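/- Let $d$ be a dimension and $0<\alpha\le\frac12$. There is a constant $C=C_{\alpha,d}>0$ such that the following holds for every viscosity $\nu>0$ and every $T\in(0,\infty]$. Let $u:[0,T)\times\mathbb{T}^d\to\mathbb{R}^d$, $\mathbb{T}^d=\mathbb{R}^d/\mathbb{Z}^d$, be a weak solution of the incompressible Navier–Stokes equations $$\partial_t u+u\cdot\nabla u+\nabla p-\nu\Delta u=0,\qquad \operatorname{div}u=0,\qquad u(0,\cdot)=u_0,$$ where $u_0$ is divergence free. Assume that $u$ belongs to the class $L^\infty_tC^\alpha_x$, and write $$\|u\|_{L^\infty_t\dot C^\alpha_x}=\operatorname*{ess\,sup}_{0<t<T}\ \sup_{y\ne z}\frac{|u(t,y)-u(t,z)|}{|y-z|^\alpha}.$$ Let $x(t)$ be a trajectory of $u$, i.e. an absolutely continuous solution of $x'(t)=u(t,x(t))$ for almost every $t\in(0,T)$. Then $x$ is differentiable at every $t\in(0,T)$, and for every $a>0$ and all $t_1,t_2\in(0,T)$ with $$t_1,\,t_2\ \ge\ a\,\|u\|_{L^\infty_t\dot C^\alpha_x}^{-\frac{2}{1+\alpha}}\,\nu^{\frac{1-\alpha}{1+\alpha}}$$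 the following estimates hold. (i) If $0<\alpha<\frac12$, then $$|x'(t_1)-x'(t_2)|\le C(a^{-1}+1)\,\|u\|_{L^\infty_t\dot C^\alpha_x}^{\frac1{1-\alpha}}\,|t_1-t_2|^{\frac{\alpha}{1-\alpha}}.$$ (ii) If $\alpha=\frac12$, then $$|x'(t_1)-x'(t_2)|\le C(a^{-1}+1)\,\|u\|_{L^\infty_t\dot C^\alpha_x}^{\frac1{1-\alpha}}\,|t_1-t_2|\,\bigl(1-\log^-(\|u\|_{L^\infty_t\dot C^\alpha_x}|t_1-t_2|)\bigr),$$ where $\log^- r=\min\{\log r,0\}$. The constant $C$ depends only on $\alpha$ and $d$; in particular it is independent of $\nu$, $a$, $T$, $u_0$ and $u$. (If $\|u\|_{L^\infty_t\dot C^\alpha_x}=0$, both sides of the estimates are $0$.) -/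

import Mathlib

open MeasureTheory Set
open scoped NNReal ENNReal ContDiff RealInnerProductSpace

noncomputable section

namespace NavierStokes

/-- The Euclidean space `ℝ^d`. Functions on the torus `𝕋^d = ℝ^d / ℤ^d` are `ℤ^d`-periodic
functions on it. -/
abbrev Space (d : ℕ) : Type := EuclideanSpace ℝ (Fin d)

/-- `f` is `ℤ^d`-periodic, that is, a function on `𝕋^d`. -/
def TorusPeriodic {d : ℕ} {F : Type*} (f : Space d → F) : Prop :=
  ∀ (i : Fin d) (x : Space d), f (x + EuclideanSpace.single i 1) = f x

/-- The fundamental cell `[0,1)^d` of the torus. -/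
def unitCell (d : ℕ) : Set (Space d) := {x | ∀ i, x i ∈ Ico (0 : ℝ) 1}

/-- The open time interval `(0,T)`, where `T = ⊤` is allowed. -/
def timeInterval (T : EReal) : Set ℝ := {t | 0 < t ∧ (t : EReal) < T}

/-- The (classical) divergence of a vector field. -/
def divergence {d : ℕ} (f : Space d → Space d) (x : Space d) : ℝ :=
  ∑ i, (fderiv ℝ f x (EuclideanSpace.single i 1)) i

/-- `div v = 0` on the torus in the sense of distributions:
`∫_{𝕋^d} v · ∇ψ = 0` for all smooth functions `ψ` on the torus. -/
def WeaklyDivFree {d : ℕ} (v : Space d → Space d) : Prop :=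
  ∀ ψ : Space d → ℝ, ContDiff ℝ ∞ ψ → TorusPeriodic ψ →
    ∫ x in unitCell d, fderiv ℝ ψ x (v x) = 0

/-- The admissible test fields: smooth, periodic and divergence free in space, and with
compact support in `[0,T)` as functions of time. -/
structure IsTestField {d : ℕ} (T : EReal) (φ : ℝ → Space d → Space d) : Prop where
  smooth : ContDiff ℝ ∞ (fun z : ℝ × Space d => φ z.1 z.2)
  periodic : ∀ t, TorusPeriodic (φ t)
  divFree : ∀ t x, divergence (φ t) x = 0
  compactSupport : ∃ S : ℝ, (S : EReal) < T ∧ ∀ t, S ≤ t → ∀ x, φ t x = 0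

/-- The norm `‖u‖_{L^∞_t Ċ^α_x}` over `(0,T) × 𝕋^d`: the essential supremum in time of the
`α`-Hölder seminorm of `u(t,·)`. -/
def holderENorm {d : ℕ} (α : ℝ≥0) (T : EReal) (u : ℝ → Space d → Space d) : ℝ≥0∞ :=
  essSup (fun t => eHolderNorm α (u t)) (volume.restrict (timeInterval T))

/-- The real number `‖u‖_{L^∞_t Ċ^α_x}`, for `u` of finite norm. -/
def holderNorm {d : ℕ} (α : ℝ≥0) (T : EReal) (u : ℝ → Space d → Space d) : ℝ :=
  (holderENorm α T u).toReal

/-- `u` is of class `L^∞_t C^α_x` on `(0,T) × 𝕋^d`. -/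
structure MemLinftyHolder {d : ℕ} (α : ℝ≥0) (T : EReal) (u : ℝ → Space d → Space d) :
    Prop where
  periodic : ∀ t ∈ timeInterval T, TorusPeriodic (u t)
  measurable : AEStronglyMeasurable (fun z : ℝ × Space d => u z.1 z.2)
    (volume.restrict (timeInterval T ×ˢ unitCell d))
  bounded : ∃ M : ℝ, ∀ᵐ t ∂(volume.restrict (timeInterval T)), ∀ x, ‖u t x‖ ≤ M
  holder : holderENorm α T u < ⊤

/-- `u` is a weak (distributional) solution on `[0,T) × 𝕋^d` of
`∂ₜu + u·∇u + ∇p - νΔu = 0`, `div u = 0`, `u(0,·) = u₀`. The pressure is eliminated by testing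
against divergence free fields; `⟪u, (∇φ) u⟫ = ∑ uᵢ uⱼ ∂ⱼ φᵢ`. -/
structure IsWeakSolution {d : ℕ} (ν : ℝ) (T : EReal) (u₀ : Space d → Space d)
    (u : ℝ → Space d → Space d) : Prop where
  initial_periodic : TorusPeriodic u₀
  initial_integrable : IntegrableOn u₀ (unitCell d)
  initial_divFree : WeaklyDivFree u₀
  divFree : ∀ᵐ t ∂(volume.restrict (timeInterval T)), WeaklyDivFree (u t)
  momentum : ∀ φ : ℝ → Space d → Space d, IsTestField T φ →
    (∫ t in timeInterval T, ∫ x in unitCell d,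
      (⟪u t x, deriv (fun s => φ s x) t⟫ + ⟪u t x, fderiv ℝ (φ t) x (u t x)⟫
        + ν * ⟪u t x, Laplacian.laplacian (φ t) x⟫))
      + ∫ x in unitCell d, ⟪u₀ x, φ 0 x⟫ = 0

/-- `x` is (the lift to `ℝ^d` of) a trajectory of `u` on `(0,T)`, that is, an absolutely continuous
solution of `x'(t) = u(t, x(t))`, written as an integral equation. In this form the notion does not
depend on the values of `u` on a null set of times; if `u` is continuous, it says that `x` is
continuously differentiable and solves the differential equation at every time. -/
def IsTrajectory {d : ℕ} (T : EReal) (u : ℝ → Space d → Space d) (x : ℝ → Space d) : Prop :=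
  ∀ s ∈ timeInterval T, ∀ t ∈ timeInterval T,
    IntervalIntegrable (fun r => u r (x r)) volume s t ∧
      x t = x s + ∫ r in s..t, u r (x r)

/-- `log⁻ r = min {log r, 0}`. -/
def logMinus (r : ℝ) : ℝ := min (Real.log r) 0

end NavierStokes

end

/-! Let U be the Hölder seminorm of u, and look at the Fourier modes of the velocity as seen from
the particle, q_k(t) = e^{2πi k·x(t)} û(t,k), with λ_k = 4π²|k|². Testing with divergence free plane
waves removes the pressure and puts the Leray symbol P in its place. Since u is divergence free, the
velocity of the particle can be subtracted from both factors of the nonlinearity: q_k' + νλ_k q_k is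
the k-th mode, at x(t), of -P div((u - u(x)) ⊗ (u - u(x))) (`char_mul_modeFlux_add`,
`exists_mode_primitive`). The flux is thus quadratic in increments, of order U²|y|^{2α} at distance
|y| from the particle. Summing the modes against e^{-λs} gives a Duhamel formula for the heat
regularised velocity along the trajectory (`ModeFlow.heatSum_sub`).

Static estimates. One expects the flux, regularised at heat time s, to be of size U² s^{α-1/2}. The
symbol P is not smooth at k = 0, but -Δ clears its denominator and leaves a cubic polynomial
(`lam_mul_leray`), for which Gaussian kernels give U² s^{α-3/2}. Integration in s from infinity,
where heat sums of mean zero vanish, recovers the flux itself (`norm_heatSum_le`). The integral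
converges if α < 1/2. If α = 1/2, the boundedness of increments on the torus supplies the decay
s^{-3/2} for large s, and a logarithm appears. `Profile` (β bounds the flux, b its Laplacian, B is a
primitive of a bound of β) and `ScaledModulus` let both cases share one argument.

Dynamics. Let δ = t₂ - t₁ and s = (Uδ)^{2/(1-α)}. If νδ ≤ s, regularise both velocities at scale
about s: the error U s^{α/2} = U(Uδ)^{α/(1-α)} and the flux contribution U²β(s)δ both have the
desired size (`abs_velocity_sub_le_of_large`). If νδ ≥ s, which means that δ is at most U^{-2/(1+α)}
ν^{(1-α)/(1+α)}, start from the velocities themselves: the flux contributes (U²/ν)B(νδ), and the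
heat flow of the slice at t₁ is controlled by its Laplacian, which Duhamel's formula bounds by
letting viscosity act on [t₀, t₁] with t₀ ≤ t₁/2 (`norm_heatSum_lamMul_mode_le`,
`abs_velocity_sub_le_of_small`). Only here is the lower bound on the times used, and it produces the
factor a⁻¹ + 1.

All this holds for times in a set of full measure; `differentiableAt_of_ae_modulus` transfers the
modulus to x' at every time. -/

noncomputable section

namespace NavierStokes

/-! ### Characters, Fourier coefficients and convolution on the torus. -/

section Characters

variable {d : ℕ}

/-- The phase `k · y`. -/
def phase (k : Fin d → ℤ) (y : Space d) : ℝ := ∑ i, (k i : ℝ) * y i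

/-- The character `e^{2πi k·y}`. -/
def char (k : Fin d → ℤ) (y : Space d) : ℂ := Complex.exp (2 * Real.pi * Complex.I * phase k y)

/-- The Fourier coefficient over the unit cell. -/
def fc (F : Space d → ℂ) (k : Fin d → ℤ) : ℂ := ∫ y in unitCell d, char (-k) y * F y

/-- The eigenvalue `4π²|k|²` of `-Δ`. -/
def lam (k : Fin d → ℤ) : ℝ := 4 * Real.pi ^ 2 * ∑ i, (k i : ℝ) ^ 2

lemma phase_add (k : Fin d → ℤ) (x y : Space d) : phase k (x + y) = phase k x + phase k y := by
  simp [phase, mul_add, Finset.sum_add_distrib]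

lemma phase_neg (k : Fin d → ℤ) (y : Space d) : phase (-k) y = -phase k y := by
  simp [phase]

lemma char_add (k : Fin d → ℤ) (x y : Space d) : char k (x + y) = char k x * char k y := by
  simp only [char, phase_add, ← Complex.exp_add]
  push_cast
  ring_nf

lemma char_eq_exp_mul_I (k : Fin d → ℤ) (y : Space d) :
    char k y = Complex.exp (((2 * Real.pi * phase k y : ℝ) : ℂ) * Complex.I) := by
  rw [char]; push_cast; ring_nf

@[simp] lemma norm_char (k : Fin d → ℤ) (y : Space d) : ‖char k y‖ = 1 := by
  rw [char_eq_exp_mul_I, Complex.norm_exp_ofReal_mul_I]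

@[fun_prop] lemma continuous_phase (k : Fin d → ℤ) : Continuous (phase k) := by
  unfold phase; fun_prop

@[fun_prop] lemma continuous_char (k : Fin d → ℤ) : Continuous (char k) := by
  unfold char; fun_prop

@[simp] lemma char_zero (y : Space d) : char 0 y = 1 := by simp [char, phase]

lemma TorusPeriodic.add_sum {F : Type*} {f : Space d → F} (hf : TorusPeriodic f)
    (s : Finset (Fin d)) (n : Fin d → ℤ) (x : Space d) :
    f (x + ∑ i ∈ s, n i • EuclideanSpace.single i (1 : ℝ)) = f x := by
  classical
  induction s using Finset.induction_on generalizing x with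
  | empty => simp
  | insert i s hi ih =>
    rw [Finset.sum_insert hi, ← add_assoc, ih]
    exact (Function.Periodic.zsmul (fun x => hf i x) (n i)) x

/-- A periodic function takes the same value at points that differ by a lattice vector. -/
lemma TorusPeriodic.eq_of_sub_int {F : Type*} {f : Space d → F} (hf : TorusPeriodic f)
    {x y : Space d} {n : Fin d → ℤ} (h : ∀ i, y i = x i + n i) : f y = f x := by
  rw [← hf.add_sum Finset.univ n x]
  congr 1
  ext j
  simp [h j, Finset.sum_apply, Pi.single_apply]

/-- The projection to the torus. -/
def toTorus (y : Space d) : UnitAddTorus (Fin d) := fun i => (y i : UnitAddCircle)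

@[fun_prop] lemma continuous_toTorus : Continuous (toTorus (d := d)) := by
  unfold toTorus
  refine continuous_pi fun i => ?_
  exact (AddCircle.continuous_mk' 1).comp (by fun_prop)

/-- A product of open quotient maps is again an open quotient map. This lets continuous periodic
functions descend to the torus. -/
lemma isQuotientMap_toTorus : Topology.IsQuotientMap (toTorus (d := d)) := by
  have h1 : IsOpenQuotientMap (fun (y : Fin d → ℝ) (i : Fin d) => (y i : UnitAddCircle)) :=
    IsOpenQuotientMap.piMap (f := fun _ => fun (y : ℝ) => (y : UnitAddCircle))
      fun _ => QuotientAddGroup.isOpenQuotientMap_mk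
  exact h1.isQuotientMap.comp (EuclideanSpace.equiv (Fin d) ℝ).toHomeomorph.isQuotientMap

/-- Gives access to the density of trigonometric polynomials in the continuous functions on the
torus, and to the sup norm as a bound for periodic functions. -/
lemma exists_lift {F : Space d → ℂ} (hc : Continuous F) (hp : TorusPeriodic F) :
    ∃ f : C(UnitAddTorus (Fin d), ℂ), ∀ y, f (toTorus y) = F y := by
  have hq : Topology.IsQuotientMap (⟨toTorus, continuous_toTorus⟩ : C(Space d, UnitAddTorus (Fin d))) :=
    isQuotientMap_toTorus
  have hfib : ∀ a b : Space d, toTorus a = toTorus b → F a = F b := fun a b h => by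
    have h' : ∀ i, ∃ n : ℤ, a i = b i + n := fun i => by
      have h0 : ((a i - b i : ℝ) : UnitAddCircle) = 0 := by
        rw [AddCircle.coe_sub, sub_eq_zero]; exact congrFun h i
      obtain ⟨n, hn⟩ := (AddCircle.coe_eq_zero_iff 1).mp h0
      exact ⟨n, by rw [zsmul_one] at hn; linarith⟩
    choose n hn using h'
    exact hp.eq_of_sub_int hn
  refine ⟨hq.lift ⟨F, hc⟩ (fun a b h => hfib a b h), fun y => ?_⟩
  exact congrArg (fun g => g y) (hq.lift_comp ⟨F, hc⟩ (fun a b h => hfib a b h))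

lemma mFourier_toTorus (k : Fin d → ℤ) (y : Space d) :
    UnitAddTorus.mFourier k (toTorus y) = char k y := by
  simp only [UnitAddTorus.mFourier, ContinuousMap.coe_mk, toTorus, fourier_coe_apply, char, phase,
    ← Complex.exp_sum]
  congr 1
  push_cast
  rw [Finset.mul_sum]
  refine Finset.sum_congr rfl fun i _ => by ring

/-- The torus integral is computed over half-open cubes closed on the other side; the two cubes
differ by a null set. -/
lemma unitCell_ae_eq : (WithLp.toLp 2 ⁻¹' unitCell d : Set (Fin d → ℝ)) =ᵐ[volume]
    {x : Fin d → ℝ | ∀ i, x i ∈ Ioc (0 : ℝ) (0 + 1)} := by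
  have h1 : (WithLp.toLp 2 ⁻¹' unitCell d : Set (Fin d → ℝ)) = univ.pi fun i => Ico ((0 : Fin d → ℝ) i) ((1 : Fin d → ℝ) i) := by
    ext; simp [unitCell]
  have h2 : {x : Fin d → ℝ | ∀ i, x i ∈ Ioc (0 : ℝ) (0 + 1)} = univ.pi fun i => Ioc ((0 : Fin d → ℝ) i) ((1 : Fin d → ℝ) i) := by
    ext; simp 
  rw [h1, h2]
  exact Measure.univ_pi_Ico_ae_eq_Icc.trans Measure.univ_pi_Ioc_ae_eq_Icc.symm

lemma measurableSet_unitCell : MeasurableSet (unitCell d) := by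
  have : unitCell d = ⋂ i, {x : Space d | x i ∈ Ico (0 : ℝ) 1} := by
    ext; simp [unitCell]
  rw [this]
  exact MeasurableSet.iInter fun i => measurableSet_Ico.preimage (by fun_prop)

lemma setIntegral_unitCell {E : Type*} [NormedAddCommGroup E] [NormedSpace ℝ E]
    (F : Space d → E) :
    ∫ y in unitCell d, F y = ∫ y in {x : Fin d → ℝ | ∀ i, x i ∈ Ioc (0 : ℝ) (0 + 1)},
      F (WithLp.toLp 2 y) := by
  rw [← setIntegral_congr_set unitCell_ae_eq,
    (PiLp.volume_preserving_toLp (Fin d)).setIntegral_preimage_emb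
      (MeasurableEquiv.toLp 2 (Fin d → ℝ)).measurableEmbedding]

lemma volume_unitCell : volume (unitCell d) = 1 := by
  rw [← (PiLp.volume_preserving_toLp (Fin d)).measure_preimage
    measurableSet_unitCell.nullMeasurableSet, measure_congr unitCell_ae_eq]
  have h2 : {x : Fin d → ℝ | ∀ i, x i ∈ Ioc (0 : ℝ) (0 + 1)} = univ.pi fun i => Ioc (0:ℝ) 1 := by
    ext; simp 
  rw [h2, volume_pi_pi]
  simp

instance : IsProbabilityMeasure (volume.restrict (unitCell d)) :=
  ⟨by rw [Measure.restrict_apply_univ, volume_unitCell]⟩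

lemma fc_eq_mFourierCoeff {F : Space d → ℂ} {f : C(UnitAddTorus (Fin d), ℂ)}
    (h : ∀ y, f (toTorus y) = F y) (k : Fin d → ℤ) :
    fc F k = UnitAddTorus.mFourierCoeff f k := by
  rw [UnitAddTorus.mFourierCoeff_eq_integral f k 0, fc, setIntegral_unitCell]
  refine integral_congr_ae (ae_of_all _ fun y => ?_)
  simp only [smul_eq_mul]
  rw [← h, ← mFourier_toTorus]
  rfl

lemma mFourierCoeff_mFourier (n k : Fin d → ℤ) :
    UnitAddTorus.mFourierCoeff (UnitAddTorus.mFourier n) k = if n = k then 1 else 0 := by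
  have := (orthonormal_iff_ite.mp (UnitAddTorus.orthonormal_mFourier (d := Fin d))) k n
  rw [ContinuousMap.inner_toLp] at this
  rw [UnitAddTorus.mFourierCoeff]
  simp only [UnitAddTorus.mFourier_neg, smul_eq_mul]
  simp_rw [eq_comm (a := n), ← this, mul_comm]

lemma integrable_unitCell {E : Type*} [NormedAddCommGroup E] {F : Space d → E}
    (hF : Continuous F) : IntegrableOn F (unitCell d) := by
  have hc : IsCompact (WithLp.toLp 2 '' (Icc (0 : Fin d → ℝ) 1) : Set (Space d)) :=
    isCompact_Icc.image (PiLp.continuous_toLp 2 _)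
  refine (hF.continuousOn.integrableOn_compact hc).mono_set fun y hy => ?_
  exact ⟨WithLp.ofLp y, ⟨fun i => (hy i).1, fun i => (hy i).2.le⟩, by simp⟩

lemma norm_fc_le {F : Space d → ℂ} {K : ℝ} (hF : ∀ y, ‖F y‖ ≤ K) (k : Fin d → ℤ) :
    ‖fc F k‖ ≤ K := by
  have := norm_integral_le_of_norm_le_const (μ := volume.restrict (unitCell d))
    (f := fun y => char (-k) y * F y) (C := K) (ae_of_all _ fun y => by simpa using hF y)
  simpa [fc] using this

/-- Convolution of a periodic function with an integrable kernel, computed through Fourier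
coefficients. -/
theorem integral_kernel_mul_eq_tsum {Θ : Space d → ℂ} (hΘ : Integrable Θ)
    (hs : Summable fun k => ∫ y, Θ y * char k y) {F : Space d → ℂ} (hc : Continuous F)
    (hp : TorusPeriodic F) (x : Space d) :
    ∫ y, Θ y * F (x + y) = ∑' k, (∫ y, Θ y * char k y) * (char k x * fc F k) := by
  obtain ⟨f, hf⟩ := exists_lift hc hp
  set c : (Fin d → ℤ) → ℂ := fun k => ∫ y, Θ y * char k y with hcdef
  have hint : ∀ f : C(UnitAddTorus (Fin d), ℂ),
      Integrable fun y => Θ y * f (toTorus (x + y)) := fun f =>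
    hΘ.mul_bdd (c := ‖f‖) (by fun_prop) (ae_of_all _ fun y => f.norm_coe_le_norm _)
  let L1 : C(UnitAddTorus (Fin d), ℂ) →L[ℂ] ℂ := LinearMap.mkContinuous
    { toFun := fun f => ∫ y, Θ y * f (toTorus (x + y))
      map_add' := fun f g => by
        simp only [ContinuousMap.add_apply, mul_add]
        exact integral_add (hint f) (hint g)
      map_smul' := fun a f => by
        simp only [ContinuousMap.smul_apply, smul_eq_mul, RingHom.id_apply, mul_left_comm _ a]
        exact integral_const_mul _ _ } (∫ y, ‖Θ y‖) fun f => by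
      rw [LinearMap.coe_mk, AddHom.coe_mk, ← integral_mul_const]
      refine norm_integral_le_of_norm_le (hΘ.norm.mul_const _) (ae_of_all _ fun y => ?_)
      rw [norm_mul]
      gcongr
      exact f.norm_coe_le_norm _
  have hcoeff : ∀ (f : C(UnitAddTorus (Fin d), ℂ)) k, ‖UnitAddTorus.mFourierCoeff f k‖ ≤ ‖f‖ := by
    intro f k
    rw [← fc_eq_mFourierCoeff (F := fun y => f (toTorus y)) (fun _ => rfl)]
    exact norm_fc_le (fun y => f.norm_coe_le_norm _) k
  have hsum : ∀ f : C(UnitAddTorus (Fin d), ℂ),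
      Summable fun k => c k * (char k x * UnitAddTorus.mFourierCoeff f k) := fun f =>
    Summable.of_norm_bounded (hs.norm.mul_right ‖f‖) fun k => by
      simp only [norm_mul, norm_char, one_mul]
      gcongr
      exact hcoeff f k
  have hfi : ∀ (f : C(UnitAddTorus (Fin d), ℂ)) k, IntegrableOn
      (fun y => char (-k) y * f (toTorus y)) (unitCell d) := fun f k =>
    integrable_unitCell (by fun_prop)
  let L2 : C(UnitAddTorus (Fin d), ℂ) →L[ℂ] ℂ := LinearMap.mkContinuous
    { toFun := fun f => ∑' k, c k * (char k x * UnitAddTorus.mFourierCoeff f k)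
      map_add' := fun f g => by
        rw [← (hsum f).tsum_add (hsum g)]
        refine tsum_congr fun k => ?_
        have : UnitAddTorus.mFourierCoeff (f + g) k
            = UnitAddTorus.mFourierCoeff f k + UnitAddTorus.mFourierCoeff g k := by
          simp only [← fc_eq_mFourierCoeff (F := fun y => _) (fun _ => rfl), fc]
          rw [← integral_add (hfi f k) (hfi g k)]
          simp [mul_add]
        rw [this]
        ring
      map_smul' := fun a f => by
        rw [RingHom.id_apply, smul_eq_mul, ← tsum_mul_left]
        refine tsum_congr fun k => ?_
        have : UnitAddTorus.mFourierCoeff (a • f) k = a * UnitAddTorus.mFourierCoeff f k := by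
          simp only [← fc_eq_mFourierCoeff (F := fun y => _) (fun _ => rfl), fc]
          rw [← integral_const_mul]
          simp [mul_left_comm]
        rw [this]
        ring } (∑' k, ‖c k‖) fun f => by
      rw [LinearMap.coe_mk, AddHom.coe_mk, ← tsum_mul_right]
      refine tsum_of_norm_bounded (hs.norm.mul_right ‖f‖).hasSum fun k => ?_
      simp only [norm_mul, norm_char, one_mul]
      gcongr
      exact hcoeff f k
  -- Both sides are bounded functionals of f in the sup norm, so it suffices to compare them on
  -- characters, whose span is dense.
  have hL : L1 = L2 := by
    refine ContinuousLinearMap.ext_on (s := range UnitAddTorus.mFourier)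
      (Submodule.dense_iff_topologicalClosure_eq_top.mpr
        UnitAddTorus.span_mFourier_closure_eq_top) ?_
    rintro _ ⟨n, rfl⟩
    change ∫ y, Θ y * UnitAddTorus.mFourier n (toTorus (x + y)) =
      ∑' k, c k * (char k x * UnitAddTorus.mFourierCoeff (UnitAddTorus.mFourier n) k)
    simp only [mFourierCoeff_mFourier, mFourier_toTorus, char_add]
    rw [tsum_eq_single n (fun k hk => by simp [hk.symm])]
    simp only [if_true, mul_one, hcdef]
    rw [← integral_mul_const]
    refine integral_congr_ae (ae_of_all _ fun y => by ring)
  have := congrArg (fun L => L f) hL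
  change ∫ y, Θ y * f (toTorus (x + y)) =
      ∑' k, c k * (char k x * UnitAddTorus.mFourierCoeff f k) at this
  simp only [hf, ← fc_eq_mFourierCoeff hf] at this
  exact this

end Characters

/-! ### One-dimensional kernels with symbol polynomial times Gaussian. -/

section GaussianKernels

variable {d : ℕ}

/-- One term of the exponential series of y²/8 dominates y^{2n}, and |y|^n ≤ 1 + y^{2n}. -/
lemma exists_abs_pow_mul_exp_le (n : ℕ) :
    ∃ C : ℝ, 0 ≤ C ∧ ∀ y : ℝ, |y| ^ n * Real.exp (-y ^ 2 / 8) ≤ C := by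
  refine ⟨1 + 8 ^ n * n.factorial, by positivity, fun y => ?_⟩
  have h1 : |y| ^ n ≤ 1 + y ^ (2 * n) := by
    rcases le_total |y| 1 with h | h
    · have := pow_le_one₀ (abs_nonneg y) h (n := n)
      have : 0 ≤ y ^ (2 * n) := by rw [pow_mul]; positivity
      linarith
    · have : |y| ^ n ≤ |y| ^ (2 * n) := pow_le_pow_right₀ h (by omega)
      rw [pow_mul |y|, sq_abs, ← pow_mul] at this
      linarith
  have h2 : y ^ (2 * n) ≤ 8 ^ n * n.factorial * Real.exp (y ^ 2 / 8) := by
    have := Real.pow_div_factorial_le_exp (y ^ 2 / 8) (by positivity) n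
    rw [div_pow, ← pow_mul, div_div, div_le_iff₀ (by positivity)] at this
    linarith
  have h3 : 1 ≤ Real.exp (y ^ 2 / 8) := Real.one_le_exp (by positivity)
  rw [neg_div, Real.exp_neg, mul_inv_le_iff₀ (Real.exp_pos _)]
  nlinarith

/-- Since e^{-y²/4} is the square of e^{-y²/8}, one factor absorbs the polynomial and the other
remains. -/
lemma exists_norm_poly_mul_exp_le (p : Polynomial ℂ) :
    ∃ C : ℝ, 0 ≤ C ∧ ∀ y : ℝ, ‖p.eval (y : ℂ) * Complex.exp (-(y : ℂ) ^ 2 / 4)‖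
      ≤ C * Real.exp (-y ^ 2 / 8) := by
  have hexp : ∀ y : ℝ, ‖Complex.exp (-(y : ℂ) ^ 2 / 4)‖
      = Real.exp (-y ^ 2 / 8) * Real.exp (-y ^ 2 / 8) := fun y => by
    rw [← Real.exp_add, Complex.norm_exp]
    congr 1
    have : (-(y : ℂ) ^ 2 / 4) = ((-y ^ 2 / 4 : ℝ) : ℂ) := by push_cast; ring
    rw [this, Complex.ofReal_re]; ring
  induction p using Polynomial.induction_on' with
  | add p q hp hq =>
    obtain ⟨C, hC, h⟩ := hp
    obtain ⟨D, hD, h'⟩ := hq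
    refine ⟨C + D, by positivity, fun y => ?_⟩
    rw [Polynomial.eval_add, add_mul, add_mul]
    exact (norm_add_le _ _).trans (add_le_add (h y) (h' y))
  | monomial n a =>
    obtain ⟨C, hC, h⟩ := exists_abs_pow_mul_exp_le n
    refine ⟨‖a‖ * C, by positivity, fun y => ?_⟩
    rw [norm_mul, hexp, Polynomial.eval_monomial, norm_mul, norm_pow, Complex.norm_real,
      Real.norm_eq_abs, ← mul_assoc, mul_assoc ‖a‖]
    gcongr
    exact h y

lemma integrable_exp_neg_sq_div_eight : Integrable fun y : ℝ => Real.exp (-y ^ 2 / 8) := by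
  have := integrable_exp_neg_mul_sq (b := 1 / 8) (by norm_num)
  refine this.congr (ae_of_all _ fun y => ?_)
  simp only; congr 1; ring

lemma integrable_poly_mul_exp_mul (p : Polynomial ℂ) {g : ℝ → ℂ} (hg : Continuous g)
    {K : ℝ} (hK : ∀ y, ‖g y‖ ≤ K) :
    Integrable fun y : ℝ => p.eval (y : ℂ) * Complex.exp (-(y : ℂ) ^ 2 / 4) * g y := by
  obtain ⟨C, hC, h⟩ := exists_norm_poly_mul_exp_le p
  have hp : Continuous fun y : ℝ => p.eval (y : ℂ) :=
    p.continuous.comp Complex.continuous_ofReal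
  refine Integrable.mono' ((integrable_exp_neg_sq_div_eight.const_mul C).mul_const K)
    (by fun_prop) (ae_of_all _ fun y => ?_)
  rw [norm_mul]
  exact mul_le_mul (h y) (hK y) (norm_nonneg _) (by positivity)

lemma norm_exp_two_pi_mul (ξ y : ℝ) : ‖Complex.exp (2 * Real.pi * Complex.I * (ξ * y))‖ = 1 := by
  have : (2 * Real.pi * Complex.I * (ξ * y) : ℂ)
      = ((2 * Real.pi * (ξ * y) : ℝ) : ℂ) * Complex.I := by push_cast; ring
  rw [this, Complex.norm_exp_ofReal_mul_I]

/-- A Hermite-type function whose Fourier transform is `ξ ^ m * exp (-4π²ξ²)`. -/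
lemma exists_hermite (m : ℕ) : ∃ p : Polynomial ℂ, ∀ ξ : ℝ,
    ∫ y : ℝ, p.eval (y : ℂ) * Complex.exp (-(y : ℂ) ^ 2 / 4)
      * Complex.exp (2 * Real.pi * Complex.I * (ξ * y))
      = (ξ : ℂ) ^ m * Complex.exp (-(4 * Real.pi ^ 2 * ξ ^ 2)) := by
  have hpi : (Real.pi : ℂ) ≠ 0 := Complex.ofReal_ne_zero.mpr Real.pi_ne_zero
  induction m with
  | zero =>
    refine ⟨Polynomial.C (((Real.pi / (1 / 4) : ℂ) ^ (1 / 2 : ℂ))⁻¹), fun ξ => ?_⟩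
    have h := fourierIntegral_gaussian (b := 1 / 4) (by norm_num) (2 * Real.pi * ξ)
    have h0 : (Real.pi / (1 / 4) : ℂ) ^ (1 / 2 : ℂ) ≠ 0 := by
      rw [Complex.cpow_ne_zero_iff]; left; simp [hpi]
    simp only [Polynomial.eval_C, mul_assoc]
    rw [integral_const_mul, inv_mul_eq_iff_eq_mul₀ h0]
    convert! h using 2
    · ext y; rw [mul_comm]; congr 2 <;> ring
    · rw [pow_zero, one_mul]; congr 1; ring
  | succ m ih =>
    obtain ⟨p, hp⟩ := ih
    -- With q = p' - yp/2, the function q e^{-y²/4} is the derivative of p e^{-y²/4}. Integration by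
    -- parts multiplies the transform by -2πiξ, and the prefactor i/(2π) turns this into ξ.
    refine ⟨Polynomial.C (Complex.I / (2 * Real.pi)) *
      (p.derivative - Polynomial.C (1 / 2) * Polynomial.X * p), fun ξ => ?_⟩
    set q := p.derivative - Polynomial.C (1 / 2) * Polynomial.X * p with hq
    have hderiv : ∀ y : ℝ, HasDerivAt
        (fun y : ℝ => p.eval (y : ℂ) * Complex.exp (-(y : ℂ) ^ 2 / 4))
        (q.eval (y : ℂ) * Complex.exp (-(y : ℂ) ^ 2 / 4)) y := fun y => by
      have h1 : HasDerivAt (fun z : ℂ => p.eval z * Complex.exp (-z ^ 2 / 4))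
          (q.eval (y : ℂ) * Complex.exp (-(y : ℂ) ^ 2 / 4)) (y : ℂ) := by
        have h2 : HasDerivAt (fun z : ℂ => -z ^ 2 / 4) (-(y : ℂ) / 2) (y : ℂ) := by
          have := ((hasDerivAt_pow 2 (y : ℂ)).neg).div_const 4
          convert! this using 1; push_cast; ring
        convert! (p.hasDerivAt (y : ℂ)).mul h2.cexp using 1
        simp [hq]; ring
      exact h1.comp_ofReal
    have hderiv2 : ∀ y : ℝ, HasDerivAt
        (fun y : ℝ => Complex.exp (2 * Real.pi * Complex.I * (ξ * y)))
        (2 * Real.pi * Complex.I * ξ * Complex.exp (2 * Real.pi * Complex.I * (ξ * y))) y := by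
      intro y
      have h1 : HasDerivAt (fun z : ℂ => 2 * Real.pi * Complex.I * (ξ * z))
          (2 * Real.pi * Complex.I * ξ) (y : ℂ) := by
        have := (hasDerivAt_id (y : ℂ)).const_mul (2 * Real.pi * Complex.I * ξ)
        convert! this using 1
        · ext z; simp; ring
        · simp
      convert! h1.cexp.comp_ofReal using 1
      ring
    have hb := fun y => (norm_exp_two_pi_mul ξ y).le
    have key := integral_mul_deriv_eq_deriv_mul_of_integrable
      (u := fun y : ℝ => p.eval (y : ℂ) * Complex.exp (-(y : ℂ) ^ 2 / 4))
      (v := fun y : ℝ => Complex.exp (2 * Real.pi * Complex.I * (ξ * y)))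
      (fun y _ => hderiv y) (fun y _ => hderiv2 y)
      (integrable_poly_mul_exp_mul p (K := ‖2 * Real.pi * Complex.I * ξ‖) (by fun_prop)
        fun y => by rw [norm_mul _ (Complex.exp _), norm_exp_two_pi_mul, mul_one])
      (integrable_poly_mul_exp_mul q (by fun_prop) hb)
      (integrable_poly_mul_exp_mul p (by fun_prop) hb)
    simp only [mul_left_comm _ (2 * Real.pi * Complex.I * ξ)] at key
    rw [integral_const_mul, hp] at key
    simp only [Polynomial.eval_mul, Polynomial.eval_C, mul_assoc]
    rw [integral_const_mul]
    simp only [mul_assoc] at key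
    rw [← neg_eq_iff_eq_neg.mpr key.symm.symm]
    field_simp
    ring_nf
    simp [Complex.I_sq]

/-- One-dimensional heat kernel derivatives, at scale `r`. -/
lemma exists_kernel_one (m : ℕ) : ∃ C : ℝ, 0 ≤ C ∧ ∀ r : ℝ, 0 < r → ∃ θ : ℝ → ℂ, Continuous θ ∧
    (∀ y, ‖θ y‖ ≤ C * (r ^ m)⁻¹ * (r⁻¹ * Real.exp (-(r⁻¹ * y) ^ 2 / 8))) ∧
    ∀ ξ : ℝ, ∫ y : ℝ, θ y * Complex.exp (2 * Real.pi * Complex.I * (ξ * y))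
      = (((ξ ^ m * Real.exp (-(4 * Real.pi ^ 2 * ξ ^ 2 * r ^ 2)) : ℝ)) : ℂ) := by
  obtain ⟨p, hp⟩ := exists_hermite m
  obtain ⟨C, hC, h⟩ := exists_norm_poly_mul_exp_le p
  have hpc : Continuous fun y : ℝ => p.eval (y : ℂ) :=
    p.continuous.comp Complex.continuous_ofReal
  -- Dilation by r replaces ξ by rξ in the symbol; r⁻¹ preserves the integral and r^{-m} restores
  -- the monomial ξ^m.
  refine ⟨C, hC, fun r hr => ⟨fun y => ((r ^ m)⁻¹ * r⁻¹ : ℝ) *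
    (p.eval ((r⁻¹ * y : ℝ) : ℂ) * Complex.exp (-((r⁻¹ * y : ℝ) : ℂ) ^ 2 / 4)), ?_, ?_, ?_⟩⟩
  · have : Continuous fun y : ℝ => p.eval ((r⁻¹ * y : ℝ) : ℂ) := hpc.comp (by fun_prop)
    fun_prop
  · intro y
    rw [norm_mul, Complex.norm_real, Real.norm_of_nonneg (by positivity)]
    calc _ ≤ (r ^ m)⁻¹ * r⁻¹ * (C * Real.exp (-(r⁻¹ * y) ^ 2 / 8)) := by
          gcongr; exact h _
      _ = _ := by ring
  · intro ξ
    have := Measure.integral_comp_mul_left (fun y : ℝ => p.eval (y : ℂ)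
      * Complex.exp (-(y : ℂ) ^ 2 / 4) * Complex.exp (2 * Real.pi * Complex.I * ((ξ * r : ℝ) * y))) r⁻¹
    rw [hp, inv_inv, abs_of_pos hr] at this
    have e : ∀ y : ℝ, ((r ^ m)⁻¹ * r⁻¹ : ℝ) *
        (p.eval ((r⁻¹ * y : ℝ) : ℂ) * Complex.exp (-((r⁻¹ * y : ℝ) : ℂ) ^ 2 / 4)) *
          Complex.exp (2 * Real.pi * Complex.I * (ξ * y)) = ((r ^ m)⁻¹ * r⁻¹ : ℝ) *
        (p.eval ((r⁻¹ * y : ℝ) : ℂ) * Complex.exp (-((r⁻¹ * y : ℝ) : ℂ) ^ 2 / 4) *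
          Complex.exp (2 * Real.pi * Complex.I * ((ξ * r : ℝ) * (r⁻¹ * y : ℝ)))) := fun y => by
      have : ((ξ * r : ℝ) : ℂ) * (r⁻¹ * y : ℝ) = ξ * y := by
        rw [← Complex.ofReal_mul, ← Complex.ofReal_mul]; congr 1; field_simp
      rw [this, mul_assoc]
    simp only [e]
    rw [integral_const_mul, this, Complex.real_smul]
    have hr' : (r : ℂ) ≠ 0 := Complex.ofReal_ne_zero.mpr hr.ne'
    push_cast
    rw [mul_pow, mul_pow]
    field_simp

end GaussianKernels

/-! ### Kernels in dimension d and Gaussian-weighted Fourier series. -/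

section KernelSums

variable {d : ℕ}

/-- A finite set of multi-indices lies in the box of its projections, over which the sum of products
factorises. -/
lemma summable_prod_of_nonneg {ι κ : Type*} [Fintype ι] [DecidableEq ι] {f : ι → κ → ℝ}
    (h0 : ∀ i n, 0 ≤ f i n) (hf : ∀ i, Summable (f i)) :
    Summable fun k : ι → κ => ∏ i, f i (k i) := by
  classical
  refine summable_of_sum_le (c := ∏ i, ∑' n, f i n)
    (fun k => Finset.prod_nonneg fun i _ => h0 i _) fun s => ?_
  have hsub : s ⊆ Fintype.piFinset fun i => s.image fun k => k i := fun k hk =>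
    Fintype.mem_piFinset.mpr fun i => Finset.mem_image_of_mem _ hk
  calc ∑ k ∈ s, ∏ i, f i (k i)
      ≤ ∑ k ∈ Fintype.piFinset fun i => s.image fun k => k i, ∏ i, f i (k i) :=
        Finset.sum_le_sum_of_subset_of_nonneg hsub fun k _ _ =>
          Finset.prod_nonneg fun i _ => h0 i _
    _ = ∏ i, ∑ n ∈ s.image fun k => k i, f i n := (Finset.prod_univ_sum _ _).symm
    _ ≤ ∏ i, ∑' n, f i n := Finset.prod_le_prod
        (fun i _ => Finset.sum_nonneg fun n _ => h0 i n)
        fun i _ => (hf i).sum_le_tsum _ fun n _ => h0 i n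

/-- The monomial `∏ kᵢ ^ mᵢ`. -/
def monom (m : Fin d → ℕ) (k : Fin d → ℤ) : ℝ := ∏ i, (k i : ℝ) ^ m i

lemma exp_neg_lam_mul (k : Fin d → ℤ) (σ : ℝ) :
    Real.exp (-(lam k * σ)) = ∏ i, Real.exp (-(4 * Real.pi ^ 2 * (k i : ℝ) ^ 2 * σ)) := by
  rw [← Real.exp_sum, lam, Finset.mul_sum, Finset.sum_mul, Finset.sum_neg_distrib]

lemma summable_abs_monom_mul_exp (m : Fin d → ℕ) {σ : ℝ} (hσ : 0 < σ) :
    Summable fun k : Fin d → ℤ => |monom m k| * Real.exp (-(lam k * σ)) := by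
  have h1 : ∀ i, Summable fun n : ℤ =>
      |(n : ℝ)| ^ m i * Real.exp (-(4 * Real.pi ^ 2 * (n : ℝ) ^ 2 * σ)) := fun i => by
    -- The one-dimensional sum is a majorant of the theta series at z = 0, with imaginary part 4πσ.
    have := summable_pow_mul_jacobiTheta₂_term_bound 0 (T := 4 * Real.pi * σ) (by positivity) (m i)
    refine this.congr fun n => ?_
    push_cast
    congr 2
    ring
  refine (summable_prod_of_nonneg (fun i n => by positivity) h1).congr fun k => ?_
  rw [Finset.prod_mul_distrib, ← exp_neg_lam_mul, monom, Finset.abs_prod]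
  simp_rw [abs_pow]

lemma integrable_exp_neg_norm_sq {b : ℝ} (hb : 0 < b) :
    Integrable fun y : Space d => Real.exp (-b * ‖y‖ ^ 2) := by
  have := (GaussianFourier.integrable_cexp_neg_mul_sq_norm_add (V := Space d)
    (b := (b : ℂ)) (by simpa using hb) 0 0).norm
  refine this.congr (ae_of_all _ fun y => ?_)
  simp only [zero_mul, add_zero, Complex.norm_exp]
  congr 1
  rw [← Complex.ofReal_neg, ← Complex.ofReal_pow, ← Complex.ofReal_mul, Complex.ofReal_re]

lemma integrable_rpow_norm_mul_exp {β : ℝ} (h0 : 0 ≤ β) (h1 : β ≤ 1) :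
    Integrable fun y : Space d => ‖y‖ ^ β * Real.exp (-‖y‖ ^ 2 / 8) := by
  -- Half of the Gaussian absorbs the power: ‖y‖^β ≤ 1 + ‖y‖ ≤ 5(1 + ‖y‖²/16) ≤ 5 e^{‖y‖²/16}.
  refine Integrable.mono' ((integrable_exp_neg_norm_sq (d := d) (b := 1 / 16)
    (by norm_num)).const_mul 5) ?_ (ae_of_all _ fun y => ?_)
  · refine Continuous.aestronglyMeasurable ?_
    have := (continuous_norm (E := Space d)).rpow_const (p := β) fun _ => Or.inr h0
    fun_prop
  · rw [Real.norm_of_nonneg (by positivity)]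
    have hs : -‖y‖ ^ 2 / 8 = -(‖y‖ ^ 2 / 16) + -(1 / 16) * ‖y‖ ^ 2 := by ring
    rw [hs, Real.exp_add, ← mul_assoc]
    gcongr
    rw [Real.exp_neg, mul_inv_le_iff₀ (Real.exp_pos _)]
    have h2 : ‖y‖ ^ β ≤ 1 + ‖y‖ := by
      rcases le_total ‖y‖ 1 with h | h
      · linarith [Real.rpow_le_one (norm_nonneg y) h h0, norm_nonneg y]
      · have := Real.rpow_le_rpow_of_exponent_le h h1
        rw [Real.rpow_one] at this
        linarith
    have := Real.add_one_le_exp (‖y‖ ^ 2 / 16)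
    nlinarith [sq_nonneg (‖y‖ - 3), norm_nonneg y]

/-- Kernels on `ℝ^d` with symbol `∏ kᵢ ^ mᵢ exp (-4π²|k|²r²)`. -/
lemma exists_kernel (m : Fin d → ℕ) : ∃ C : ℝ, 0 ≤ C ∧ ∀ r : ℝ, 0 < r → ∃ Θ : Space d → ℂ,
    Continuous Θ ∧
    (∀ y, ‖Θ y‖ ≤ C * (r ^ (∑ i, m i))⁻¹ * ((r ^ d)⁻¹ * Real.exp (-‖r⁻¹ • y‖ ^ 2 / 8))) ∧
    ∀ k, ∫ y, Θ y * char k y = ((monom m k * Real.exp (-(lam k * r ^ 2)) : ℝ) : ℂ) := by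
  choose C hC h using fun i => exists_kernel_one (m i)
  refine ⟨∏ i, C i, Finset.prod_nonneg fun i _ => hC i, fun r hr => ?_⟩
  choose θ hθc hθb hθ using fun i => h i r hr
  refine ⟨fun y => ∏ i, θ i (y i), ?_, fun y => ?_, fun k => ?_⟩
  · refine continuous_finsetProd _ fun i _ => (hθc i).comp (by fun_prop)
  · rw [norm_prod]
    refine (Finset.prod_le_prod (fun i _ => norm_nonneg _) fun i _ => hθb i (y i)).trans_eq ?_
    rw [Finset.prod_mul_distrib, Finset.prod_mul_distrib, Finset.prod_mul_distrib,
      Finset.prod_inv_distrib, Finset.prod_pow_eq_pow_sum, Finset.prod_const, Finset.card_univ,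
      Fintype.card_fin, ← Real.exp_sum, EuclideanSpace.norm_sq_eq, inv_pow]
    congr 3
    rw [← Finset.sum_div, ← Finset.sum_neg_distrib]
    simp [mul_pow]
  · rw [← (PiLp.volume_preserving_toLp (Fin d)).integral_comp
      (MeasurableEquiv.toLp 2 (Fin d → ℝ)).measurableEmbedding]
    have : ∀ y : Fin d → ℝ, (∏ i, θ i ((WithLp.toLp 2 y : Space d) i)) * char k (WithLp.toLp 2 y)
        = ∏ i, θ i (y i) * Complex.exp (2 * Real.pi * Complex.I * (((k i : ℝ) : ℂ) * y i)) := by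
      intro y
      rw [Finset.prod_mul_distrib, ← Complex.exp_sum, ← Finset.mul_sum, char, phase]
      push_cast
      rfl
    simp only [this]
    rw [integral_fintype_prod_volume_eq_prod
      (f := fun i (y : ℝ) => θ i y * Complex.exp (2 * Real.pi * Complex.I * (((k i : ℝ) : ℂ) * y)))]
    simp only [hθ]
    rw [← Complex.ofReal_prod, Finset.prod_mul_distrib, exp_neg_lam_mul, monom]

/-- The Gaussian-weighted Fourier series of a function that vanishes at `x` to order `β`. -/
theorem exists_norm_tsum_monom_le (m : Fin d → ℕ) {β : ℝ} (h0 : 0 ≤ β) (h1 : β ≤ 1) :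
    ∃ C : ℝ, 0 ≤ C ∧ ∀ (F : Space d → ℂ) (x : Space d) (K σ : ℝ), 0 < σ → Continuous F →
      TorusPeriodic F → (∀ y, ‖F (x + y)‖ ≤ K * ‖y‖ ^ β) →
      ‖∑' k, ((monom m k * Real.exp (-(lam k * σ)) : ℝ) : ℂ) * (char k x * fc F k)‖
        ≤ C * K * σ ^ ((β - (∑ i, m i : ℕ)) / 2) := by
  obtain ⟨C, hC, h⟩ := exists_kernel m
  set I := ∫ y : Space d, ‖y‖ ^ β * Real.exp (-‖y‖ ^ 2 / 8) with hI
  have hI0 : 0 ≤ I := integral_nonneg fun y => by positivity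
  refine ⟨C * I, by positivity, fun F x K σ hσ hFc hFp hF => ?_⟩
  -- The kernel of width r has symbol e^{-λr²}, so heat time σ corresponds to width √σ.
  set r := √σ with hr
  have hr0 : 0 < r := Real.sqrt_pos.mpr hσ
  have hrσ : r ^ 2 = σ := Real.sq_sqrt hσ.le
  obtain ⟨Θ, hΘc, hΘb, hΘ⟩ := h r hr0
  rw [hrσ] at hΘ
  have hint8 : Integrable fun y : Space d => Real.exp (-‖r⁻¹ • y‖ ^ 2 / 8) := by
    have := (integrable_exp_neg_norm_sq (d := d) (b := 1 / 8)
      (by norm_num)).comp_smul (inv_ne_zero hr0.ne')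
    refine this.congr (ae_of_all _ fun y => ?_)
    simp only; congr 1; ring
  have hΘi : Integrable Θ := Integrable.mono' ((hint8.const_mul (r ^ d)⁻¹).const_mul
    (C * (r ^ (∑ i, m i))⁻¹)) hΘc.aestronglyMeasurable (ae_of_all _ hΘb)
  have hsum : Summable fun k => ∫ y, Θ y * char k y := by
    simp only [hΘ]
    refine Summable.of_norm ((summable_abs_monom_mul_exp m hσ).congr fun k => ?_)
    rw [Complex.norm_real, norm_mul, Real.norm_eq_abs, Real.norm_of_nonneg (Real.exp_pos _).le]
  have key := integral_kernel_mul_eq_tsum hΘi hsum hFc hFp x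
  simp only [hΘ] at key
  rw [← key]
  -- Rescaling y by r yields r^{β+d}; the factor r^d cancels the normalisation of the kernel, and
  -- r^β is the gain from the vanishing of F at x.
  have hscale : ∫ y : Space d, r ^ β * (‖r⁻¹ • y‖ ^ β * Real.exp (-‖r⁻¹ • y‖ ^ 2 / 8))
      = r ^ β * (r ^ d * I) := by
    rw [integral_const_mul, Measure.integral_comp_smul_of_nonneg (μ := volume)
      (fun y : Space d => ‖y‖ ^ β * Real.exp (-‖y‖ ^ 2 / 8)) r⁻¹ (hR := by positivity)]
    simp [hI]
  calc ‖∫ y, Θ y * F (x + y)‖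
      ≤ ∫ y : Space d, (C * (r ^ (∑ i, m i))⁻¹ * (r ^ d)⁻¹ * K) *
          (r ^ β * (‖r⁻¹ • y‖ ^ β * Real.exp (-‖r⁻¹ • y‖ ^ 2 / 8))) := by
        refine norm_integral_le_of_norm_le ?_ (ae_of_all _ fun y => ?_)
        · exact (((integrable_rpow_norm_mul_exp (d := d) h0 h1).comp_smul
            (inv_ne_zero hr0.ne')).const_mul _).const_mul _
        · rw [norm_mul]
          refine (mul_le_mul (hΘb y) (hF y) (norm_nonneg _) (by positivity)).trans_eq ?_
          have : ‖y‖ ^ β = r ^ β * ‖r⁻¹ • y‖ ^ β := by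
            rw [← Real.mul_rpow hr0.le (norm_nonneg _), norm_smul, norm_inv,
              Real.norm_of_nonneg hr0.le, mul_inv_cancel_left₀ hr0.ne']
          rw [this]; ring
    _ = C * I * K * ((r ^ (∑ i, m i))⁻¹ * r ^ β) := by
        rw [integral_const_mul, hscale]; field_simp
    _ = C * I * K * σ ^ ((β - (∑ i, m i : ℕ)) / 2) := by
        congr 1
        rw [← Real.rpow_natCast r, ← Real.rpow_neg hr0.le, ← Real.rpow_add hr0, hr,
          Real.sqrt_eq_rpow, ← Real.rpow_mul hσ.le]
        congr 1; ring

end KernelSums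

/-! ### Heat sums, and the modes of the velocity and of the flux in the moving frame. -/

section HeatSums

open Filter Topology

variable {d : ℕ}

lemma lam_nonneg (k : Fin d → ℤ) : 0 ≤ lam k := by unfold lam; positivity

@[simp] lemma lam_zero : lam (0 : Fin d → ℤ) = 0 := by simp [lam]

lemma one_le_sum_sq {k : Fin d → ℤ} (hk : k ≠ 0) : 1 ≤ ∑ i, (k i : ℝ) ^ 2 := by
  obtain ⟨i, hi⟩ := Function.ne_iff.mp hk
  have h1 : (1 : ℝ) ≤ (k i : ℝ) ^ 2 := by
    have : (1 : ℤ) ≤ k i ^ 2 := by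
      have : k i ≠ 0 := hi
      have := sq_pos_of_ne_zero this
      omega
    exact_mod_cast this
  exact h1.trans (Finset.single_le_sum (f := fun i => (k i : ℝ) ^ 2)
    (fun _ _ => sq_nonneg _) (Finset.mem_univ i))

/-- The spectral gap of the torus, which makes heat sums without zero mode decay at infinity. -/
lemma one_le_lam {k : Fin d → ℤ} (hk : k ≠ 0) : 1 ≤ lam k := by
  have h1 := one_le_sum_sq hk
  have h2 := Real.pi_gt_three
  unfold lam
  nlinarith [mul_nonneg (sq_nonneg Real.pi) (sub_nonneg.mpr h1)]

/-- Coefficients of at most subgaussian growth. -/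
def HeatSummable (a : (Fin d → ℤ) → ℂ) : Prop :=
  ∀ s : ℝ, 0 < s → Summable fun k => ‖a k‖ * Real.exp (-(lam k * s))

/-- The Gaussian-weighted sum `∑ exp (-4π²|k|²s) aₖ`. -/
def heatSum (a : (Fin d → ℤ) → ℂ) (s : ℝ) : ℂ :=
  ∑' k, (Real.exp (-(lam k * s)) : ℂ) * a k

/-- The coefficients `4π²|k|² aₖ`. -/
def lamMul (a : (Fin d → ℤ) → ℂ) : (Fin d → ℤ) → ℂ := fun k => (lam k : ℂ) * a k

lemma HeatSummable.summable {a : (Fin d → ℤ) → ℂ} (ha : HeatSummable a) {s : ℝ} (hs : 0 < s) :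
    Summable fun k => (Real.exp (-(lam k * s)) : ℂ) * a k := by
  refine Summable.of_norm ((ha s hs).congr fun k => ?_)
  rw [norm_mul, Complex.norm_real, Real.norm_of_nonneg (Real.exp_pos _).le, mul_comm]

lemma HeatSummable.of_le {a b : (Fin d → ℤ) → ℂ} (hb : HeatSummable b) (A : ℝ)
    (h : ∀ k, ‖a k‖ ≤ A * ‖b k‖) : HeatSummable a := fun s hs =>
  Summable.of_nonneg_of_le (fun k => by positivity) (fun k => by
    rw [← mul_assoc]
    exact mul_le_mul_of_nonneg_right (h k) (Real.exp_pos _).le) ((hb s hs).mul_left A)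

lemma heatSummable_of_bounded {a : (Fin d → ℤ) → ℂ} (A : ℝ) (h : ∀ k, ‖a k‖ ≤ A) :
    HeatSummable a := by
  refine HeatSummable.of_le (b := fun _ => 1) (fun s hs => ?_) A (by simpa using h)
  refine (summable_abs_monom_mul_exp (0 : Fin d → ℕ) hs).congr fun k => ?_
  simp [monom]

lemma HeatSummable.add {a b : (Fin d → ℤ) → ℂ} (ha : HeatSummable a) (hb : HeatSummable b) :
    HeatSummable (fun k => a k + b k) := fun s hs =>
  Summable.of_nonneg_of_le (fun k => by positivity) (fun k => by
    rw [← add_mul]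
    exact mul_le_mul_of_nonneg_right (norm_add_le _ _) (Real.exp_pos _).le)
    ((ha s hs).add (hb s hs))

/-- Half of the weight pays for the eigenvalue: λs/2 ≤ e^{λs/2}. -/
lemma HeatSummable.lamMul {a : (Fin d → ℤ) → ℂ} (ha : HeatSummable a) :
    HeatSummable (lamMul a) := fun s hs => by
  refine Summable.of_nonneg_of_le (fun k => by positivity) (fun k => ?_)
    ((ha (s / 2) (by positivity)).mul_left (2 / s))
  have h1 : lam k * s / 2 ≤ Real.exp (lam k * s / 2) := by
    linarith [Real.add_one_le_exp (lam k * s / 2)]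
  have h2 : lam k ≤ 2 / s * Real.exp (lam k * s / 2) := by
    rw [div_mul_eq_mul_div, le_div_iff₀ hs]; linarith
  rw [NavierStokes.lamMul, norm_mul, Complex.norm_real, Real.norm_of_nonneg (lam_nonneg k)]
  have h3 : Real.exp (-(lam k * (s / 2))) = Real.exp (lam k * s / 2) * Real.exp (-(lam k * s)) := by
    rw [← Real.exp_add]; congr 1; ring
  rw [h3]
  have := mul_le_mul_of_nonneg_right h2 (mul_nonneg (norm_nonneg (a k)) (Real.exp_pos (-(lam k * s))).le)
  linarith

/-- Termwise differentiation on (s/2, ∞), where the weight at s/2 dominates all derivatives. -/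
lemma hasDerivAt_heatSum {a : (Fin d → ℤ) → ℂ} (ha : HeatSummable a) {s : ℝ} (hs : 0 < s) :
    HasDerivAt (heatSum a) (-heatSum (lamMul a) s) s := by
  have hg : ∀ k, ∀ y ∈ Ioi (s / 2), HasDerivAt
      (fun s : ℝ => (Real.exp (-(lam k * s)) : ℂ) * a k)
      (-((Real.exp (-(lam k * y)) : ℂ) * lamMul a k)) y := fun k y _ => by
    have h1 : HasDerivAt (fun s : ℝ => Real.exp (-(lam k * s)))
        (Real.exp (-(lam k * y)) * -(lam k)) y := by
      have := (((hasDerivAt_id y).const_mul (lam k)).neg).exp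
      simpa using this
    convert! (h1.ofReal_comp).mul_const (a k) using 1
    rw [lamMul]; push_cast; ring
  have := hasDerivAt_tsum_of_isPreconnected (ha.lamMul (s / 2) (by positivity)) isOpen_Ioi
    isPreconnected_Ioi hg (fun k y hy => ?_) (y₀ := s) (y := s) (by simp [hs])
    (ha.summable hs) (by simp [hs])
  · rw [tsum_neg] at this
    exact this
  · rw [norm_neg, norm_mul, Complex.norm_real, Real.norm_of_nonneg (Real.exp_pos _).le, mul_comm]
    gcongr
    · exact lam_nonneg k
    · exact (mem_Ioi.mp hy).le

/-- By the spectral gap, e^{-λs} ≤ e^{-(s-1)} e^{-λ} for every nonzero mode once s ≥ 1. -/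
lemma tendsto_heatSum {a : (Fin d → ℤ) → ℂ} (ha : HeatSummable a) (h0 : a 0 = 0) :
    Tendsto (heatSum a) atTop (𝓝 0) := by
  have h1 : ∀ s : ℝ, 1 ≤ s → ‖heatSum a s‖ ≤
      Real.exp (-(s - 1)) * ∑' k, ‖a k‖ * Real.exp (-(lam k * 1)) := fun s hs => by
    rw [← tsum_mul_left]
    refine tsum_of_norm_bounded ((ha 1 one_pos).mul_left _).hasSum fun k => ?_
    rw [norm_mul, Complex.norm_real, Real.norm_of_nonneg (Real.exp_pos _).le]
    rcases eq_or_ne k 0 with rfl | hk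
    · simp [h0]
    · rw [mul_left_comm, ← Real.exp_add, mul_comm]
      gcongr
      nlinarith [one_le_lam hk]
  have h2 : Tendsto (fun s : ℝ => Real.exp (-(s - 1)) *
      ∑' k, ‖a k‖ * Real.exp (-(lam k * 1))) atTop (𝓝 0) := by
    rw [← zero_mul (∑' k, ‖a k‖ * Real.exp (-(lam k * 1)))]
    refine Tendsto.mul_const _ ?_
    refine Real.tendsto_exp_neg_atTop_nhds_zero.comp (tendsto_atTop_add_const_right _ _ tendsto_id)
  exact squeeze_zero_norm' ((eventually_ge_atTop 1).mono h1) h2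

/-- Comparison of the increments of a heat sum with those of a scalar function. -/
lemma norm_heatSum_sub_le {a : (Fin d → ℤ) → ℂ} (ha : HeatSummable a) {β b : ℝ → ℝ} {s R : ℝ}
    (hs : 0 < s) (hsR : s ≤ R) (hβ : ∀ r, 0 < r → HasDerivAt β (b r) r)
    (hb : ∀ r ∈ Icc s R, ‖heatSum (lamMul a) r‖ ≤ b r) :
    ‖heatSum a R - heatSum a s‖ ≤ β R - β s := by
  have hpos : ∀ r ∈ Icc s R, 0 < r := fun r hr => hs.trans_le hr.1
  refine image_norm_le_of_norm_deriv_right_le_deriv_boundary' (a := s) (b := R)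
    (f := fun r => heatSum a r - heatSum a s) (f' := fun r => -heatSum (lamMul a) r)
    (B := fun r => β r - β s) (B' := b) ?_ ?_ (by simp) ?_ ?_ ?_ (right_mem_Icc.mpr hsR)
  · exact fun r hr => ((hasDerivAt_heatSum ha (hpos r hr)).sub_const _).continuousAt.continuousWithinAt
  · exact fun r hr => ((hasDerivAt_heatSum ha (hpos r (Ico_subset_Icc_self hr))).sub_const _).hasDerivWithinAt
  · exact fun r hr => ((hβ r (hpos r hr)).sub_const _).continuousAt.continuousWithinAt
  · exact fun r hr => ((hβ r (hpos r (Ico_subset_Icc_self hr))).sub_const _).hasDerivWithinAt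
  · exact fun r hr => by rw [norm_neg]; exact hb r (Ico_subset_Icc_self hr)

/-- The heat sum is minus the integral of its derivative from s to infinity: compare increments on
[s, R] and let R tend to infinity, where the sum vanishes because there is no zero mode. This
removes a factor λ without inverting the Laplacian. -/
lemma norm_heatSum_le {a : (Fin d → ℤ) → ℂ} (ha : HeatSummable a) (h0 : a 0 = 0) {β b : ℝ → ℝ}
    {s : ℝ} (hs : 0 < s) (hβ : ∀ r, 0 < r → HasDerivAt β (-b r) r) (hβ0 : ∀ r, 0 < r → 0 ≤ β r)
    (hb : ∀ r, 0 < r → ‖heatSum (lamMul a) r‖ ≤ b r) : ‖heatSum a s‖ ≤ β s := by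
  have h1 : ∀ R, s ≤ R → ‖heatSum a R - heatSum a s‖ ≤ β s := fun R hR => by
    have := norm_heatSum_sub_le ha (β := fun r => -β r) (b := b) hs hR
      (fun r hr => by have := (hβ r hr).fun_neg; rwa [neg_neg] at this) fun r hr => hb r (hs.trans_le hr.1)
    linarith [hβ0 R (hs.trans_le hR)]
  have h2 : Tendsto (fun R => ‖heatSum a R - heatSum a s‖) atTop (𝓝 ‖0 - heatSum a s‖) :=
    ((tendsto_heatSum ha h0).sub_const _).norm
  rw [zero_sub, norm_neg] at h2
  exact le_of_tendsto h2 ((eventually_ge_atTop s).mono h1)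

/-- The Fourier modes of the component `v_e`, seen from the point `x`. -/
def fourierMode (e : Fin d) (v : Space d → Space d) (x : Space d) (k : Fin d → ℤ) : ℂ :=
  char k x * fc (fun y => (v y e : ℂ)) k

/-- The matrix `δ_{ei} - k_e kᵢ / |k|²` of the Leray projection. -/
def leray (e : Fin d) (k : Fin d → ℤ) (i : Fin d) : ℝ :=
  (if i = e then 1 else 0) - k e * k i / ∑ l, (k l : ℝ) ^ 2

/-- The quadratic increment `(vᵢ(y) - vᵢ(x)) (vⱼ(y) - vⱼ(x))`. -/
def quadInc (v : Space d → Space d) (x : Space d) (i j : Fin d) (y : Space d) : ℂ :=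
  (((v y i - v x i) * (v y j - v x j) : ℝ) : ℂ)

/-- The Fourier modes of the projected flux relative to the frame moving with velocity `v x`. -/
def fluxMode (e : Fin d) (v : Space d → Space d) (x : Space d) (k : Fin d → ℤ) : ℂ :=
  -(2 * Real.pi * Complex.I) * ∑ i, ∑ j, ((leray e k i * k j : ℝ) : ℂ) *
    (char k x * fc (quadInc v x i j) k)

/-- The exponents of the monomial `k_a k_b k_c`. -/
def cubic (a b c : Fin d) : Fin d → ℕ := Pi.single a 1 + Pi.single b 1 + Pi.single c 1

lemma monom_single (a : Fin d) (n : ℕ) (k : Fin d → ℤ) :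
    monom (Pi.single a n) k = (k a : ℝ) ^ n := by
  rw [monom, Finset.prod_eq_single a (fun i _ hi => by simp [hi]) (by simp)]
  simp

lemma monom_add (m n : Fin d → ℕ) (k : Fin d → ℤ) :
    monom (m + n) k = monom m k * monom n k := by
  simp [monom, pow_add, Finset.prod_mul_distrib]

lemma monom_cubic (a b c : Fin d) (k : Fin d → ℤ) :
    monom (cubic a b c) k = k a * k b * k c := by
  simp [cubic, monom_add, monom_single]

lemma sum_cubic (a b c : Fin d) : ∑ i, cubic a b c i = 3 := by
  simp [cubic, Finset.sum_add_distrib]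

/-- The factor λ clears the denominator |k|² of the Leray matrix. What remains is a homogeneous
cubic polynomial, so Gaussian kernels suffice and no singular integral has to be estimated. -/
lemma lam_mul_leray (e : Fin d) (k : Fin d → ℤ) (i j : Fin d) :
    lam k * (leray e k i * k j) = 4 * Real.pi ^ 2 *
      ((if i = e then ∑ l, monom (cubic l l j) k else 0) - monom (cubic e i j) k) := by
  simp only [monom_cubic, leray, lam]
  rcases eq_or_ne k 0 with rfl | hk
  · simp
  · have h := one_le_sum_sq hk
    have h' : (∑ l, (k l : ℝ) ^ 2) ≠ 0 := by positivity
    have h2 : ∑ l, (k l : ℝ) * k l * k j = (∑ l, (k l : ℝ) ^ 2) * k j := by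
      rw [Finset.sum_mul]; exact Finset.sum_congr rfl fun l _ => by ring
    rw [h2]
    split_ifs
    · field_simp
    · field_simp; ring

/-- A crude growth bound, used only for summability and for exchanging sums with integrals. -/
lemma abs_leray_mul_le (e : Fin d) (k : Fin d → ℤ) (i j : Fin d) :
    |leray e k i * k j| ≤ 2 * (lam k + 1) := by
  rcases eq_or_ne k 0 with rfl | hk
  · simp
  · have h := one_le_sum_sq hk
    set S := ∑ l, (k l : ℝ) ^ 2
    have hk1 : ∀ l, (k l : ℝ) ^ 2 ≤ S := fun l =>
      Finset.single_le_sum (f := fun i => (k i : ℝ) ^ 2) (fun _ _ => sq_nonneg _) (Finset.mem_univ l)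
    have h1 : |leray e k i| ≤ 2 := by
      have h3 : |(k e : ℝ) * k i / S| ≤ 1 := by
        rw [abs_div, abs_of_pos (by positivity : 0 < S), div_le_one (by positivity), abs_mul]
        nlinarith [hk1 e, hk1 i, sq_nonneg (|(k e : ℝ)| - |(k i : ℝ)|), sq_abs (k e : ℝ), sq_abs (k i : ℝ)]
      have h4 : |(if i = e then (1 : ℝ) else 0)| ≤ 1 := by split_ifs <;> simp
      have := abs_sub (if i = e then (1 : ℝ) else 0) ((k e : ℝ) * k i / S)
      unfold leray
      linarith
    have h2 : |(k j : ℝ)| ≤ lam k + 1 := by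
      have h5 : lam k = 4 * Real.pi ^ 2 * S := rfl
      have h6 := Real.pi_gt_three
      have : S ≤ lam k := by
        have : 1 ≤ 4 * Real.pi ^ 2 := by nlinarith
        rw [h5]; nlinarith
      nlinarith [hk1 j, sq_abs (k j : ℝ), sq_nonneg (|(k j : ℝ)| - 1)]
    rw [abs_mul]
    exact mul_le_mul h1 h2 (abs_nonneg _) (by norm_num)

/-- A bound for the flux modes of a field whose quadratic increments at `x` are at most
`K |y| ^ β`. -/
lemma exists_norm_heatSum_lamMul_fluxMode_le (d : ℕ) {β : ℝ} (h0 : 0 ≤ β) (h1 : β ≤ 1) :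
    ∃ C : ℝ, 0 ≤ C ∧ ∀ (e : Fin d) (v : Space d → Space d) (x : Space d) (K σ : ℝ), 0 < σ →
      Continuous v → TorusPeriodic v →
      (∀ i j y, ‖quadInc v x i j (x + y)‖ ≤ K * ‖y‖ ^ β) →
      ‖heatSum (lamMul (fluxMode e v x)) σ‖ ≤ C * K * σ ^ ((β - 3) / 2) := by
  choose c hc h using fun m : Fin d → ℕ => exists_norm_tsum_monom_le m h0 h1
  set D : ℝ := ∑ a : Fin d, ∑ b : Fin d, ∑ e : Fin d, c (cubic a b e) with hD
  have hcD : ∀ a b e, c (cubic a b e) ≤ D := fun a b e =>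
    (Finset.single_le_sum (f := fun e => c (cubic a b e)) (fun _ _ => hc _)
      (Finset.mem_univ e)).trans <|
    (Finset.single_le_sum (f := fun b => ∑ e, c (cubic a b e))
      (fun _ _ => Finset.sum_nonneg fun _ _ => hc _) (Finset.mem_univ b)).trans <|
    Finset.single_le_sum (f := fun a => ∑ b, ∑ e, c (cubic a b e))
      (fun _ _ => Finset.sum_nonneg fun _ _ => Finset.sum_nonneg fun _ _ => hc _) (Finset.mem_univ a)
  have hD0 : 0 ≤ D := Finset.sum_nonneg fun _ _ => Finset.sum_nonneg fun _ _ =>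
    Finset.sum_nonneg fun _ _ => hc _
  refine ⟨2 * Real.pi * (∑ _i : Fin d, ∑ _j : Fin d, 4 * Real.pi ^ 2 * ((d : ℝ) * D + D)),
    by positivity, fun e v x K σ hσ hvc hvp hK => ?_⟩
  have hFc : ∀ i j, Continuous (quadInc v x i j) := fun i j => by unfold quadInc; fun_prop
  have hFp : ∀ i j, TorusPeriodic (quadInc v x i j) := fun i j l y => by
    simp only [quadInc, hvp l y]
  -- The sign of K comes from the hypothesis at a unit vector; in dimension 0 there is no such
  -- vector, hence the index.
  have hK0 : ∀ i : Fin d, 0 ≤ K := fun i => by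
    have := (norm_nonneg _).trans (hK i i (EuclideanSpace.single i 1))
    simpa using this
  set T : (Fin d → ℕ) → Fin d → Fin d → (Fin d → ℤ) → ℂ := fun m i j k =>
    ((monom m k * Real.exp (-(lam k * σ)) : ℝ) : ℂ) * (char k x * fc (quadInc v x i j) k) with hT
  have hTs : ∀ m i j, Summable (T m i j) := fun m i j => by
    obtain ⟨f, hf⟩ := exists_lift (hFc i j) (hFp i j)
    have hb : ∀ y, ‖quadInc v x i j y‖ ≤ ‖f‖ := fun y => by
      rw [← hf]; exact f.norm_coe_le_norm _
    refine Summable.of_norm_bounded ((summable_abs_monom_mul_exp m hσ).mul_right ‖f‖) fun k => ?_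
    rw [hT, norm_mul, norm_mul, norm_char, one_mul, Complex.norm_real, norm_mul, Real.norm_eq_abs,
      Real.norm_of_nonneg (Real.exp_pos _).le]
    gcongr
    exact norm_fc_le hb k
  have hTb : ∀ a b l i j, ‖∑' k, T (cubic a b l) i j k‖ ≤ D * (K * σ ^ ((β - 3) / 2)) := by
    intro a b l i j
    have := h (cubic a b l) (quadInc v x i j) x K σ hσ (hFc i j) (hFp i j) (hK i j)
    rw [sum_cubic, mul_assoc] at this
    refine this.trans (mul_le_mul_of_nonneg_right (hcD a b l) ?_)
    exact mul_nonneg (hK0 i) (by positivity)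
  have hexpand : heatSum (lamMul (fluxMode e v x)) σ = -(2 * Real.pi * Complex.I) *
      ∑ i, ∑ j, (4 * Real.pi ^ 2 : ℂ) * ((if i = e then ∑ l, ∑' k, T (cubic l l j) i j k else 0)
        - ∑' k, T (cubic e i j) i j k) := by
    have hterm : ∀ k, (Real.exp (-(lam k * σ)) : ℂ) * lamMul (fluxMode e v x) k =
        -(2 * Real.pi * Complex.I) * ∑ i, ∑ j, (4 * Real.pi ^ 2 : ℂ) *
          ((if i = e then ∑ l, T (cubic l l j) i j k else 0) - T (cubic e i j) i j k) := by
      intro k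
      rw [lamMul, fluxMode, mul_left_comm (lam k : ℂ), mul_left_comm (Real.exp (-(lam k * σ)) : ℂ)]
      congr 1
      rw [Finset.mul_sum, Finset.mul_sum]
      refine Finset.sum_congr rfl fun i _ => ?_
      rw [Finset.mul_sum, Finset.mul_sum]
      refine Finset.sum_congr rfl fun j _ => ?_
      have := congrArg Complex.ofReal (lam_mul_leray e k i j)
      rw [← mul_assoc (lam k : ℂ), ← Complex.ofReal_mul, this]
      simp only [hT]
      split_ifs
      · push_cast; rw [← Finset.sum_mul, ← Finset.sum_mul]; ring
      · push_cast; ring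
    have hs1 : ∀ i j, Summable fun k => ((if i = e then ∑ l, T (cubic l l j) i j k else 0)
        - T (cubic e i j) i j k) := fun i j => by
      refine Summable.sub ?_ (hTs _ _ _)
      split_ifs
      · exact summable_sum fun l _ => hTs _ _ _
      · exact summable_zero
    rw [heatSum]
    simp only [hterm]
    rw [tsum_mul_left, Summable.tsum_finsetSum
      fun i _ => summable_sum fun j _ => (hs1 i j).mul_left _]
    congr 1
    refine Finset.sum_congr rfl fun i _ => ?_
    rw [Summable.tsum_finsetSum fun j _ => (hs1 i j).mul_left _]
    refine Finset.sum_congr rfl fun j _ => ?_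
    rw [tsum_mul_left]
    congr 1
    split_ifs with hie
    · rw [Summable.tsum_sub (summable_sum fun l _ => hTs _ _ _) (hTs _ _ _),
        Summable.tsum_finsetSum fun l _ => hTs _ _ _]
    · simp [tsum_neg]
  rw [hexpand, norm_mul, norm_neg]
  have hn : ‖(2 * Real.pi * Complex.I : ℂ)‖ = 2 * Real.pi := by
    simp [abs_of_pos Real.pi_pos]
  rw [hn, mul_assoc (2 * Real.pi), mul_assoc (2 * Real.pi)]
  gcongr
  rw [mul_assoc, Finset.sum_mul]
  refine norm_sum_le_of_le _ fun i _ => ?_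
  rw [Finset.sum_mul]
  refine norm_sum_le_of_le _ fun j _ => ?_
  have hn2 : ‖(4 * Real.pi ^ 2 : ℂ)‖ = 4 * Real.pi ^ 2 := by
    simp [abs_of_pos Real.pi_pos]
  rw [norm_mul, hn2, mul_assoc (4 * Real.pi ^ 2)]
  gcongr
  refine (norm_sub_le _ _).trans ?_
  rw [add_mul]
  refine add_le_add ?_ (hTb _ _ _ _ _)
  have hnn : 0 ≤ D * (K * σ ^ ((β - 3) / 2)) := mul_nonneg hD0 (mul_nonneg (hK0 i) (by positivity))
  split_ifs
  · refine (norm_sum_le_of_le _ fun l _ => hTb _ _ _ _ _).trans ?_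
    simp [mul_assoc]
  · rw [norm_zero, mul_assoc]; positivity

end HeatSums

/-! ### Bounds at fixed time for the modes of a Hölder field. -/

section StaticEstimates

open Filter Topology

variable {d : ℕ}

/-- Scalar functions that control the time integrals of the flux: `-b` is the derivative of `β`,
and `β` is at most the derivative `B'` of `B`. -/
structure Profile (α : ℝ) (β b B B' : ℝ → ℝ) (κ : ℝ) : Prop where
  hasDerivAt : ∀ s, 0 < s → HasDerivAt β (-b s) s
  nonneg : ∀ s, 0 < s → 0 ≤ β s
  min_le : ∀ s, 0 < s → min (s ^ (α - 3 / 2)) (s ^ (-(3 / 2 : ℝ))) ≤ κ * b s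
  const_nonneg : 0 ≤ κ
  hasDerivAt_prim : ∀ s, 0 < s → HasDerivAt B (B' s) s
  le_prim : ∀ s, 0 < s → β s ≤ B' s
  prim_nonneg : ∀ s, 0 < s → 0 ≤ B s

/-- A periodic vector field with Hölder seminorm at most `U`. -/
structure HolderField (α U : ℝ) (v : Space d → Space d) : Prop where
  periodic : TorusPeriodic v
  bound : ∀ y z, ‖v y - v z‖ ≤ U * ‖y - z‖ ^ α

lemma HolderField.continuous {α U : ℝ} {v : Space d → Space d} (hv : HolderField α U v)
    (hα : 0 < α) : Continuous v := by
  rw [continuous_iff_continuousAt]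
  intro z
  rw [ContinuousAt, tendsto_iff_norm_sub_tendsto_zero]
  have h : Tendsto (fun y => U * ‖y - z‖ ^ α) (𝓝 z) (𝓝 0) := by
    have h1 : Continuous fun y : Space d => U * ‖y - z‖ ^ α :=
      continuous_const.mul ((by fun_prop : Continuous fun y : Space d => ‖y - z‖).rpow_const
        fun _ => Or.inr hα.le)
    have := h1.tendsto z
    simpa [Real.zero_rpow hα.ne'] using this
  exact squeeze_zero (fun _ => norm_nonneg _) (fun y => hv.bound y z) h

/-- By periodicity y may be replaced by its fractional parts, a vector of length at most d + 1. This
global bound gives the decay of the flux at large heat times, needed when α = 1/2. -/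
lemma HolderField.norm_add_sub_le {α U : ℝ} {v : Space d → Space d} (hv : HolderField α U v)
    (hα : 0 < α) (hα1 : α ≤ 1) (hU : 0 ≤ U) (x y : Space d) : ‖v (x + y) - v x‖ ≤ (d + 1) * U := by
  set y' : Space d := WithLp.toLp 2 fun i => Int.fract (y i) with hy'
  have h1 : v (x + y) = v (x + y') := hv.periodic.eq_of_sub_int (n := fun i => ⌊y i⌋) fun i => by
    simp only [PiLp.add_apply, hy', add_assoc, Int.fract_add_floor]
  have h2 : ‖y'‖ ≤ d + 1 := by
    have h3 : ‖y'‖ ^ 2 ≤ d := by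
      rw [EuclideanSpace.norm_sq_eq]
      calc ∑ i, ‖y' i‖ ^ 2 ≤ ∑ _i : Fin d, (1 : ℝ) := by
            refine Finset.sum_le_sum fun i _ => ?_
            have : ‖y' i‖ ≤ 1 := by
              rw [Real.norm_of_nonneg (Int.fract_nonneg _)]; exact (Int.fract_lt_one _).le
            exact pow_le_one₀ (norm_nonneg _) this
        _ = d := by simp
    nlinarith [norm_nonneg y', (Nat.cast_nonneg d : (0 : ℝ) ≤ d)]
  rw [h1]
  refine (hv.bound _ _).trans ?_
  rw [add_sub_cancel_left, mul_comm]
  gcongr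
  have hd : (1 : ℝ) ≤ d + 1 := by linarith [(Nat.cast_nonneg d : (0 : ℝ) ≤ d)]
  calc ‖y'‖ ^ α ≤ ((d : ℝ) + 1) ^ α := by gcongr
    _ ≤ ((d : ℝ) + 1) ^ (1 : ℝ) := Real.rpow_le_rpow_of_exponent_le hd hα1
    _ = d + 1 := Real.rpow_one _

lemma abs_apply_le_norm (v : Space d) (i : Fin d) : |v i| ≤ ‖v‖ := by
  simpa using PiLp.norm_apply_le v i

lemma norm_quadInc_le (v : Space d → Space d) (x y : Space d) (i j : Fin d) :
    ‖quadInc v x i j y‖ ≤ ‖v y - v x‖ ^ 2 := by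
  rw [quadInc, Complex.norm_real, norm_mul, sq]
  have := fun i => abs_apply_le_norm (v y - v x) i
  exact mul_le_mul (this i) (this j) (norm_nonneg _) (norm_nonneg _)

lemma exists_norm_le_of_periodic {F : Space d → ℂ} (hc : Continuous F) (hp : TorusPeriodic F) :
    ∃ A : ℝ, ∀ y, ‖F y‖ ≤ A := by
  obtain ⟨f, hf⟩ := exists_lift hc hp
  exact ⟨‖f‖, fun y => by rw [← hf]; exact f.norm_coe_le_norm _⟩

lemma heatSummable_mode {F : Space d → ℂ} (hc : Continuous F) (hp : TorusPeriodic F)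
    (x : Space d) : HeatSummable fun k => char k x * fc F k := by
  obtain ⟨A, hA⟩ := exists_norm_le_of_periodic hc hp
  exact heatSummable_of_bounded A fun k => by
    rw [norm_mul, norm_char, one_mul]; exact norm_fc_le hA k

lemma continuous_quadInc {v : Space d → Space d} (hv : Continuous v) (x : Space d) (i j : Fin d) :
    Continuous (quadInc v x i j) := by unfold quadInc; fun_prop

lemma periodic_quadInc {v : Space d → Space d} (hv : TorusPeriodic v) (x : Space d)
    (i j : Fin d) : TorusPeriodic (quadInc v x i j) := fun l y => by simp only [quadInc, hv l y]

lemma heatSummable_fluxMode {v : Space d → Space d} (hc : Continuous v) (hp : TorusPeriodic v)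
    (e : Fin d) (x : Space d) : HeatSummable (fluxMode e v x) := by
  choose A hA using fun i j => exists_norm_le_of_periodic (continuous_quadInc hc x i j)
    (periodic_quadInc hp x i j)
  have hg : HeatSummable fun k : Fin d → ℤ => ((lam k : ℂ) * 1 + 1) :=
    (heatSummable_of_bounded (a := fun _ => 1) 1 (by simp)).lamMul.add
      (heatSummable_of_bounded 1 (by simp))
  refine hg.of_le (2 * Real.pi * ∑ i, ∑ j, 2 * A i j) fun k => ?_
  have hn : ‖(2 * Real.pi * Complex.I : ℂ)‖ = 2 * Real.pi := by
    simp [abs_of_pos Real.pi_pos]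
  have hl : ‖((lam k : ℂ) * 1 + 1)‖ = lam k + 1 := by
    rw [mul_one, ← Complex.ofReal_one, ← Complex.ofReal_add, Complex.norm_real,
      Real.norm_of_nonneg (by linarith [lam_nonneg k])]
  rw [fluxMode, norm_mul, norm_neg, hn, hl, mul_assoc (2 * Real.pi), Finset.sum_mul]
  gcongr
  refine norm_sum_le_of_le _ fun i _ => ?_
  rw [Finset.sum_mul]
  refine norm_sum_le_of_le _ fun j _ => ?_
  rw [norm_mul, Complex.norm_real, norm_mul (char k x), norm_char, one_mul]
  calc _ ≤ (2 * (lam k + 1)) * A i j :=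
        mul_le_mul (abs_leray_mul_le e k i j) (norm_fc_le (hA i j) k) (norm_nonneg _)
          (by linarith [lam_nonneg k])
    _ = _ := by ring

lemma fluxMode_zero (e : Fin d) (v : Space d → Space d) (x : Space d) : fluxMode e v x 0 = 0 := by
  simp [fluxMode]

lemma heatSummable_fourierMode {v : Space d → Space d} (hc : Continuous v) (hp : TorusPeriodic v)
    (e : Fin d) (x : Space d) : HeatSummable (fourierMode e v x) :=
  heatSummable_mode (by fun_prop) (fun i y => by simp only [hp i y]) x

lemma fc_one (k : Fin d → ℤ) : fc (fun _ : Space d => (1 : ℂ)) k = if k = 0 then 1 else 0 := by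
  rw [fc_eq_mFourierCoeff (f := UnitAddTorus.mFourier 0)
    (fun y => by rw [mFourier_toTorus, char_zero]), mFourierCoeff_mFourier]
  simp [eq_comm]

lemma fc_sub_const {F : Space d → ℂ} (hc : Continuous F) (c : ℂ) (k : Fin d → ℤ) :
    fc (fun y => F y - c) k = fc F k - if k = 0 then c else 0 := by
  have h1 : fc (fun y => F y - c) k = fc F k - c * fc (fun _ : Space d => (1 : ℂ)) k := by
    rw [fc, fc, fc, ← integral_const_mul, ← integral_sub (integrable_unitCell (by fun_prop))
      (integrable_unitCell (by fun_prop))]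
    congr 1; ext y; ring
  rw [h1, fc_one]; split_ifs <;> simp

/-- The quadratic increments are at most U²|y|^{2α} and also at most a constant times U². These two
bounds, with β = 2α and β = 0, give the powers α - 3/2 and -3/2 whose minimum the profile dominates;
2α ≤ 1 is what the kernel estimate allows. -/
lemma exists_fluxMode_lamMul_bound (d : ℕ) {α : ℝ} (hα : 0 < α) (hα1 : α ≤ 1 / 2)
    {β b B B' : ℝ → ℝ} {κ : ℝ} (hP : Profile α β b B B' κ) :
    ∃ C : ℝ, 0 ≤ C ∧ ∀ (U : ℝ) (v : Space d → Space d), 0 ≤ U → HolderField α U v →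
      ∀ (e : Fin d) (x : Space d) (σ : ℝ), 0 < σ →
      ‖heatSum (lamMul (fluxMode e v x)) σ‖ ≤ C * U ^ 2 * b σ := by
  obtain ⟨C₁, hC₁, h₁⟩ := exists_norm_heatSum_lamMul_fluxMode_le d (β := 2 * α) (by linarith) (by linarith)
  obtain ⟨C₂, hC₂, h₂⟩ := exists_norm_heatSum_lamMul_fluxMode_le d (β := 0) le_rfl zero_le_one
  refine ⟨(C₁ + C₂ * (d + 1) ^ 2) * κ, mul_nonneg (by positivity) hP.const_nonneg,
    fun U v hU hv e x σ hσ => ?_⟩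
  have hvc := hv.continuous hα
  have k₁ := h₁ e v x (U ^ 2) σ hσ hvc hv.periodic fun i j y => by
    refine (norm_quadInc_le v x (x + y) i j).trans ?_
    have := hv.bound (x + y) x
    rw [add_sub_cancel_left] at this
    rw [mul_comm 2 α, Real.rpow_mul (norm_nonneg _), Real.rpow_two, ← mul_pow]
    gcongr
  have k₂ := h₂ e v x (((d + 1) * U) ^ 2) σ hσ hvc hv.periodic fun i j y => by
    refine (norm_quadInc_le v x (x + y) i j).trans ?_
    rw [Real.rpow_zero, mul_one]
    have := hv.norm_add_sub_le hα (by linarith) hU x y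
    gcongr
  have e₁ : (2 * α - 3) / 2 = α - 3 / 2 := by ring
  have e₂ : ((0 : ℝ) - 3) / 2 = -(3 / 2) := by ring
  rw [e₁] at k₁
  rw [e₂] at k₂
  have hm := hP.min_le σ hσ
  have hbn : 0 ≤ κ * b σ := (le_min (by positivity) (by positivity)).trans hm
  rcases min_le_iff.mp hm with hm | hm
  · calc _ ≤ C₁ * U ^ 2 * (κ * b σ) := k₁.trans (by gcongr)
      _ ≤ (C₁ + C₂ * (d + 1) ^ 2) * U ^ 2 * (κ * b σ) := by
        gcongr; linarith [mul_nonneg hC₂ (sq_nonneg ((d : ℝ) + 1))]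
      _ = _ := by ring
  · calc _ ≤ C₂ * ((d + 1) * U) ^ 2 * (κ * b σ) := k₂.trans (by gcongr)
      _ = (C₂ * (d + 1) ^ 2) * U ^ 2 * (κ * b σ) := by ring
      _ ≤ (C₁ + C₂ * (d + 1) ^ 2) * U ^ 2 * (κ * b σ) := by
        gcongr; linarith
      _ = _ := by ring

/-- Integrates the bound for the Laplacian of the flux from infinity; the flux has no zero mode,
since its symbol contains k_j. -/
lemma fluxMode_bound {α : ℝ} (hα : 0 < α) {β b B B' : ℝ → ℝ} {κ : ℝ} (hP : Profile α β b B B' κ)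
    {C U : ℝ} (hC : 0 ≤ C) {v : Space d → Space d} (hv : HolderField α U v) {e : Fin d} {x : Space d}
    (h : ∀ σ, 0 < σ → ‖heatSum (lamMul (fluxMode e v x)) σ‖ ≤ C * U ^ 2 * b σ) {s : ℝ}
    (hs : 0 < s) : ‖heatSum (fluxMode e v x) s‖ ≤ C * U ^ 2 * β s :=
  norm_heatSum_le (β := fun s => C * U ^ 2 * β s) (b := fun s => C * U ^ 2 * b s)
    (heatSummable_fluxMode (hv.continuous hα) hv.periodic e x) (fluxMode_zero e v x) hs
    (fun r hr => by simpa using (hP.hasDerivAt r hr).const_mul (C * U ^ 2))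
    (fun r hr => mul_nonneg (by positivity) (hP.nonneg r hr)) h

/-- Subtracting v(x) from v changes only the zero mode. For the plain sum this is the subtracted
constant; for the Laplacian it is invisible. The kernel estimates then apply with the monomials 1
and k_l². -/
lemma exists_fourierMode_bound (d : ℕ) {α : ℝ} (hα : 0 < α) (hα1 : α ≤ 1) :
    ∃ C : ℝ, 0 ≤ C ∧ ∀ (U : ℝ) (v : Space d → Space d), 0 ≤ U → HolderField α U v →
      ∀ (e : Fin d) (x : Space d) (s : ℝ), 0 < s →
      ‖heatSum (fourierMode e v x) s - (v x e : ℂ)‖ ≤ C * U * s ^ (α / 2) ∧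
      ‖heatSum (lamMul (fourierMode e v x)) s‖ ≤ C * U * s ^ (α / 2 - 1) := by
  choose c hc h using fun m : Fin d → ℕ => exists_norm_tsum_monom_le m hα.le hα1
  set D := 4 * Real.pi ^ 2 * ∑ l, c (Pi.single l 2) with hD
  have hD0 : 0 ≤ D := mul_nonneg (by positivity) (Finset.sum_nonneg fun _ _ => hc _)
  refine ⟨c 0 + D, add_nonneg (hc 0) hD0, fun U v hU hv e x s hs => ?_⟩
  have hvc := hv.continuous hα
  set F : Space d → ℂ := fun y => (v y e : ℂ) - (v x e : ℂ) with hF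
  have hFc : Continuous F := by fun_prop
  have hFp : TorusPeriodic F := fun i y => by simp only [hF, hv.periodic i y]
  have hFb : ∀ y, ‖F (x + y)‖ ≤ U * ‖y‖ ^ α := fun y => by
    have h1 := abs_apply_le_norm (v (x + y) - v x) e
    have h2 := hv.bound (x + y) x
    rw [add_sub_cancel_left] at h2
    simp only [hF]
    rw [← Complex.ofReal_sub, Complex.norm_real]
    exact h1.trans h2
  have hq : ∀ k, char k x * fc F k = fourierMode e v x k - if k = 0 then (v x e : ℂ) else 0 := by
    intro k
    rw [hF, fc_sub_const (by fun_prop), fourierMode, mul_sub]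
    split_ifs with hk
    · rw [hk, char_zero, one_mul, one_mul]
    · simp
  have hsF := heatSummable_mode hFc hFp x
  constructor
  · have h0 := h 0 F x U s hs hFc hFp hFb
    have h1 : ∑' k, ((monom (0 : Fin d → ℕ) k * Real.exp (-(lam k * s)) : ℝ) : ℂ) * (char k x * fc F k)
        = heatSum (fourierMode e v x) s - (v x e : ℂ) := by
      have h2 : HasSum (fun k : Fin d → ℤ => if k = 0 then (v x e : ℂ) else 0) (v x e : ℂ) := by
        simpa using hasSum_ite_eq (0 : Fin d → ℤ) (v x e : ℂ)
      have h3 := ((heatSummable_fourierMode hvc hv.periodic e x).summable hs).hasSum.sub h2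
      rw [heatSum, ← h3.tsum_eq]
      refine tsum_congr fun k => ?_
      rw [hq]
      split_ifs with hk
      · simp [hk, monom]
      · simp [monom]
    rw [h1] at h0
    refine h0.trans ?_
    simp only [Pi.zero_apply, Finset.sum_const_zero, Nat.cast_zero, sub_zero]
    gcongr
    linarith
  · have h1 : heatSum (lamMul (fourierMode e v x)) s = (4 * Real.pi ^ 2 : ℝ) *
        ∑ l, ∑' k, ((monom (Pi.single l 2 : Fin d → ℕ) k * Real.exp (-(lam k * s)) : ℝ) : ℂ)
          * (char k x * fc F k) := by
      rw [← Summable.tsum_finsetSum, ← tsum_mul_left, heatSum]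
      · refine tsum_congr fun k => ?_
        simp only [monom_single]
        rw [← Finset.sum_mul, hq, lamMul]
        split_ifs with hk
        · simp [hk]
        · rw [lam]; push_cast; rw [← Finset.sum_mul]; ring
      · intro l _
        obtain ⟨A, hA⟩ := exists_norm_le_of_periodic hFc hFp
        refine Summable.of_norm_bounded
          ((summable_abs_monom_mul_exp (Pi.single l 2) hs).mul_right A) fun k => ?_
        rw [norm_mul, norm_mul, norm_char, one_mul, Complex.norm_real, norm_mul, Real.norm_eq_abs,
          Real.norm_of_nonneg (Real.exp_pos _).le]
        gcongr
        exact norm_fc_le hA k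
    rw [h1, norm_mul, Complex.norm_real, Real.norm_of_nonneg (by positivity)]
    calc _ ≤ 4 * Real.pi ^ 2 * ∑ l, c (Pi.single l 2) * U * s ^ (α / 2 - 1) := by
          gcongr
          refine norm_sum_le_of_le _ fun l _ => ?_
          have h0 := h (Pi.single l 2) F x U s hs hFc hFp hFb
          rw [Finset.sum_pi_single', if_pos (Finset.mem_univ l)] at h0
          convert! h0 using 2
          push_cast; ring_nf
      _ = D * U * s ^ (α / 2 - 1) := by rw [← Finset.sum_mul, ← Finset.sum_mul]; ring
      _ ≤ _ := by gcongr; linarith [hc 0]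

end StaticEstimates

/-! ### Primitives of bounded functions, the chain rule, and weak time derivatives. -/

section WeakDerivatives

open Filter Topology

section TimeIntegrals

variable {E : Type*} [NormedAddCommGroup E] [NormedSpace ℝ E]

/-- `f` is a primitive of the bounded function `f'` on `[a, b]`. -/
structure IsPrimitiveOn (f f' : ℝ → E) (a b : ℝ) (K : ℝ≥0) : Prop where
  le : a ≤ b
  integrable : IntervalIntegrable f' volume a b
  bound : ∀ᵐ r, r ∈ Icc a b → ‖f' r‖ ≤ K
  sub_eq : ∀ r ∈ Icc a b, ∀ s ∈ Icc a b, f r - f s = ∫ t in s..r, f' t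

lemma IsPrimitiveOn.lipschitzOnWith {f f' : ℝ → E} {a b : ℝ} {K : ℝ≥0}
    (h : IsPrimitiveOn f f' a b K) : LipschitzOnWith K f (Icc a b) := by
  refine LipschitzOnWith.of_dist_le_mul fun r hr s hs => ?_
  rw [dist_eq_norm, h.sub_eq r hr s hs, Real.dist_eq]
  refine intervalIntegral.norm_integral_le_of_norm_le_const_ae ?_
  filter_upwards [h.bound] with t ht hts
  refine ht ?_
  have h1 := uIoc_subset_uIcc hts
  exact ⟨(le_min hs.1 hr.1).trans h1.1, h1.2.trans (max_le hs.2 hr.2)⟩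

lemma IsPrimitiveOn.ae_hasDerivAt [CompleteSpace E] {f f' : ℝ → E} {a b : ℝ} {K : ℝ≥0}
    (h : IsPrimitiveOn f f' a b K) : ∀ᵐ r, r ∈ Ioo a b → HasDerivAt f (f' r) r := by
  filter_upwards [h.integrable.ae_hasDerivAt_integral] with r hr hrab
  rw [uIcc_of_le h.le] at hr
  have h1 := (hr (Ioo_subset_Icc_self hrab) a (left_mem_Icc.mpr h.le)).const_add (f a)
  refine h1.congr_of_eventuallyEq ?_
  filter_upwards [Ioo_mem_nhds hrab.1 hrab.2] with s hs
  rw [← h.sub_eq s (Ioo_subset_Icc_self hs) a (left_mem_Icc.mpr h.le)]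
  abel

lemma isPrimitiveOn_integral {f' : ℝ → E} {a b c : ℝ} {K : ℝ≥0} (hab : a ≤ b)
    (hc : c ∈ Icc a b) (hint : IntervalIntegrable f' volume a b)
    (hb : ∀ᵐ r, r ∈ Icc a b → ‖f' r‖ ≤ K) :
    IsPrimitiveOn (fun t => ∫ r in c..t, f' r) f' a b K := by
  have hsub : ∀ r ∈ Icc a b, ∀ s ∈ Icc a b, IntervalIntegrable f' volume r s := fun r hr s hs =>
    hint.mono_set (by rw [uIcc_of_le hab]; exact uIcc_subset_Icc hr hs)
  exact ⟨hab, hint, hb, fun r hr s hs =>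
    intervalIntegral.integral_interval_sub_left (hsub c hc r hr) (hsub c hc s hs)⟩

/-- The fundamental theorem of calculus for Lipschitz functions with values in a Banach space. -/
lemma sub_eq_integral_of_lipschitzOnWith [CompleteSpace E] {f f' : ℝ → E} {a b : ℝ} (hab : a ≤ b) {K K' : ℝ≥0}
    (hf : LipschitzOnWith K f (Icc a b)) (hint : IntervalIntegrable f' volume a b)
    (hb : ∀ᵐ r, r ∈ Icc a b → ‖f' r‖ ≤ K')
    (hd : ∀ᵐ r, r ∈ Ioo a b → HasDerivAt f (f' r) r) : f b - f a = ∫ r in a..b, f' r := by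
  have hI := isPrimitiveOn_integral hab (left_mem_Icc.mpr hab) hint hb
  -- The difference of f and the primitive of f' is Lipschitz with derivative 0 almost everywhere,
  -- hence constant.
  have hac : AbsolutelyContinuousOnInterval (fun t => f t - ∫ r in a..t, f' r) a b := by
    refine LipschitzOnWith.absolutelyContinuousOnInterval (K := K + K') ?_
    rw [uIcc_of_le hab]
    exact hf.sub hI.lipschitzOnWith
  have hend : ∀ c : ℝ, ∀ᵐ r : ℝ, r ≠ c := fun c => by
    simp [ae_iff]
  obtain ⟨C, hC⟩ := hac.const_of_ae_hasDerivAt_zero (by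
    filter_upwards [hd, hI.ae_hasDerivAt, hend a, hend b] with r h1 h2 h3 h4 h5
    rw [uIcc_of_le hab] at h5
    have h6 : r ∈ Ioo a b := ⟨lt_of_le_of_ne h5.1 h3.symm, lt_of_le_of_ne h5.2 h4⟩
    simpa using (h1 h6).fun_sub (h2 h6))
  have h1 := hC a left_mem_uIcc
  have h2 := hC b right_mem_uIcc
  simp only [intervalIntegral.integral_same, sub_zero] at h1
  rw [sub_eq_iff_eq_add] at h2
  rw [h2, h1]; abel

/-- The chain rule in integrated form for a smooth function of a Lipschitz curve. -/
lemma IsPrimitiveOn.comp {F : Type*} [NormedAddCommGroup F] [NormedSpace ℝ F] [CompleteSpace F]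
    [CompleteSpace E]
    {f f' : ℝ → E} {a b : ℝ} {K : ℝ≥0} (h : IsPrimitiveOn f f' a b K) {Φ : E → F}
    (hΦ : ContDiff ℝ 1 Φ) :
    IntervalIntegrable (fun r => fderiv ℝ Φ (f r) (f' r)) volume a b ∧
    Φ (f b) - Φ (f a) = ∫ r in a..b, fderiv ℝ Φ (f r) (f' r) := by
  have hfc : ContinuousOn f (Icc a b) := h.lipschitzOnWith.continuousOn
  have hS : IsCompact (f '' Icc a b) := isCompact_Icc.image_of_continuousOn hfc
  obtain ⟨L, hL⟩ := (hΦ.locallyLipschitz.locallyLipschitzOn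
    (s := f '' Icc a b)).exists_lipschitzOnWith_of_compact hS
  obtain ⟨D, hD⟩ := hS.exists_bound_of_continuousOn
    (hΦ.continuous_fderiv one_ne_zero).continuousOn
  have hlip : LipschitzOnWith (L * K) (fun r => Φ (f r)) (Icc a b) :=
    hL.comp h.lipschitzOnWith fun r hr => mem_image_of_mem f hr
  have hbound : ∀ᵐ r, r ∈ Icc a b → ‖fderiv ℝ Φ (f r) (f' r)‖ ≤ (Real.toNNReal D * K : ℝ≥0) := by
    filter_upwards [h.bound] with r hr hrab
    refine (ContinuousLinearMap.le_opNorm _ _).trans ?_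
    rw [NNReal.coe_mul]
    exact mul_le_mul ((hD _ (mem_image_of_mem f hrab)).trans (Real.le_coe_toNNReal D)) (hr hrab)
      (norm_nonneg _) (NNReal.coe_nonneg _)
  have hmeas : AEStronglyMeasurable (fun r => fderiv ℝ Φ (f r) (f' r))
      (volume.restrict (Icc a b)) := by
    have h1 : AEStronglyMeasurable (fun r => fderiv ℝ Φ (f r)) (volume.restrict (Icc a b)) :=
      ((hΦ.continuous_fderiv one_ne_zero).comp_continuousOn hfc).aestronglyMeasurable
        measurableSet_Icc
    have h2 : AEStronglyMeasurable f' (volume.restrict (Icc a b)) := by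
      have := (intervalIntegrable_iff_integrableOn_Icc_of_le h.le).mp h.integrable
      exact this.aestronglyMeasurable
    exact (ContinuousLinearMap.apply ℝ F).flip.aestronglyMeasurable_comp₂ h1 h2
  have hint : IntervalIntegrable (fun r => fderiv ℝ Φ (f r) (f' r)) volume a b := by
    rw [intervalIntegrable_iff_integrableOn_Icc_of_le h.le]
    exact Integrable.of_bound hmeas _ ((ae_restrict_iff' measurableSet_Icc).mpr hbound)
  refine ⟨hint, sub_eq_integral_of_lipschitzOnWith h.le hlip hint hbound ?_⟩
  filter_upwards [h.ae_hasDerivAt] with r hr hrab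
  exact ((hΦ.differentiable one_ne_zero (f r)).hasFDerivAt).comp_hasDerivAt r (hr hrab)

lemma IsPrimitiveOn.prodMk {F : Type*} [NormedAddCommGroup F] [NormedSpace ℝ F]
    {f f' : ℝ → E} {g g' : ℝ → F} {a b : ℝ} {K L : ℝ≥0} [CompleteSpace E] [CompleteSpace F]
    (hf : IsPrimitiveOn f f' a b K) (hg : IsPrimitiveOn g g' a b L) :
    IsPrimitiveOn (fun r => (f r, g r)) (fun r => (f' r, g' r)) a b (max K L) := by
  have hint : IntervalIntegrable (fun r => (f' r, g' r)) volume a b := by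
    rw [intervalIntegrable_iff_integrableOn_Icc_of_le hf.le]
    exact ((intervalIntegrable_iff_integrableOn_Icc_of_le hf.le).mp hf.integrable).prodMk
      ((intervalIntegrable_iff_integrableOn_Icc_of_le hf.le).mp hg.integrable)
  refine ⟨hf.le, hint, ?_, fun r hr s hs => ?_⟩
  · filter_upwards [hf.bound, hg.bound] with r h1 h2 h3
    rw [Prod.norm_mk, NNReal.coe_max]
    exact max_le_max (h1 h3) (h2 h3)
  · have h1 : IntervalIntegrable (fun r => (f' r, g' r)) volume s r :=
      hint.mono_set (by rw [uIcc_of_le hf.le]; exact uIcc_subset_Icc hs hr)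
    have h2 := (ContinuousLinearMap.fst ℝ E F).intervalIntegral_comp_comm h1
    have h3 := (ContinuousLinearMap.snd ℝ E F).intervalIntegral_comp_comm h1
    simp only [ContinuousLinearMap.coe_fst', ContinuousLinearMap.coe_snd'] at h2 h3
    ext
    · rw [← h2]; exact hf.sub_eq r hr s hs
    · rw [← h3]; exact hg.sub_eq r hr s hs

lemma isPrimitiveOn_of_hasDerivAt {f f' : ℝ → E} [CompleteSpace E] {a b : ℝ} (hab : a ≤ b)
    (hf : ∀ r, HasDerivAt f (f' r) r) (hf' : Continuous f') :
    ∃ K, IsPrimitiveOn f f' a b K := by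
  obtain ⟨D, hD⟩ := isCompact_Icc.exists_bound_of_continuousOn (hf'.continuousOn (s := Icc a b))
  refine ⟨Real.toNNReal D, hab, hf'.intervalIntegrable _ _, ae_of_all _ fun r hr =>
    (hD r hr).trans (Real.le_coe_toNNReal D), fun r _ s _ => ?_⟩
  exact (intervalIntegral.integral_eq_sub_of_hasDerivAt (fun t _ => hf t)
    (hf'.intervalIntegrable _ _)).symm

/-- A compact subset of an open interval lies in the interior of a compact subinterval. -/
lemma exists_Ioo_of_isCompact {J K : Set ℝ} (hJ : IsOpen J) (hJc : J.OrdConnected)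
    (hK : IsCompact K) (hne : K.Nonempty) (hKJ : K ⊆ J) :
    ∃ l r, l ≤ r ∧ K ⊆ Ioo l r ∧ Icc l r ⊆ J := by
  obtain ⟨m, hm⟩ := hK.exists_isLeast hne
  obtain ⟨M, hM⟩ := hK.exists_isGreatest hne
  obtain ⟨l, hl, hlJ⟩ := ((frequently_lt_nhds m).and_eventually (hJ.mem_nhds (hKJ hm.1))).exists
  obtain ⟨r, hr, hrJ⟩ := ((frequently_gt_nhds M).and_eventually (hJ.mem_nhds (hKJ hM.1))).exists
  have h1 : m ≤ M := hm.2 hM.1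
  exact ⟨l, r, by linarith, fun t ht => ⟨hl.trans_le (hm.2 ht), (hM.2 ht).trans_lt hr⟩,
    hJc.out hlJ hrJ⟩

/-- A bounded function with bounded weak derivative is almost everywhere a primitive of it. -/
lemma exists_isPrimitiveOn_of_weak [CompleteSpace E] {J : Set ℝ} (hJ : IsOpen J)
    (hJc : J.OrdConnected) (hJn : J.Nonempty) {a b : ℝ → E} {A K : ℝ≥0}
    (ha : AEStronglyMeasurable a (volume.restrict J)) (hb : AEStronglyMeasurable b (volume.restrict J))
    (hA : ∀ᵐ t ∂volume.restrict J, ‖a t‖ ≤ A) (hK : ∀ᵐ t ∂volume.restrict J, ‖b t‖ ≤ K)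
    (hw : ∀ η : ℝ → ℝ, ContDiff ℝ ∞ η → HasCompactSupport η → tsupport η ⊆ J →
      ∫ t in J, (deriv η t • a t + η t • b t) = 0) :
    ∃ f : ℝ → E, (∀ᵐ t ∂volume.restrict J, a t = f t) ∧
      ∀ s ∈ J, ∀ t ∈ J, s ≤ t → IsPrimitiveOn f b s t K := by
  obtain ⟨t₀, ht₀⟩ := hJn
  have hloc : ∀ {g : ℝ → E} {A : ℝ≥0}, AEStronglyMeasurable g (volume.restrict J) →
      (∀ᵐ t ∂volume.restrict J, ‖g t‖ ≤ A) → ∀ l r, Icc l r ⊆ J → IntegrableOn g (Icc l r) :=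
    fun hg hgA l r hlr => Integrable.of_bound (hg.mono_measure (Measure.restrict_mono hlr le_rfl)) _
      (ae_mono (Measure.restrict_mono hlr le_rfl) hgA)
  have hbint : ∀ s ∈ J, ∀ t ∈ J, IntervalIntegrable b volume s t := fun s hs t ht => by
    have := hloc hb hK (min s t) (max s t) (hJc.uIcc_subset hs ht)
    rw [intervalIntegrable_iff]
    exact this.mono_set uIoc_subset_uIcc
  -- It remains to show that a - P is almost everywhere constant, which is the du Bois-Reymond
  -- lemma.
  set P : ℝ → E := fun t => ∫ r in t₀..t, b r with hP
  have hPprim : ∀ s ∈ J, ∀ t ∈ J, s ≤ t → IsPrimitiveOn P b s t K := fun s hs t ht hst => by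
    refine ⟨hst, hbint s hs t ht, ?_, fun r hr q hq => ?_⟩
    · filter_upwards [(ae_restrict_iff' hJ.measurableSet).mp hK] with r hr hrst
      exact hr (hJc.out hs ht hrst)
    · exact intervalIntegral.integral_interval_sub_left
        (hbint _ ht₀ _ (hJc.out hs ht hr)) (hbint _ ht₀ _ (hJc.out hs ht hq))
  have hPcont : ContinuousOn P J := fun t ht => by
    obtain ⟨l, r, hlr, hKlr, hsub⟩ := exists_Ioo_of_isCompact hJ hJc isCompact_singleton
      (singleton_nonempty t) (singleton_subset_iff.mpr ht)
    have h1 := (hPprim l (hsub (left_mem_Icc.mpr hlr)) r (hsub (right_mem_Icc.mpr hlr))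
      hlr).lipschitzOnWith.continuousOn
    have h2 : t ∈ Ioo l r := hKlr rfl
    exact (h1.continuousAt (Icc_mem_nhds h2.1 h2.2)).continuousWithinAt
  have hPloc : ∀ l r, Icc l r ⊆ J → IntegrableOn P (Icc l r) := fun l r h =>
    (hPcont.mono h).integrableOn_compact isCompact_Icc
  set w : ℝ → E := fun t => a t - P t with hwdef
  have hwloc : ∀ l r, Icc l r ⊆ J → IntegrableOn w (Icc l r) := fun l r h =>
    (hloc ha hA l r h).sub (hPloc l r h)
  have hcut : ∀ {g : ℝ → E} {l r : ℝ}, Icc l r ⊆ J → (∀ t, t ∉ Icc l r → g t = 0) →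
      ∫ t in J, g t = ∫ t in Icc l r, g t := fun hlr hg =>
    setIntegral_eq_of_subset_of_forall_sdiff_eq_zero hJ.measurableSet hlr fun t ht => hg t ht.2
  -- the derivative of a test function is orthogonal to `w`
  have horth : ∀ (η g : ℝ → ℝ) (l r : ℝ), l ≤ r → Icc l r ⊆ J → (∀ t, HasDerivAt η (g t) t) →
      ContDiff ℝ ∞ η → (∀ t, t ∉ Ioo l r → η t = 0) → (∀ t, t ∉ Ioo l r → g t = 0) →
      ∫ t in Icc l r, g t • w t = 0 := by
    intro η g l r hlr hsub hηg hη h0 hg0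
    have hsupp : tsupport η ⊆ Icc l r := closure_minimal (fun t ht => by
      by_contra h; exact ht (h0 t fun h' => h (Ioo_subset_Icc_self h'))) isClosed_Icc
    have hgd : deriv η = g := funext fun t => (hηg t).deriv
    have hgc : Continuous g := hgd ▸ hη.continuous_deriv (by simp)
    have h1 := hw η hη (isCompact_Icc.of_isClosed_subset (isClosed_tsupport η) hsupp)
      (hsupp.trans hsub)
    rw [hgd, hcut hsub (fun t ht => by
      have : t ∉ Ioo l r := fun h => ht (Ioo_subset_Icc_self h)
      rw [h0 t this, hg0 t this]; simp)] at h1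
    obtain ⟨L, hηP⟩ := isPrimitiveOn_of_hasDerivAt hlr hηg hgc
    have h2 := ((hηP.prodMk (hPprim l (hsub (left_mem_Icc.mpr hlr)) r
      (hsub (right_mem_Icc.mpr hlr)) hlr)).comp (Φ := fun p : ℝ × E => p.1 • p.2)
      (contDiff_fst.smul contDiff_snd)).2
    have hfd : ∀ (p q : ℝ × E), fderiv ℝ (fun p : ℝ × E => p.1 • p.2) p q
        = q.1 • p.2 + p.1 • q.2 := fun p q => by
      have := (hasFDerivAt_fst (𝕜 := ℝ) (p := p)).smul (hasFDerivAt_snd (𝕜 := ℝ) (p := p))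
      have h3 : HasFDerivAt (fun p : ℝ × E => p.1 • p.2) _ p := this
      rw [h3.fderiv]
      simp [add_comm]
    simp only [hfd] at h2
    rw [h0 l (fun h => lt_irrefl _ h.1), h0 r (fun h => lt_irrefl _ h.2), zero_smul, zero_smul,
      sub_zero, intervalIntegral.integral_of_le hlr, ← integral_Icc_eq_integral_Ioc] at h2
    have hi : ∀ {ζ : ℝ → ℝ} {f : ℝ → E}, Continuous ζ → IntegrableOn f (Icc l r) →
        IntegrableOn (fun t => ζ t • f t) (Icc l r) := fun hζ hf => by
      exact hf.continuousOn_smul hζ.continuousOn isCompact_Icc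
    have hηc := hη.continuous
    have ia := hi hgc (hloc ha hA l r hsub)
    have ib := hi hηc (hloc hb hK l r hsub)
    have ic := hi hgc (hPloc l r hsub)
    rw [integral_add ia ib] at h1
    rw [integral_add ic ib] at h2
    simp only [hwdef, smul_sub]
    rw [integral_sub ia ic, eq_neg_of_add_eq_zero_left h1, eq_neg_of_add_eq_zero_left h2.symm,
      sub_self]
  -- A fixed bump at t₀; its weighted mean of w is the candidate for the constant c.
  obtain ⟨η₀, hη₀s, hη₀c, hη₀, hη₀r, hη₀1⟩ :=
    exists_contDiff_tsupport_subset (n := ⊤) (hJ.mem_nhds ht₀)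
  have hI₀ : 0 < ∫ t, η₀ t := hη₀.continuous.integral_pos_of_hasCompactSupport_nonneg_nonzero
    hη₀c (fun t => (hη₀r ⟨t, rfl⟩).1) (x := t₀) (by rw [hη₀1]; exact one_ne_zero)
  have hint : ∀ {ζ : ℝ → ℝ} {f : ℝ → E} {l r : ℝ}, Continuous ζ → IntegrableOn f (Icc l r) →
      IntegrableOn (fun t => ζ t • f t) (Icc l r) := fun hζ hf =>
    hf.continuousOn_smul hζ.continuousOn isCompact_Icc
  set c : E := (∫ t, η₀ t)⁻¹ • ∫ t in J, η₀ t • w t with hc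
  have hψ : ∀ ψ : ℝ → ℝ, ContDiff ℝ ∞ ψ → HasCompactSupport ψ → tsupport ψ ⊆ J →
      ∫ t, ψ t • (w t - c) = 0 := by
    intro ψ hψ hψc hψs
    obtain ⟨l, r, hlr, hKlr, hsub⟩ := exists_Ioo_of_isCompact hJ hJc
      (hψc.isCompact.union hη₀c.isCompact) ⟨t₀, Or.inr (subset_tsupport _ (by simp [hη₀1]))⟩
      (union_subset hψs hη₀s)
    have hψ0 : ∀ t, t ∉ Ioo l r → ψ t = 0 := fun t ht =>
      image_eq_zero_of_notMem_tsupport fun h => ht (hKlr (Or.inl h))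
    have hη0 : ∀ t, t ∉ Ioo l r → η₀ t = 0 := fun t ht =>
      image_eq_zero_of_notMem_tsupport fun h => ht (hKlr (Or.inr h))
    -- Subtracting κη₀ from ψ gives integral zero, so the primitive of the difference is again a
    -- compactly supported test function.
    set κ : ℝ := (∫ t, ψ t) * (∫ t, η₀ t)⁻¹ with hκ
    set g : ℝ → ℝ := fun t => ψ t - κ * η₀ t with hg
    have hgs : ContDiff ℝ ∞ g := hψ.sub (contDiff_const.mul hη₀)
    have hgc := hgs.continuous
    have hg0 : ∀ t, t ∉ Ioo l r → g t = 0 := fun t ht => by simp [hg, hψ0 t ht, hη0 t ht]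
    set η : ℝ → ℝ := fun t => ∫ s in l..t, g s with hηdef
    have hηg : ∀ t, HasDerivAt η (g t) t := fun t =>
      intervalIntegral.integral_hasDerivAt_right (hgc.intervalIntegrable _ _)
        (hgc.stronglyMeasurableAtFilter _ _) hgc.continuousAt
    have hη : ContDiff ℝ ∞ η := contDiff_infty_iff_deriv.mpr
      ⟨fun t => (hηg t).differentiableAt, by rwa [funext fun t => (hηg t).deriv]⟩
    have hzero : ∀ {ζ : ℝ → ℝ}, (∀ t, t ∉ Ioo l r → ζ t = 0) → ∫ t in l..r, ζ t = ∫ t, ζ t :=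
      fun h => by
        rw [intervalIntegral.integral_of_le hlr, integral_Ioc_eq_integral_Ioo]
        exact setIntegral_eq_integral_of_forall_compl_eq_zero h
    have hηr : η r = 0 := by
      simp only [hηdef, hg]
      rw [intervalIntegral.integral_sub (hψ.continuous.intervalIntegrable _ _)
        ((hη₀.continuous.const_mul κ).intervalIntegrable _ _),
        intervalIntegral.integral_const_mul, hzero hψ0, hzero hη0, hκ]
      field_simp
      simp
    have hηz : ∀ t, t ∉ Ioo l r → η t = 0 := by
      intro t ht
      by_cases htl : t ≤ l
      · refine (intervalIntegral.integral_congr (g := fun _ => 0) fun s hs => ?_).trans (by simp)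
        rw [uIcc_of_ge htl] at hs
        exact hg0 s fun h => absurd h.1 (not_lt.mpr hs.2)
      · have hrt : r ≤ t := not_lt.mp fun h => ht ⟨not_le.mp htl, h⟩
        have h1 : η t - η r = ∫ s in r..t, g s := intervalIntegral.integral_interval_sub_left
          (hgc.intervalIntegrable _ _) (hgc.intervalIntegrable _ _)
        rw [hηr, sub_zero] at h1
        rw [h1]
        refine (intervalIntegral.integral_congr (g := fun _ => 0) fun s hs => ?_).trans (by simp)
        rw [uIcc_of_le hrt] at hs
        exact hg0 s fun h => absurd h.2 (not_lt.mpr hs.1)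
    have key := horth η g l r hlr hsub hηg hη hηz hg0
    have hwi := hwloc l r hsub
    have h1 : ∫ t in Icc l r, ψ t • w t = κ • ∫ t in Icc l r, η₀ t • w t := by
      have hk : IntegrableOn (fun t => κ • η₀ t • w t) (Icc l r) :=
        (hint hη₀.continuous hwi).smul κ
      rw [← integral_smul, ← sub_eq_zero, ← integral_sub (hint hψ.continuous hwi) hk, ← key]
      congr 1; ext t
      simp only [hg, sub_smul, smul_smul]
    have h2 : ∫ t, ψ t • (w t - c) = ∫ t in Icc l r, ψ t • (w t - c) :=
      (setIntegral_eq_integral_of_forall_compl_eq_zero fun t ht => by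
        rw [hψ0 t fun h => ht (Ioo_subset_Icc_self h), zero_smul]).symm
    have h3 : ∫ t in Icc l r, ψ t = ∫ t, ψ t :=
      setIntegral_eq_integral_of_forall_compl_eq_zero fun t ht =>
        hψ0 t fun h => ht (Ioo_subset_Icc_self h)
    have h4 : ∫ t in J, η₀ t • w t = ∫ t in Icc l r, η₀ t • w t := hcut hsub fun t ht => by
      rw [hη0 t fun h => ht (Ioo_subset_Icc_self h), zero_smul]
    rw [h2]
    simp only [smul_sub]
    rw [integral_sub (hint hψ.continuous hwi)
      (hint hψ.continuous (integrableOn_const (by simp) (by simp))), h1, integral_smul_const, h3,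
      hc, h4, smul_smul, ← hκ, sub_self]
  have hae := hJ.ae_eq_zero_of_integral_contDiff_smul_eq_zero (f := fun t => w t - c)
    (μ := volume) ?_ hψ
  · refine ⟨fun t => P t + c, ?_, fun s hs t ht hst => ?_⟩
    · rw [ae_restrict_iff' hJ.measurableSet]
      filter_upwards [hae] with t ht htJ
      have := ht htJ
      rw [hwdef, sub_eq_zero, sub_eq_iff_eq_add] at this
      rw [this, add_comm]
    · have h := hPprim s hs t ht hst
      refine ⟨h.le, h.integrable, h.bound, fun r hr q hq => ?_⟩
      rw [← h.sub_eq r hr q hq]; abel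
  · rw [locallyIntegrableOn_iff hJ.isLocallyClosed]
    intro k hkJ hk
    rcases k.eq_empty_or_nonempty with rfl | hne
    · exact integrableOn_empty
    · obtain ⟨l, r, _, hKlr, hsub⟩ := exists_Ioo_of_isCompact hJ hJc hk hne hkJ
      exact ((hwloc l r hsub).sub (integrableOn_const (by simp) (by simp))).mono_set
        (hKlr.trans Ioo_subset_Icc_self)

end TimeIntegrals

end WeakDerivatives

/-! ### Plane wave test fields and regular time slices. -/

section TestFields

open Filter Topology

variable {d : ℕ}

/-- The phase as a continuous linear functional. -/
def phaseL (k : Fin d → ℤ) : Space d →L[ℝ] ℝ :=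
  ∑ i, (k i : ℝ) • (EuclideanSpace.proj i : Space d →L[ℝ] ℝ)

@[simp] lemma phaseL_apply (k : Fin d → ℤ) (y : Space d) : phaseL k y = phase k y := by
  simp [phaseL, phase]

/-- The plane wave `cos (2πk·y + p)`. -/
def wave (k : Fin d → ℤ) (p : ℝ) (y : Space d) : ℝ := Real.cos (2 * Real.pi * phase k y + p)

lemma wave_add_pi (k : Fin d → ℤ) (p : ℝ) (y : Space d) :
    wave k (p + Real.pi / 2 + Real.pi / 2) y = -wave k p y := by
  rw [wave, wave, ← Real.cos_add_pi]; congr 1; ring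

/-- Test fields are real, so a complex mode is assembled from two plane waves a quarter period
apart. -/
lemma char_neg_eq_wave (k : Fin d → ℤ) (y : Space d) :
    char (-k) y = (wave k 0 y : ℂ) + Complex.I * (wave k (0 + Real.pi / 2) y : ℂ) := by
  rw [char_eq_exp_mul_I, phase_neg, wave, wave, add_zero, zero_add, Real.cos_add_pi_div_two,
    Complex.exp_mul_I, ← Complex.ofReal_cos, ← Complex.ofReal_sin, mul_neg, Real.cos_neg,
    Real.sin_neg]
  push_cast; ring

lemma contDiff_wave (k : Fin d → ℤ) (p : ℝ) : ContDiff ℝ ∞ (wave k p) := by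
  have : wave k p = fun y => Real.cos (2 * Real.pi * phaseL k y + p) := by ext; simp [wave]
  rw [this]
  exact Real.contDiff_cos.comp ((contDiff_const.mul (phaseL k).contDiff).add contDiff_const)

@[fun_prop] lemma continuous_wave (k : Fin d → ℤ) (p : ℝ) : Continuous (wave k p) :=
  (contDiff_wave k p).continuous

lemma hasFDerivAt_wave (k : Fin d → ℤ) (p : ℝ) (y : Space d) :
    HasFDerivAt (wave k p) ((2 * Real.pi * wave k (p + Real.pi / 2) y) • phaseL k) y := by
  have h1 : HasFDerivAt (fun y => 2 * Real.pi * phaseL k y + p) ((2 * Real.pi) • phaseL k) y :=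
    ((phaseL k).hasFDerivAt.const_mul _).add_const p
  have h2 := h1.cos
  have : wave k p = fun y => Real.cos (2 * Real.pi * phaseL k y + p) := by ext; simp [wave]
  rw [this]
  convert! h2 using 1
  rw [wave, ← add_assoc, Real.cos_add_pi_div_two, smul_smul, phaseL_apply]
  congr 1; ring

lemma wave_periodic (k : Fin d → ℤ) (p : ℝ) : TorusPeriodic (wave k p) := fun i y => by
  have : phase k (EuclideanSpace.single i 1) = k i := by simp [phase]
  have h := Real.cos_add_int_mul_two_pi (2 * Real.pi * phase k y + p) (k i)
  rw [wave, wave, phase_add, this, ← h]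
  congr 1; ring

/-- The derivatives of a plane wave field. -/
lemma fderiv_wave_smul (k : Fin d → ℤ) (p s : ℝ) (c y w : Space d) :
    fderiv ℝ (fun y => (s * wave k p y) • c) y w
      = (s * (2 * Real.pi * wave k (p + Real.pi / 2) y * phase k w)) • c := by
  have h : HasFDerivAt (fun y => (s * wave k p y) • c) _ y :=
    (((hasFDerivAt_wave k p y).const_mul s).smul_const c)
  rw [h.fderiv]
  simp

lemma laplacian_wave_smul (k : Fin d → ℤ) (p s : ℝ) (c y : Space d) :
    Laplacian.laplacian (fun y => (s * wave k p y) • c) y = -(lam k * s * wave k p y) • c := by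
  have h1 : fderiv ℝ (fun y => (s * wave k p y) • c) = fun y =>
      (s * (2 * Real.pi) * wave k (p + Real.pi / 2) y) • (phaseL k).smulRight c := by
    ext y w : 2
    rw [fderiv_wave_smul]
    simp only [smul_apply, ContinuousLinearMap.smulRight_apply, phaseL_apply,
      smul_smul]
    congr 1; ring
  rw [InnerProductSpace.laplacian_eq_iteratedFDeriv_orthonormalBasis _
    (EuclideanSpace.basisFun (Fin d) ℝ)]
  have h2 : ∀ i, iteratedFDeriv ℝ 2 (fun y => (s * wave k p y) • c) y
      ![(EuclideanSpace.basisFun (Fin d) ℝ) i, (EuclideanSpace.basisFun (Fin d) ℝ) i]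
      = (-(4 * Real.pi ^ 2 * (k i : ℝ) ^ 2 * s * wave k p y)) • c := fun i => by
    rw [iteratedFDeriv_two_apply, h1]
    have h : HasFDerivAt (fun y => (s * (2 * Real.pi) * wave k (p + Real.pi / 2) y) •
        (phaseL k).smulRight c) _ y :=
      (((hasFDerivAt_wave k (p + Real.pi / 2) y).const_mul (s * (2 * Real.pi))).smul_const _)
    have hk : phase k (EuclideanSpace.single i 1) = k i := by simp [phase]
    rw [h.fderiv]
    simp [hk, wave_add_pi, smul_smul]
    congr 1; ring
  simp only [h2, ← Finset.sum_smul]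
  congr 1
  rw [Finset.sum_neg_distrib, lam, ← Finset.sum_mul, ← Finset.sum_mul, Finset.mul_sum]

lemma isOpen_timeInterval (T : EReal) : IsOpen (timeInterval T) :=
  (isOpen_lt continuous_const continuous_id).inter
    (isOpen_lt continuous_coe_real_ereal continuous_const)

lemma ordConnected_timeInterval (T : EReal) : (timeInterval T).OrdConnected :=
  ⟨fun _ hs _ ht _ hr => ⟨hs.1.trans_le hr.1, (EReal.coe_le_coe_iff.mpr hr.2).trans_lt ht.2⟩⟩

/-- Plane waves with amplitude orthogonal to the frequency are admissible test fields. -/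
lemma isTestField_wave {T : EReal} (k : Fin d → ℤ) (p : ℝ) {c : Space d} (hc : phase k c = 0)
    {η : ℝ → ℝ} (hη : ContDiff ℝ ∞ η) (hηc : HasCompactSupport η)
    (hηs : tsupport η ⊆ timeInterval T) (hT : (timeInterval T).Nonempty) :
    IsTestField T (fun t y => (η t * wave k p y) • c) where
  smooth := by
    have h1 : ContDiff ℝ ∞ fun z : ℝ × Space d => η z.1 := hη.comp contDiff_fst
    have h2 : ContDiff ℝ ∞ fun z : ℝ × Space d => wave k p z.2 := (contDiff_wave k p).comp contDiff_snd
    exact (h1.mul h2).smul contDiff_const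
  periodic := fun t i y => by simp only [wave_periodic k p i y]
  divFree := fun t y => by
    have h : ∀ i : Fin d, phase k (EuclideanSpace.single i 1) = k i := fun i => by simp [phase]
    simp only [divergence, fderiv_wave_smul, h, PiLp.smul_apply, smul_eq_mul]
    rw [phase] at hc
    calc _ = η t * (2 * Real.pi * wave k (p + Real.pi / 2) y) * ∑ i, (k i : ℝ) * c i := by
          rw [Finset.mul_sum]; exact Finset.sum_congr rfl fun i _ => by ring
      _ = 0 := by rw [hc, mul_zero]
  compactSupport := by
    obtain ⟨t₀, ht₀⟩ := hT
    obtain ⟨l, r, hlr, hK, hsub⟩ := exists_Ioo_of_isCompact (isOpen_timeInterval T)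
      (ordConnected_timeInterval T) (hηc.isCompact.union isCompact_singleton)
      ⟨t₀, Or.inr rfl⟩ (union_subset hηs (singleton_subset_iff.mpr ht₀))
    refine ⟨r, (hsub (right_mem_Icc.mpr hlr)).2, fun t ht y => ?_⟩
    have : η t = 0 := image_eq_zero_of_notMem_tsupport fun h =>
      absurd (hK (Or.inl h)).2 (not_lt.mpr ht)
    rw [this, zero_mul, zero_smul]

/-- The regularity of `u (t, ·)` at almost every time. -/
structure GoodSlice (α U M : ℝ) (v : Space d → Space d) : Prop where
  holder : HolderField α U v
  bound : ∀ y, ‖v y‖ ≤ M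
  divFree : WeaklyDivFree v

lemma ae_goodSlice {α : ℝ≥0} {T : EReal} {ν : ℝ} {u₀ : Space d → Space d}
    {u : ℝ → Space d → Space d} (hu : MemLinftyHolder α T u) (hw : IsWeakSolution ν T u₀ u) :
    ∃ M : ℝ, 0 ≤ M ∧ ∀ᵐ t ∂volume.restrict (timeInterval T),
      GoodSlice (α : ℝ) (holderNorm α T u) M (u t) := by
  obtain ⟨M, hM⟩ := hu.bounded
  refine ⟨max M 0, le_max_right _ _, ?_⟩
  filter_upwards [hM, hw.divFree, ae_le_essSup (f := fun t => eHolderNorm α (u t)),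
    ae_restrict_mem (isOpen_timeInterval T).measurableSet] with t h1 h2 h3 h4
  have h5 : eHolderNorm α (u t) ≤ holderENorm α T u := h3
  have h6 : MemHolder α (u t) := eHolderNorm_lt_top.mp (h5.trans_lt hu.holder)
  refine ⟨⟨hu.periodic t h4, fun y z => ?_⟩, fun y => (h1 y).trans (le_max_left _ _), h2⟩
  have h7 := h6.holderWith.dist_le y z
  rw [dist_eq_norm, dist_eq_norm] at h7
  refine h7.trans ?_
  gcongr
  rw [holderNorm, ← ENNReal.coe_toReal]
  refine ENNReal.toReal_mono hu.holder.ne ?_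
  rw [h6.coe_nnHolderNorm_eq_eHolderNorm]
  exact h5

/-- The frequency pairing of a divergence free field vanishes. -/
lemma integral_char_mul_phase_eq_zero {v : Space d → Space d} (hc : Continuous v)
    (hd : WeaklyDivFree v) (k : Fin d → ℤ) :
    ∫ y in unitCell d, char (-k) y * (phase k (v y) : ℂ) = 0 := by
  have h : ∀ p, ∫ y in unitCell d, wave k p y * phase k (v y) = 0 := fun p => by
    have h1 := hd (wave k (p - Real.pi / 2)) (contDiff_wave k _) (wave_periodic k _)
    have h2 : ∀ y, fderiv ℝ (wave k (p - Real.pi / 2)) y (v y)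
        = 2 * Real.pi * (wave k p y * phase k (v y)) := fun y => by
      rw [(hasFDerivAt_wave k _ y).fderiv, sub_add_cancel]
      simp [mul_assoc]
    simp only [h2] at h1
    rw [integral_const_mul] at h1
    exact (mul_eq_zero.mp h1).resolve_left (by positivity)
  have h3 : ∀ y, char (-k) y * (phase k (v y) : ℂ) = ((wave k 0 y * phase k (v y) : ℝ) : ℂ)
      + Complex.I * ((wave k (0 + Real.pi / 2) y * phase k (v y) : ℝ) : ℂ) := fun y => by
    rw [char_neg_eq_wave]; push_cast; ring
  simp only [h3]
  have hi : ∀ p, IntegrableOn (fun y => ((wave k p y * phase k (v y) : ℝ) : ℂ)) (unitCell d) :=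
    fun p => integrable_unitCell (by fun_prop)
  rw [integral_add (hi _) ((hi _).const_mul _), integral_const_mul, integral_complex_ofReal,
    integral_complex_ofReal, h, h]
  simp

/-- The Fourier coefficient of `⟨v, c⟩`. -/
def modeCoeff (k : Fin d → ℤ) (c : Space d) (v : Space d → Space d) : ℂ :=
  ∫ y in unitCell d, char (-k) y * (⟪v y, c⟫ : ℝ)

/-- The Fourier coefficient of `-div (v ⊗ v) · c`, with a sign. -/
def modeFlux (k : Fin d → ℤ) (c : Space d) (v : Space d → Space d) : ℂ :=
  ∫ y in unitCell d, -(2 * Real.pi * Complex.I) * (char (-k) y * ((phase k (v y) * ⟪v y, c⟫ : ℝ) : ℂ))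

end TestFields

/-! ### The weak formulation tested with a single Fourier mode. -/

section WeakFormulation

open Filter Topology

variable {d : ℕ}

lemma aestronglyMeasurable_cellIntegral {T : EReal} {u : ℝ → Space d → Space d}
    (hu : AEStronglyMeasurable (fun z : ℝ × Space d => u z.1 z.2)
      (volume.restrict (timeInterval T ×ˢ unitCell d)))
    {G : Space d → Space d → ℂ} (hG : Continuous fun z : Space d × Space d => G z.1 z.2) :
    AEStronglyMeasurable (fun t => ∫ y in unitCell d, G y (u t y))
      (volume.restrict (timeInterval T)) := by
  rw [Measure.volume_eq_prod, ← Measure.prod_restrict] at hu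
  have h : AEStronglyMeasurable (fun z : ℝ × Space d => G z.2 (u z.1 z.2))
      ((volume.restrict (timeInterval T)).prod (volume.restrict (unitCell d))) :=
    hG.comp_aestronglyMeasurable (continuous_snd.aestronglyMeasurable.prodMk hu)
  exact h.integral_prod_right'

lemma norm_modeCoeff_le {k : Fin d → ℤ} {c : Space d} {v : Space d → Space d} {M : ℝ}
    (hv : ∀ y, ‖v y‖ ≤ M) : ‖modeCoeff k c v‖ ≤ M * ‖c‖ := by
  have := norm_integral_le_of_norm_le_const (μ := volume.restrict (unitCell d))
    (f := fun y => char (-k) y * ((⟪v y, c⟫ : ℝ) : ℂ)) (C := M * ‖c‖) (ae_of_all _ fun y => by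
      rw [norm_mul, norm_char, one_mul, Complex.norm_real]
      exact (norm_inner_le_norm _ _).trans (by gcongr; exact hv y))
  simpa [modeCoeff] using this

lemma norm_modeFlux_le {k : Fin d → ℤ} {c : Space d} {v : Space d → Space d} {M : ℝ}
    (hM : 0 ≤ M) (hv : ∀ y, ‖v y‖ ≤ M) :
    ‖modeFlux k c v‖ ≤ 2 * Real.pi * (‖phaseL k‖ * M * (M * ‖c‖)) := by
  have hn : ‖(2 * Real.pi * Complex.I : ℂ)‖ = 2 * Real.pi := by
    simp [abs_of_pos Real.pi_pos]
  have := norm_integral_le_of_norm_le_const (μ := volume.restrict (unitCell d))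
    (f := fun y => -(2 * Real.pi * Complex.I) *
      (char (-k) y * ((phase k (v y) * ⟪v y, c⟫ : ℝ) : ℂ)))
    (C := 2 * Real.pi * (‖phaseL k‖ * M * (M * ‖c‖))) (ae_of_all _ fun y => by
      rw [norm_mul, norm_neg, hn, norm_mul, norm_char, one_mul, Complex.norm_real, norm_mul]
      have h1 : ‖phase k (v y)‖ ≤ ‖phaseL k‖ * M := by
        rw [← phaseL_apply]; exact (phaseL k).le_opNorm_of_le (hv y)
      have h2 : ‖(⟪v y, c⟫ : ℝ)‖ ≤ M * ‖c‖ :=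
        (norm_inner_le_norm _ _).trans (by gcongr; exact hv y)
      gcongr)
  simpa [modeFlux] using this

/-- The time derivative of the Fourier coefficient of `⟨u, c⟩`. -/
def modeRate (ν : ℝ) (k : Fin d → ℤ) (c : Space d) (v : Space d → Space d) : ℂ :=
  modeFlux k c v - ((ν * lam k : ℝ) : ℂ) * modeCoeff k c v

lemma norm_modeRate_le {ν : ℝ} {k : Fin d → ℤ} {c : Space d} {v : Space d → Space d} {M : ℝ}
    (hM : 0 ≤ M) (hv : ∀ y, ‖v y‖ ≤ M) : ‖modeRate ν k c v‖ ≤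
      2 * Real.pi * (‖phaseL k‖ * M * (M * ‖c‖)) + |ν * lam k| * (M * ‖c‖) := by
  refine (norm_sub_le _ _).trans (add_le_add (norm_modeFlux_le hM hv) ?_)
  rw [norm_mul, Complex.norm_real, Real.norm_eq_abs]
  gcongr
  exact norm_modeCoeff_le hv

lemma aestronglyMeasurable_modeCoeff {T : EReal} {u : ℝ → Space d → Space d}
    (hu : AEStronglyMeasurable (fun z : ℝ × Space d => u z.1 z.2)
      (volume.restrict (timeInterval T ×ˢ unitCell d))) (k : Fin d → ℤ) (c : Space d) :
    AEStronglyMeasurable (fun t => modeCoeff k c (u t)) (volume.restrict (timeInterval T)) :=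
  aestronglyMeasurable_cellIntegral hu
    (G := fun y w => char (-k) y * ((⟪w, c⟫ : ℝ) : ℂ)) (by fun_prop)

lemma aestronglyMeasurable_modeRate {T : EReal} {u : ℝ → Space d → Space d}
    (hu : AEStronglyMeasurable (fun z : ℝ × Space d => u z.1 z.2)
      (volume.restrict (timeInterval T ×ˢ unitCell d))) (ν : ℝ) (k : Fin d → ℤ) (c : Space d) :
    AEStronglyMeasurable (fun t => modeRate ν k c (u t)) (volume.restrict (timeInterval T)) :=
  (aestronglyMeasurable_cellIntegral hu
    (G := fun y w => -(2 * Real.pi * Complex.I) *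
      (char (-k) y * ((phase k w * ⟪w, c⟫ : ℝ) : ℂ))) (by fun_prop)).sub
    ((aestronglyMeasurable_modeCoeff hu k c).const_mul _)

/-- The weak formulation, tested with a Fourier mode. -/
lemma integral_mode_eq_zero {α : ℝ} {T : EReal} {ν U M : ℝ} {u₀ : Space d → Space d}
    {u : ℝ → Space d → Space d} (hα : 0 < α) (hM : 0 ≤ M)
    (hu : AEStronglyMeasurable (fun z : ℝ × Space d => u z.1 z.2)
      (volume.restrict (timeInterval T ×ˢ unitCell d)))
    (hw : IsWeakSolution ν T u₀ u) (hT : (timeInterval T).Nonempty)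
    (hg : ∀ᵐ t ∂volume.restrict (timeInterval T), GoodSlice α U M (u t))
    (k : Fin d → ℤ) {c : Space d} (hc : phase k c = 0) {η : ℝ → ℝ} (hη : ContDiff ℝ ∞ η)
    (hηc : HasCompactSupport η) (hηs : tsupport η ⊆ timeInterval T) :
    ∫ t in timeInterval T, (deriv η t • modeCoeff k c (u t) + η t • modeRate ν k c (u t)) = 0 := by
  -- The integrand of the weak formulation for the real wave of phase p; the phases 0 and π/2 give
  -- the real and imaginary parts of the claim.
  set r : ℝ → ℝ → ℝ := fun p t => ∫ y in unitCell d,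
    (deriv η t * (wave k p y * ⟪u t y, c⟫)
      + η t * (2 * Real.pi * wave k (p + Real.pi / 2) y * phase k (u t y) * ⟪u t y, c⟫)
      + ν * (-(lam k * η t * (wave k p y * ⟪u t y, c⟫)))) with hr
  -- The support of η lies in the open interval (0,T), so the initial datum does not enter.
  have h0 : η 0 = 0 := image_eq_zero_of_notMem_tsupport fun h => lt_irrefl _ (hηs h).1
  have hr0 : ∀ p, ∫ t in timeInterval T, r p t = 0 := fun p => by
    have h1 := hw.momentum _ (isTestField_wave k p hc hη hηc hηs hT)
    have h2 : ∀ t y, deriv (fun s => (η s * wave k p y) • c) t = (deriv η t * wave k p y) • c :=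
      fun t y => by
        have := ((((hη.differentiable (by simp)) t).hasDerivAt.mul_const (wave k p y)).smul_const c)
        exact this.deriv
    simp only [h2, fderiv_wave_smul, laplacian_wave_smul, h0, zero_mul, zero_smul, inner_zero_right,
      integral_zero, add_zero, inner_smul_right, neg_smul, inner_neg_right] at h1
    rw [← h1]
    refine integral_congr_ae (ae_of_all _ fun t => integral_congr_ae (ae_of_all _ fun y => ?_))
    simp only
    ring
  have hX : ∀ᵐ t ∂volume.restrict (timeInterval T),
      deriv η t • modeCoeff k c (u t) + η t • modeRate ν k c (u t)
        = (r 0 t : ℂ) + Complex.I * (r (0 + Real.pi / 2) t : ℂ) := by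
    filter_upwards [hg] with t ht
    have huc := ht.holder.continuous hα
    simp only [hr]
    rw [← integral_complex_ofReal, ← integral_complex_ofReal, ← integral_const_mul,
      ← integral_add (integrable_unitCell (by fun_prop)) (integrable_unitCell (by fun_prop)),
      modeRate, modeFlux, modeCoeff, Complex.real_smul, Complex.real_smul, mul_sub,
      ← integral_const_mul, ← integral_const_mul, ← integral_const_mul, ← integral_const_mul,
      ← integral_sub (integrable_unitCell (by fun_prop)) (integrable_unitCell (by fun_prop)),
      ← integral_add (integrable_unitCell (by fun_prop)) (integrable_unitCell (by fun_prop))]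
    refine integral_congr_ae (ae_of_all _ fun y => ?_)
    simp only [char_neg_eq_wave, wave_add_pi]
    push_cast
    linear_combination (-(η t : ℂ) * 2 * Real.pi * wave k (0 + Real.pi / 2) y *
      phase k (u t y) * (⟪u t y, c⟫ : ℝ)) * Complex.I_sq
  have hmul : ∀ {ζ : ℝ → ℝ} {f : ℝ → ℂ} {K : ℝ}, Continuous ζ → HasCompactSupport ζ →
      AEStronglyMeasurable f (volume.restrict (timeInterval T)) →
      (∀ᵐ t ∂volume.restrict (timeInterval T), ‖f t‖ ≤ K) →
      Integrable (fun t => ζ t • f t) (volume.restrict (timeInterval T)) := fun hζ hζc hf hK => by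
    simp only [Complex.real_smul]
    exact (hζ.integrable_of_hasCompactSupport hζc).integrableOn.ofReal.mul_bdd hf hK
  have hint : Integrable (fun t => deriv η t • modeCoeff k c (u t) + η t • modeRate ν k c (u t))
      (volume.restrict (timeInterval T)) :=
    (hmul (hη.continuous_deriv (by simp)) hηc.deriv (aestronglyMeasurable_modeCoeff hu k c)
      (hg.mono fun t ht => norm_modeCoeff_le ht.bound)).add
    (hmul hη.continuous hηc (aestronglyMeasurable_modeRate hu ν k c)
      (hg.mono fun t ht => norm_modeRate_le hM ht.bound))
  refine Complex.ext ?_ ?_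
  · have := Complex.reCLM.integral_comp_comm hint
    rw [Complex.reCLM_apply] at this
    rw [← this, Complex.zero_re, ← hr0 0]
    refine integral_congr_ae (hX.mono fun t ht => ?_)
    simp only [ht]
    simp
  · have := Complex.imCLM.integral_comp_comm hint
    rw [Complex.imCLM_apply] at this
    rw [← this, Complex.zero_im, ← hr0 (0 + Real.pi / 2)]
    refine integral_congr_ae (hX.mono fun t ht => ?_)
    simp only [ht]
    simp

end WeakFormulation

/-! ### The evolution of a single mode in the frame of the particle. -/

section ModeEvolution

open Filter Topology

variable {d : ℕ}

/-- The Leray projection of the `e`-th unit vector at frequency `k`. -/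
def lerayVec (e : Fin d) (k : Fin d → ℤ) : Space d := WithLp.toLp 2 (leray e k)

@[simp] lemma lerayVec_apply (e : Fin d) (k : Fin d → ℤ) (i : Fin d) :
    lerayVec e k i = leray e k i := rfl

lemma inner_lerayVec (e : Fin d) (k : Fin d → ℤ) (w : Space d) :
    ⟪w, lerayVec e k⟫ = w e - k e / (∑ l, (k l : ℝ) ^ 2) * phase k w := by
  simp only [PiLp.inner_apply, lerayVec_apply, leray, phase, RCLike.inner_apply, conj_trivial,
    sub_mul, Finset.sum_sub_distrib, Finset.mul_sum, ite_mul, one_mul, zero_mul,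
    Finset.sum_ite_eq', Finset.mem_univ, if_true]
  congr 1
  exact Finset.sum_congr rfl fun i _ => by ring

lemma phase_lerayVec (e : Fin d) (k : Fin d → ℤ) : phase k (lerayVec e k) = 0 := by
  simp only [phase, lerayVec_apply, leray, mul_sub, mul_ite, mul_one, mul_zero,
    Finset.sum_sub_distrib, Finset.sum_ite_eq', Finset.mem_univ, if_true]
  by_cases hk : k = 0
  · simp [hk]
  · have h : ∑ l, (k l : ℝ) ^ 2 ≠ 0 := by linarith [one_le_sum_sq hk]
    rw [show ∑ i, (k i : ℝ) * (k e * k i / ∑ l, (k l : ℝ) ^ 2)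
      = k e * (∑ i, (k i : ℝ) ^ 2) / ∑ l, (k l : ℝ) ^ 2 by
        rw [Finset.mul_sum, Finset.sum_div]; exact Finset.sum_congr rfl fun i _ => by ring]
    field_simp
    ring

/-- The projected unit vector differs from the unit vector by a multiple of k, and the k-component
of a divergence free field vanishes at frequency k. -/
lemma modeCoeff_lerayVec {v : Space d → Space d} (hc : Continuous v) (hd : WeaklyDivFree v)
    (e : Fin d) (k : Fin d → ℤ) :
    modeCoeff k (lerayVec e k) v = fc (fun y => (v y e : ℂ)) k := by
  have h := integral_char_mul_phase_eq_zero hc hd k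
  rw [modeCoeff, fc, ← sub_zero (∫ y in unitCell d, char (-k) y * (v y e : ℂ)),
    ← mul_zero (((k e / (∑ l, (k l : ℝ) ^ 2) : ℝ)) : ℂ), ← h, ← integral_const_mul,
    ← integral_sub (integrable_unitCell (by fun_prop)) (integrable_unitCell (by fun_prop))]
  refine integral_congr_ae (ae_of_all _ fun y => ?_)
  simp only [inner_lerayVec]
  push_cast
  ring

/-- The cancellation behind the theorem: moving with velocity v(x) adds the transport term 2πi
k·v(x), and this completes the flux of v ⊗ v to the flux of (v - v(x)) ⊗ (v - v(x)). Of the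
remaining terms, one vanishes by incompressibility and the other because k·v(x) times the mean of
the character is 0 for every k. -/
lemma char_mul_modeFlux_add {v : Space d → Space d} (hc : Continuous v) (hd : WeaklyDivFree v)
    (e : Fin d) (k : Fin d → ℤ) (x : Space d) :
    char k x * (modeFlux k (lerayVec e k) v
      + 2 * Real.pi * Complex.I * phase k (v x) * modeCoeff k (lerayVec e k) v)
      = fluxMode e v x k := by
  have h := integral_char_mul_phase_eq_zero hc hd k
  have h1 : ((phase k (v x) : ℝ) : ℂ) * ∫ y in unitCell d, char (-k) y = 0 := by
    by_cases hk : k = 0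
    · simp [hk, phase]
    · have := fc_one (d := d) k
      simp only [fc, mul_one, hk, if_false] at this
      rw [this, mul_zero]
  have h2 : ∑ i, ∑ j, ((leray e k i * k j : ℝ) : ℂ) * (char k x * fc (quadInc v x i j) k)
      = char k x * ∫ y in unitCell d, char (-k) y *
        ((⟪v y - v x, lerayVec e k⟫ * phase k (v y - v x) : ℝ) : ℂ) := by
    have h3 : ∀ y, char (-k) y * ((⟪v y - v x, lerayVec e k⟫ * phase k (v y - v x) : ℝ) : ℂ)
        = ∑ i, ∑ j, ((leray e k i * k j : ℝ) : ℂ) * (char (-k) y * quadInc v x i j y) := fun y => by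
      simp only [PiLp.inner_apply, phase, Finset.sum_mul_sum, quadInc, RCLike.inner_apply,
        conj_trivial]
      push_cast
      rw [Finset.mul_sum]
      refine Finset.sum_congr rfl fun i _ => ?_
      rw [Finset.mul_sum]
      refine Finset.sum_congr rfl fun j _ => ?_
      simp only [lerayVec_apply, PiLp.sub_apply]
      push_cast
      ring
    simp only [h3]
    have hq : ∀ i j, Continuous (quadInc v x i j) := fun i j => by unfold quadInc; fun_prop
    have hI : ∀ i j, Integrable (fun y => ((leray e k i * k j : ℝ) : ℂ) *
        (char (-k) y * quadInc v x i j y)) (volume.restrict (unitCell d)) := fun i j =>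
      integrable_unitCell (((continuous_char _).mul (hq i j)).const_mul _)
    rw [integral_finsetSum _ fun i _ => integrable_finsetSum _ fun j _ => hI i j, Finset.mul_sum]
    refine Finset.sum_congr rfl fun i _ => ?_
    rw [integral_finsetSum _ fun j _ => hI i j, Finset.mul_sum]
    refine Finset.sum_congr rfl fun j _ => ?_
    rw [integral_const_mul, fc]
    ring
  have h4 : ∫ y in unitCell d, char (-k) y *
        ((⟪v y - v x, lerayVec e k⟫ * phase k (v y - v x) : ℝ) : ℂ)
      = (∫ y in unitCell d, char (-k) y * ((phase k (v y) * ⟪v y, lerayVec e k⟫ : ℝ) : ℂ))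
        - phase k (v x) * modeCoeff k (lerayVec e k) v
        - (⟪v x, lerayVec e k⟫ : ℝ) * (∫ y in unitCell d, char (-k) y * (phase k (v y) : ℂ))
        + (⟪v x, lerayVec e k⟫ : ℝ) * (phase k (v x) * ∫ y in unitCell d, char (-k) y) := by
    rw [modeCoeff, ← integral_const_mul, ← integral_const_mul, ← integral_const_mul,
      ← integral_const_mul,
      ← integral_sub (integrable_unitCell (by fun_prop)) (integrable_unitCell (by fun_prop)),
      ← integral_sub (integrable_unitCell (by fun_prop)) (integrable_unitCell (by fun_prop)),
      ← integral_add (integrable_unitCell (by fun_prop)) (integrable_unitCell (by fun_prop))]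
    refine integral_congr_ae (ae_of_all _ fun y => ?_)
    have h5 : phase k (v y - v x) = phase k (v y) - phase k (v x) := by
      simp only [← phaseL_apply, map_sub]
    simp only [h5, inner_sub_left]
    push_cast
    ring
  rw [fluxMode, h2, h4, h, h1, modeFlux, integral_const_mul]
  ring

/-- The evolution of a Fourier mode of the velocity seen along a trajectory. -/
lemma exists_mode_primitive {α : ℝ} {T : EReal} {ν U M : ℝ} {u₀ : Space d → Space d}
    {u : ℝ → Space d → Space d} {x : ℝ → Space d} (hα : 0 < α) (hM : 0 ≤ M)
    (hu : AEStronglyMeasurable (fun z : ℝ × Space d => u z.1 z.2)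
      (volume.restrict (timeInterval T ×ˢ unitCell d)))
    (hw : IsWeakSolution ν T u₀ u) (hx : IsTrajectory T u x) (hT : (timeInterval T).Nonempty)
    (hg : ∀ᵐ t ∂volume.restrict (timeInterval T), GoodSlice α U M (u t))
    (e : Fin d) (k : Fin d → ℤ) :
    ∃ Q : ℝ → ℂ, (∀ᵐ t ∂volume.restrict (timeInterval T),
        fourierMode e (u t) (x t) k = Q t) ∧
      ∀ t₁ ∈ timeInterval T, ∀ t₂ ∈ timeInterval T, t₁ ≤ t₂ →
        IntervalIntegrable (fun r => (Real.exp (lam k * ν * r) : ℂ) *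
          fluxMode e (u r) (x r) k) volume t₁ t₂ ∧
        (Real.exp (lam k * ν * t₂) : ℂ) * Q t₂ - (Real.exp (lam k * ν * t₁) : ℂ) * Q t₁
          = ∫ r in t₁..t₂, (Real.exp (lam k * ν * r) : ℂ) * fluxMode e (u r) (x r) k := by
  set c := lerayVec e k
  obtain ⟨f, hf, hfp⟩ := exists_isPrimitiveOn_of_weak (isOpen_timeInterval T)
    (ordConnected_timeInterval T) hT (A := Real.toNNReal (M * ‖c‖))
    (K := Real.toNNReal
      (2 * Real.pi * (‖phaseL k‖ * M * (M * ‖c‖)) + |ν * lam k| * (M * ‖c‖)))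
    (aestronglyMeasurable_modeCoeff hu k c) (aestronglyMeasurable_modeRate hu ν k c)
    (hg.mono fun t ht => (norm_modeCoeff_le ht.bound).trans (Real.le_coe_toNNReal _))
    (hg.mono fun t ht => (norm_modeRate_le hM ht.bound).trans (Real.le_coe_toNNReal _))
    fun η h1 h2 h3 => integral_mode_eq_zero hα hM hu hw hT hg k (phase_lerayVec e k) h1 h2 h3
  refine ⟨fun t => char k (x t) * f t, ?_, fun t₁ h₁ t₂ h₂ h12 => ?_⟩
  · filter_upwards [hf, hg] with t h1 h2
    rw [fourierMode, ← h1, modeCoeff_lerayVec (h2.holder.continuous hα) h2.divFree]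
  · have hsub : Icc t₁ t₂ ⊆ timeInterval T := (ordConnected_timeInterval T).out h₁ h₂
    have hxp : IsPrimitiveOn x (fun r => u r (x r)) t₁ t₂ (Real.toNNReal M) := by
      refine ⟨h12, (hx t₁ h₁ t₂ h₂).1, ?_, fun r hr s hs => ?_⟩
      · filter_upwards [(ae_restrict_iff' (isOpen_timeInterval T).measurableSet).mp hg] with r h1 h2
        exact ((h1 (hsub h2)).bound _).trans (Real.le_coe_toNNReal _)
      · rw [(hx s (hsub hs) r (hsub hr)).2]; abel
    obtain ⟨K, htp⟩ := isPrimitiveOn_of_hasDerivAt h12 (f := fun r : ℝ => r) (f' := fun _ => 1)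
      (fun r => hasDerivAt_id r) continuous_const
    -- Mode, position and time are three Lipschitz primitives, and Φ multiplies the mode by the
    -- character at the position and by the integrating factor e^{λνt}.
    have hΦ : ContDiff ℝ 1 (fun p : ℂ × Space d × ℝ => p.1 *
        Complex.exp (2 * Real.pi * Complex.I * phaseL k p.2.1 + (lam k * ν * p.2.2 : ℝ))) :=
      contDiff_fst.mul ((contDiff_const.mul (Complex.ofRealCLM.contDiff.comp
        ((phaseL k).contDiff.comp (contDiff_fst.comp contDiff_snd)))).add
        (Complex.ofRealCLM.contDiff.comp
          (contDiff_const.mul (contDiff_snd.comp contDiff_snd)))).cexp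
    have hD : ∀ p q : ℂ × Space d × ℝ, fderiv ℝ (fun p : ℂ × Space d × ℝ => p.1 *
        Complex.exp (2 * Real.pi * Complex.I * phaseL k p.2.1 + (lam k * ν * p.2.2 : ℝ))) p q
        = Complex.exp (2 * Real.pi * Complex.I * phaseL k p.2.1 + (lam k * ν * p.2.2 : ℝ)) *
          (q.1 + p.1 * (2 * Real.pi * Complex.I * phaseL k q.2.1 + (lam k * ν * q.2.2 : ℝ))) := fun p q => by
      have h1 : HasFDerivAt (fun p : ℂ × Space d × ℝ => p.2.1)
          ((ContinuousLinearMap.fst ℝ (Space d) ℝ).comp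
            (ContinuousLinearMap.snd ℝ ℂ (Space d × ℝ))) p := hasFDerivAt_fst.comp p hasFDerivAt_snd
      have h2 : HasFDerivAt (fun p : ℂ × Space d × ℝ => p.2.2)
          ((ContinuousLinearMap.snd ℝ (Space d) ℝ).comp
            (ContinuousLinearMap.snd ℝ ℂ (Space d × ℝ))) p := hasFDerivAt_snd.comp p hasFDerivAt_snd
      have h3 := (Complex.ofRealCLM.hasFDerivAt.comp p
        ((phaseL k).hasFDerivAt.comp p h1)).const_mul (2 * Real.pi * Complex.I)
      have h4 := Complex.ofRealCLM.hasFDerivAt.comp p (h2.const_mul (lam k * ν))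
      have h5 := (hasFDerivAt_fst (𝕜 := ℝ) (p := p)).mul (h3.add h4).cexp
      refine (congrArg (fun L => L q) h5.fderiv).trans ?_
      simp
      ring
    have hE : ∀ r, Complex.exp (2 * Real.pi * Complex.I * phaseL k (x r) + (lam k * ν * r : ℝ))
        = (Real.exp (lam k * ν * r) : ℂ) * char k (x r) := fun r => by
      rw [Complex.exp_add, char, phaseL_apply, mul_comm, Complex.ofReal_exp]
    have hcomp := ((hfp t₁ h₁ t₂ h₂ h12).prodMk (hxp.prodMk htp)).comp hΦ
    simp only [hD, hE] at hcomp
    -- The integrating factor cancels the viscous term of `modeRate`, and the derivative of the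
    -- character is the transport term of `char_mul_modeFlux_add`.
    have hae : ∀ᵐ r, r ∈ uIoc t₁ t₂ → (Real.exp (lam k * ν * r) : ℂ) * char k (x r) *
        (modeRate ν k c (u r) + f r * (2 * Real.pi * Complex.I * phaseL k (u r (x r))
          + (lam k * ν * 1 : ℝ)))
        = (Real.exp (lam k * ν * r) : ℂ) * fluxMode e (u r) (x r) k := by
      filter_upwards [(ae_restrict_iff' (isOpen_timeInterval T).measurableSet).mp hg,
        (ae_restrict_iff' (isOpen_timeInterval T).measurableSet).mp hf] with r h1 h2 h3
      rw [uIoc_of_le h12] at h3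
      have hr := hsub (Ioc_subset_Icc_self h3)
      rw [← char_mul_modeFlux_add ((h1 hr).holder.continuous hα) (h1 hr).divFree, ← h2 hr,
        modeRate, phaseL_apply]
      push_cast
      ring
    refine ⟨hcomp.1.congr_ae ((ae_restrict_iff' measurableSet_uIoc).mpr hae), ?_⟩
    rw [← intervalIntegral.integral_congr_ae hae, ← hcomp.2]
    ring

end ModeEvolution

/-! ### Duhamel's formula along a trajectory. -/

section Duhamel

open Filter Topology

variable {d : ℕ}

/-- An integral is bounded by the increment of a primitive of a bound of the integrand. -/
lemma norm_integral_le_sub_of_hasDerivAt {E : Type*} [NormedAddCommGroup E] [NormedSpace ℝ E]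
    {f : ℝ → E} {G G' : ℝ → ℝ} {a b : ℝ} (hab : a ≤ b)
    (hG : ∀ r ∈ Icc a b, HasDerivAt G (G' r) r) (hG' : ∀ r ∈ Icc a b, 0 ≤ G' r)
    (hf : ∀ᵐ r, r ∈ Ioc a b → ‖f r‖ ≤ G' r) : ‖∫ r in a..b, f r‖ ≤ G b - G a := by
  have hGc : ContinuousOn G (Icc a b) := fun r hr => (hG r hr).continuousAt.continuousWithinAt
  by_cases hi : IntervalIntegrable f volume a b
  · refine (intervalIntegral.norm_integral_le_integral_norm hab).trans ?_
    -- The bound on f holds only almost everywhere, but the comparison theorem needs it pointwise; φ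
    -- alters ‖f‖ on a null set.
    set φ : ℝ → ℝ := fun r => if ‖f r‖ ≤ G' r then ‖f r‖ else 0 with hφ
    have hae : ∀ᵐ r, r ∈ uIoc a b → ‖f r‖ = φ r := by
      filter_upwards [hf] with r hr h
      rw [uIoc_of_le hab] at h
      rw [hφ]; simp only [hr h, if_true]
    rw [intervalIntegral.integral_congr_ae hae]
    refine intervalIntegral.integral_le_sub_of_hasDeriv_right_of_le hab hGc
      (fun r hr => (hG r (Ioo_subset_Icc_self hr)).hasDerivWithinAt) ?_ fun r hr => ?_
    · exact (intervalIntegrable_iff_integrableOn_Icc_of_le hab).mp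
        (hi.norm.congr_ae ((ae_restrict_iff' measurableSet_uIoc).mpr hae))
    · simp only [hφ]
      split_ifs with h
      · exact h
      · exact hG' r (Ioo_subset_Icc_self hr)
  -- The integral of a non-integrable f is 0 by convention, and G increases.
  · rw [intervalIntegral.integral_undef hi, norm_zero, sub_nonneg]
    refine monotoneOn_of_deriv_nonneg (convex_Icc a b) hGc (fun r hr => ?_) (fun r hr => ?_)
      (left_mem_Icc.mpr hab) (right_mem_Icc.mpr hab) hab
    · exact (hG r (interior_subset hr)).differentiableAt.differentiableWithinAt
    · rw [(hG r (interior_subset hr)).deriv]; exact hG' r (interior_subset hr)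

/-- A bound uniform in time and of polynomial growth in k, needed to exchange the sum over modes
with the time integral. -/
lemma norm_fluxMode_le {v : Space d → Space d} {M : ℝ} (hv : ∀ y, ‖v y‖ ≤ M) (e : Fin d)
    (x : Space d) (k : Fin d → ℤ) :
    ‖fluxMode e v x k‖ ≤ 2 * Real.pi * (d * (d * (2 * (2 * M) ^ 2))) * (lam k + 1) := by
  have hn : ‖(2 * Real.pi * Complex.I : ℂ)‖ = 2 * Real.pi := by
    simp [abs_of_pos Real.pi_pos]
  have hq : ∀ i j, ‖fc (quadInc v x i j) k‖ ≤ (2 * M) ^ 2 := fun i j =>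
    norm_fc_le (fun y => (norm_quadInc_le v x y i j).trans (by
      gcongr
      exact (norm_sub_le _ _).trans (by linarith [hv x, hv y]))) k
  rw [fluxMode, norm_mul, norm_neg, hn, mul_assoc (2 * Real.pi)]
  gcongr
  calc _ ≤ ∑ i : Fin d, ∑ j : Fin d, 2 * (lam k + 1) * (2 * M) ^ 2 := by
        refine norm_sum_le_of_le _ fun i _ => norm_sum_le_of_le _ fun j _ => ?_
        rw [norm_mul, Complex.norm_real, norm_mul (char k x), norm_char, one_mul]
        exact mul_le_mul (abs_leray_mul_le e k i j) (hq i j) (norm_nonneg _)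
          (by linarith [lam_nonneg k])
    _ = _ := by simp; ring

/-- The Fourier side of a solution along a trajectory: on a set `S` of full measure in the time
interval `J`, the slices of `u` are regular and their modes evolve by the Duhamel formula. -/
structure ModeFlow (α U M ν : ℝ) (J S : Set ℝ) (u : ℝ → Space d → Space d)
    (x : ℝ → Space d) : Prop where
  subset : S ⊆ J
  ordConnected : J.OrdConnected
  ae_mem : ∀ᵐ t, t ∈ J → t ∈ S
  slice : ∀ t ∈ S, GoodSlice α U M (u t)
  evolution : ∀ t₁ ∈ S, ∀ t₂ ∈ S, t₁ ≤ t₂ → ∀ (e : Fin d) (k : Fin d → ℤ),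
    IntervalIntegrable (fun r => (Real.exp (lam k * ν * r) : ℂ) *
      fluxMode e (u r) (x r) k) volume t₁ t₂ ∧
    (Real.exp (lam k * ν * t₂) : ℂ) * fourierMode e (u t₂) (x t₂) k
      - (Real.exp (lam k * ν * t₁) : ℂ) * fourierMode e (u t₁) (x t₁) k
      = ∫ r in t₁..t₂, (Real.exp (lam k * ν * r) : ℂ) * fluxMode e (u r) (x r) k

/-- There are countably many pairs of a component and a frequency, so the exceptional null sets
combine into one. -/
lemma exists_modeFlow {α : ℝ} {T : EReal} {ν U M : ℝ} {u₀ : Space d → Space d}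
    {u : ℝ → Space d → Space d} {x : ℝ → Space d} (hα : 0 < α) (hM : 0 ≤ M)
    (hu : AEStronglyMeasurable (fun z : ℝ × Space d => u z.1 z.2)
      (volume.restrict (timeInterval T ×ˢ unitCell d)))
    (hw : IsWeakSolution ν T u₀ u) (hx : IsTrajectory T u x) (hT : (timeInterval T).Nonempty)
    (hg : ∀ᵐ t ∂volume.restrict (timeInterval T), GoodSlice α U M (u t)) :
    ∃ S, ModeFlow α U M ν (timeInterval T) S u x := by
  choose Q hQ hQi using exists_mode_primitive hα hM hu hw hx hT hg
  have hall : ∀ᵐ t ∂volume.restrict (timeInterval T),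
      GoodSlice α U M (u t) ∧ ∀ e k, fourierMode e (u t) (x t) k = Q e k t :=
    hg.and (ae_all_iff.mpr fun e => ae_all_iff.mpr fun k => hQ e k)
  refine ⟨{t | t ∈ timeInterval T ∧ GoodSlice α U M (u t) ∧
    ∀ e k, fourierMode e (u t) (x t) k = Q e k t}, fun t ht => ht.1, ordConnected_timeInterval T,
    ?_, fun t ht => ht.2.1, fun t₁ h₁ t₂ h₂ h12 e k => ?_⟩
  · filter_upwards [(ae_restrict_iff' (isOpen_timeInterval T).measurableSet).mp hall] with t h1 h2
    exact ⟨h2, h1 h2⟩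
  · rw [h₁.2.2, h₂.2.2]
    exact hQi e k t₁ h₁.1 t₂ h₂.1 h12

lemma ModeFlow.ae_Ioc {α U M ν : ℝ} {J S : Set ℝ} {u : ℝ → Space d → Space d}
    {x : ℝ → Space d} (h : ModeFlow α U M ν J S u x) {t₁ t₂ : ℝ} (h₁ : t₁ ∈ S) (h₂ : t₂ ∈ S) :
    ∀ᵐ r, r ∈ Ioc t₁ t₂ → r ∈ S := by
  filter_upwards [h.ae_mem] with r hr hI
  exact hr (h.ordConnected.out (h.subset h₁) (h.subset h₂) (Ioc_subset_Icc_self hI))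

/-- Duhamel's formula for Fourier multipliers of the velocity along a trajectory. -/
lemma ModeFlow.heatSum_sub {α U M ν : ℝ} {J S : Set ℝ} {u : ℝ → Space d → Space d}
    {x : ℝ → Space d} (h : ModeFlow α U M ν J S u x) (hν : 0 ≤ ν) {t₁ t₂ : ℝ} (h₁ : t₁ ∈ S)
    (h₂ : t₂ ∈ S) (h12 : t₁ ≤ t₂) (e : Fin d) {m : (Fin d → ℤ) → ℂ} {s : ℝ} (hs : 0 < s)
    (hm : HeatSummable fun k => m k * (lam k + 1))
    (hm₁ : HeatSummable fun k => m k * fourierMode e (u t₁) (x t₁) k)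
    (hm₂ : HeatSummable fun k => m k * fourierMode e (u t₂) (x t₂) k) :
    heatSum (fun k => m k * fourierMode e (u t₂) (x t₂) k) s
      - heatSum (fun k => m k * fourierMode e (u t₁) (x t₁) k) (s + ν * (t₂ - t₁))
      = ∫ r in t₁..t₂, heatSum (fun k => m k * fluxMode e (u r) (x r) k) (s + ν * (t₂ - r)) := by
  set F : (Fin d → ℤ) → ℝ → ℂ := fun k r =>
    (Real.exp (-(lam k * (s + ν * (t₂ - r)))) : ℂ) * (m k * fluxMode e (u r) (x r) k)
  have hF : ∀ k r, F k r = ((Real.exp (-(lam k * (s + ν * t₂))) : ℂ) * m k) *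
      ((Real.exp (lam k * ν * r) : ℂ) * fluxMode e (u r) (x r) k) := fun k r => by
    have : Real.exp (-(lam k * (s + ν * (t₂ - r))))
        = Real.exp (-(lam k * (s + ν * t₂))) * Real.exp (lam k * ν * r) := by
      rw [← Real.exp_add]; congr 1; ring
    simp only [F, this]
    push_cast
    ring
  have hi : ∀ k, Integrable (F k) (volume.restrict (Ioc t₁ t₂)) := fun k => by
    have := ((h.evolution t₁ h₁ t₂ h₂ h12 e k).1.const_mul
      ((Real.exp (-(lam k * (s + ν * t₂))) : ℂ) * m k)).congr_ae
      (ae_of_all _ fun r => (hF k r).symm)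
    exact (intervalIntegrable_iff_integrableOn_Ioc_of_le h12).mp this
  set D := 2 * Real.pi * (d * (d * (2 * (2 * M) ^ 2)))
  have hb : ∀ k, ∀ᵐ r ∂volume.restrict (Ioc t₁ t₂),
      ‖F k r‖ ≤ D * (‖m k * (lam k + 1)‖ * Real.exp (-(lam k * s))) := fun k => by
    rw [ae_restrict_iff' measurableSet_Ioc]
    filter_upwards [h.ae_Ioc h₁ h₂] with r hr hI
    have hl : ‖(lam k + 1 : ℂ)‖ = lam k + 1 := by
      rw [← Complex.ofReal_one, ← Complex.ofReal_add, Complex.norm_real,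
        Real.norm_of_nonneg (by linarith [lam_nonneg k])]
    simp only [F, norm_mul, hl, Complex.norm_real, Real.norm_of_nonneg (Real.exp_pos _).le]
    calc _ ≤ Real.exp (-(lam k * s)) * (‖m k‖ * (D * (lam k + 1))) := by
          gcongr
          · exact lam_nonneg k
          · nlinarith [mul_nonneg hν (sub_nonneg.mpr hI.2)]
          · exact norm_fluxMode_le (h.slice r (hr hI)).bound e (x r) k
      _ = _ := by ring
  -- Since s > 0, the weight e^{-λs} dominates all terms uniformly in r.
  have hsum : Summable fun k => ∫ r in Ioc t₁ t₂, ‖F k r‖ := by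
    refine Summable.of_nonneg_of_le (fun k => integral_nonneg fun r => norm_nonneg _)
      (fun k => ?_) (((hm s hs).mul_left D).mul_right (t₂ - t₁))
    have := integral_mono_ae (hi k).norm (integrable_const _) (hb k)
    simpa [h12, mul_comm] using this
  have hkey := hasSum_integral_of_summable_integral_norm hi hsum
  rw [intervalIntegral.integral_of_le h12]
  refine HasSum.unique ?_ hkey
  have hs2 : 0 < s + ν * (t₂ - t₁) := by
    linarith [mul_nonneg hν (sub_nonneg.mpr h12)]
  convert! (hm₂.summable hs).hasSum.sub (hm₁.summable hs2).hasSum using 1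
  ext k
  have h3 := (h.evolution t₁ h₁ t₂ h₂ h12 e k).2
  rw [intervalIntegral.integral_of_le h12] at h3
  simp only [hF, integral_const_mul, ← h3]
  have h4 : Real.exp (-(lam k * s))
      = Real.exp (-(lam k * (s + ν * t₂))) * Real.exp (lam k * ν * t₂) := by
    rw [← Real.exp_add]; congr 1; ring
  have h5 : Real.exp (-(lam k * (s + ν * (t₂ - t₁))))
      = Real.exp (-(lam k * (s + ν * t₂))) * Real.exp (lam k * ν * t₁) := by
    rw [← Real.exp_add]; congr 1; ring
  rw [h4, h5]
  push_cast
  ring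

end Duhamel

/-! ### Increments of the velocity along a trajectory, at small and at large time scales. -/

section VelocityIncrements

open Filter Topology

variable {d : ℕ}

/-- The bounds for the heat sums of the modes of a Hölder field. -/
structure StaticBounds (d : ℕ) (α : ℝ) (β b : ℝ → ℝ) (C : ℝ) : Prop where
  const_nonneg : 0 ≤ C
  lamMul_flux : ∀ {U : ℝ} {v : Space d → Space d}, 0 ≤ U → HolderField α U v →
    ∀ (e : Fin d) (x : Space d) (s : ℝ), 0 < s →
      ‖heatSum (lamMul (fluxMode e v x)) s‖ ≤ C * U ^ 2 * b s
  flux : ∀ {U : ℝ} {v : Space d → Space d}, 0 ≤ U → HolderField α U v →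
    ∀ (e : Fin d) (x : Space d) (s : ℝ), 0 < s → ‖heatSum (fluxMode e v x) s‖ ≤ C * U ^ 2 * β s
  mode_sub : ∀ {U : ℝ} {v : Space d → Space d}, 0 ≤ U → HolderField α U v →
    ∀ (e : Fin d) (x : Space d) (s : ℝ), 0 < s →
      ‖heatSum (fourierMode e v x) s - (v x e : ℂ)‖ ≤ C * U * s ^ (α / 2)
  lamMul_mode : ∀ {U : ℝ} {v : Space d → Space d}, 0 ≤ U → HolderField α U v →
    ∀ (e : Fin d) (x : Space d) (s : ℝ), 0 < s →
      ‖heatSum (lamMul (fourierMode e v x)) s‖ ≤ C * U * s ^ (α / 2 - 1)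

lemma Profile.pos {α : ℝ} {β b B B' : ℝ → ℝ} {κ : ℝ} (hP : Profile α β b B B' κ) {s : ℝ}
    (hs : 0 < s) : 0 < b s := by
  have h := hP.min_le s hs
  have h2 : 0 < min (s ^ (α - 3 / 2)) (s ^ (-(3 / 2 : ℝ))) := lt_min (by positivity) (by positivity)
  exact pos_of_mul_pos_right (h2.trans_le h) hP.const_nonneg

lemma Profile.antitoneOn {α : ℝ} {β b B B' : ℝ → ℝ} {κ : ℝ} (hP : Profile α β b B B' κ) :
    AntitoneOn β (Ioi 0) := by
  refine antitoneOn_of_deriv_nonpos (convex_Ioi 0)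
    (fun s hs => (hP.hasDerivAt s hs).continuousAt.continuousWithinAt) ?_ ?_ <;>
    rw [interior_Ioi] <;> intro s hs
  · exact (hP.hasDerivAt s hs).differentiableAt.differentiableWithinAt
  · rw [(hP.hasDerivAt s hs).deriv]; linarith [hP.pos hs]

lemma exists_staticBounds (d : ℕ) {α : ℝ} (hα : 0 < α) (hα1 : α ≤ 1 / 2) {β b B B' : ℝ → ℝ}
    {κ : ℝ} (hP : Profile α β b B B' κ) : ∃ C, StaticBounds d α β b C := by
  obtain ⟨C₁, hC₁, h₁⟩ := exists_fluxMode_lamMul_bound d hα hα1 hP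
  obtain ⟨C₂, hC₂, h₂⟩ := exists_fourierMode_bound d hα (by linarith)
  refine ⟨C₁ + C₂, by positivity, fun hU hv e x s hs => ?_, fun hU hv e x s hs => ?_,
    fun hU hv e x s hs => ?_, fun hU hv e x s hs => ?_⟩
  · refine (h₁ _ _ hU hv e x s hs).trans ?_
    have := hP.pos hs
    gcongr; linarith
  · refine (fluxMode_bound hα hP hC₁ hv (h₁ _ _ hU hv e x) hs).trans ?_
    have := hP.nonneg s hs
    gcongr; linarith
  · refine (h₂ _ _ hU hv e x s hs).1.trans ?_
    gcongr; linarith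
  · refine (h₂ _ _ hU hv e x s hs).2.trans ?_
    gcongr; linarith

variable {α U M ν C κ : ℝ} {J S : Set ℝ} {u : ℝ → Space d → Space d}
    {x : ℝ → Space d} {β b B B' : ℝ → ℝ}

lemma heatSummable_lam_add_one : HeatSummable fun k : Fin d → ℤ => ((lam k : ℂ) + 1) := by
  have := (heatSummable_of_bounded (d := d) (a := fun _ => 1) 1 (by simp)).lamMul.add
    (heatSummable_of_bounded (a := fun _ => 1) 1 (by simp))
  simpa [lamMul] using this

lemma ModeFlow.heatSum_mode_sub (h : ModeFlow α U M ν J S u x) (hα : 0 < α) (hν : 0 ≤ ν)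
    {t₁ t₂ : ℝ} (h₁ : t₁ ∈ S) (h₂ : t₂ ∈ S) (h12 : t₁ ≤ t₂) (e : Fin d) {s : ℝ} (hs : 0 < s) :
    heatSum (fourierMode e (u t₂) (x t₂)) s
      - heatSum (fourierMode e (u t₁) (x t₁)) (s + ν * (t₂ - t₁))
      = ∫ r in t₁..t₂, heatSum (fluxMode e (u r) (x r)) (s + ν * (t₂ - r)) := by
  have hq : ∀ t ∈ S, HeatSummable (fourierMode e (u t) (x t)) := fun t ht =>
    heatSummable_fourierMode ((h.slice t ht).holder.continuous hα) (h.slice t ht).holder.periodic _ _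
  have := h.heatSum_sub hν h₁ h₂ h12 e (m := fun _ => 1) hs
    (by simpa using heatSummable_lam_add_one) (by simpa using hq t₁ h₁) (by simpa using hq t₂ h₂)
  simpa using this

lemma ModeFlow.heatSum_lamMul_sub (h : ModeFlow α U M ν J S u x) (hα : 0 < α) (hν : 0 ≤ ν)
    {t₁ t₂ : ℝ} (h₁ : t₁ ∈ S) (h₂ : t₂ ∈ S) (h12 : t₁ ≤ t₂) (e : Fin d) {s : ℝ} (hs : 0 < s) :
    heatSum (lamMul (fourierMode e (u t₂) (x t₂))) s
      - heatSum (lamMul (fourierMode e (u t₁) (x t₁))) (s + ν * (t₂ - t₁))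
      = ∫ r in t₁..t₂, heatSum (lamMul (fluxMode e (u r) (x r))) (s + ν * (t₂ - r)) := by
  have hq : ∀ t ∈ S, HeatSummable (lamMul (fourierMode e (u t) (x t))) := fun t ht =>
    (heatSummable_fourierMode ((h.slice t ht).holder.continuous hα)
      (h.slice t ht).holder.periodic _ _).lamMul
  exact h.heatSum_sub hν h₁ h₂ h12 e (m := fun k => (lam k : ℂ)) hs
    heatSummable_lam_add_one.lamMul (hq t₁ h₁) (hq t₂ h₂)

/-- The flux at time r is regularised at s + ν(t₂ - r), so its bound integrates to an increment of
B; the change of variables gives 1/ν. -/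
lemma norm_heatSum_mode_sub_le (h : ModeFlow α U M ν J S u x) (hP : Profile α β b B B' κ)
    (hb : StaticBounds d α β b C) (hα : 0 < α) (hν : 0 < ν) (hU : 0 ≤ U)
    {t₁ t₂ : ℝ} (h₁ : t₁ ∈ S) (h₂ : t₂ ∈ S) (h12 : t₁ ≤ t₂) (e : Fin d) {s : ℝ} (hs : 0 < s) :
    ‖heatSum (fourierMode e (u t₂) (x t₂)) s
      - heatSum (fourierMode e (u t₁) (x t₁)) (s + ν * (t₂ - t₁))‖
      ≤ C * U ^ 2 / ν * B (s + ν * (t₂ - t₁)) := by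
  rw [h.heatSum_mode_sub hα hν.le h₁ h₂ h12 e hs]
  have hC := hb.const_nonneg
  have hpos : ∀ r ∈ Icc t₁ t₂, 0 < s + ν * (t₂ - r) := fun r hr => by
    have := mul_nonneg hν.le (sub_nonneg.mpr hr.2); linarith
  refine (norm_integral_le_sub_of_hasDerivAt h12
    (G := fun r => -(C * U ^ 2 / ν * B (s + ν * (t₂ - r))))
    (G' := fun r => C * U ^ 2 * B' (s + ν * (t₂ - r))) (fun r hr => ?_) (fun r hr => ?_) ?_).trans ?_
  · have h1 : HasDerivAt (fun r => s + ν * (t₂ - r)) (-ν) r := by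
      simpa using (((hasDerivAt_id r).const_sub t₂).const_mul ν).const_add s
    have h2 := (((hP.hasDerivAt_prim _ (hpos r hr)).comp r h1).const_mul (C * U ^ 2 / ν)).fun_neg
    convert! h2 using 1
    field_simp
  · have := (hP.nonneg _ (hpos r hr)).trans (hP.le_prim _ (hpos r hr))
    positivity
  · filter_upwards [h.ae_Ioc h₁ h₂] with r hr hI
    have hr0 := hpos r (Ioc_subset_Icc_self hI)
    exact (hb.flux hU (h.slice r (hr hI)).holder e (x r) _ hr0).trans
      (by gcongr; exact hP.le_prim _ hr0)
  · simp only [sub_self, mul_zero, add_zero]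
    have : 0 ≤ C * U ^ 2 / ν * B s := mul_nonneg (by positivity) (hP.prim_nonneg s hs)
    linarith

/-- Since β decreases, the flux at every intermediate time is bounded by its value at s. No 1/ν is
lost, which suits long time steps. -/
lemma norm_heatSum_mode_sub_le_mul (h : ModeFlow α U M ν J S u x) (hP : Profile α β b B B' κ)
    (hb : StaticBounds d α β b C) (hα : 0 < α) (hν : 0 < ν) (hU : 0 ≤ U)
    {t₁ t₂ : ℝ} (h₁ : t₁ ∈ S) (h₂ : t₂ ∈ S) (h12 : t₁ ≤ t₂) (e : Fin d) {s : ℝ} (hs : 0 < s) :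
    ‖heatSum (fourierMode e (u t₂) (x t₂)) s
      - heatSum (fourierMode e (u t₁) (x t₁)) (s + ν * (t₂ - t₁))‖
      ≤ C * U ^ 2 * β s * (t₂ - t₁) := by
  rw [h.heatSum_mode_sub hα hν.le h₁ h₂ h12 e hs, ← abs_of_nonneg (sub_nonneg.mpr h12)]
  have hC := hb.const_nonneg
  refine intervalIntegral.norm_integral_le_of_norm_le_const_ae ?_
  filter_upwards [h.ae_Ioc h₁ h₂] with r hr hI
  rw [uIoc_of_le h12] at hI
  have h3 : s ≤ s + ν * (t₂ - r) := by
    have := mul_nonneg hν.le (sub_nonneg.mpr hI.2); linarith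
  refine (hb.flux hU (h.slice r (hr hI)).holder e (x r) _ (hs.trans_le h3)).trans ?_
  gcongr
  exact hP.antitoneOn hs (hs.trans_le h3) h3

/-- Viscous smoothing: Duhamel's formula from t₀ regularises the old slice for the heat time ν(t₁ -
t₀), while b integrates to β. The first term stays bounded as s tends to 0, whereas the static bound
s^{α/2-1} would be too singular. -/
lemma norm_heatSum_lamMul_mode_le (h : ModeFlow α U M ν J S u x) (hP : Profile α β b B B' κ)
    (hb : StaticBounds d α β b C) (hα : 0 < α) (hα1 : α ≤ 2) (hν : 0 < ν) (hU : 0 ≤ U)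
    {t₀ t₁ : ℝ} (h₀ : t₀ ∈ S) (h₁ : t₁ ∈ S) (h01 : t₀ < t₁) (e : Fin d) {s : ℝ} (hs : 0 < s) :
    ‖heatSum (lamMul (fourierMode e (u t₁) (x t₁))) s‖
      ≤ C * U * (ν * (t₁ - t₀)) ^ (α / 2 - 1) + C * U ^ 2 / ν * β s := by
  have hC := hb.const_nonneg
  have hh : 0 < ν * (t₁ - t₀) := mul_pos hν (sub_pos.mpr h01)
  have hpos : ∀ r ∈ Icc t₀ t₁, 0 < s + ν * (t₁ - r) := fun r hr => by
    have := mul_nonneg hν.le (sub_nonneg.mpr hr.2); linarith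
  have key : ‖heatSum (lamMul (fourierMode e (u t₁) (x t₁))) s
      - heatSum (lamMul (fourierMode e (u t₀) (x t₀))) (s + ν * (t₁ - t₀))‖
      ≤ C * U ^ 2 / ν * β s := by
    rw [h.heatSum_lamMul_sub hα hν.le h₀ h₁ h01.le e hs]
    refine (norm_integral_le_sub_of_hasDerivAt h01.le
      (G := fun r => C * U ^ 2 / ν * β (s + ν * (t₁ - r)))
      (G' := fun r => C * U ^ 2 * b (s + ν * (t₁ - r))) (fun r hr => ?_) (fun r hr => ?_) ?_).trans ?_
    · have h1 : HasDerivAt (fun r => s + ν * (t₁ - r)) (-ν) r := by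
        simpa using (((hasDerivAt_id r).const_sub t₁).const_mul ν).const_add s
      have h2 := ((hP.hasDerivAt _ (hpos r hr)).comp r h1).const_mul (C * U ^ 2 / ν)
      convert! h2 using 1
      field_simp
    · have := hP.pos (hpos r hr)
      positivity
    · filter_upwards [h.ae_Ioc h₀ h₁] with r hr hI
      exact hb.lamMul_flux hU (h.slice r (hr hI)).holder e (x r) _ (hpos r (Ioc_subset_Icc_self hI))
    · simp only [sub_self, mul_zero, add_zero]
      have : 0 ≤ C * U ^ 2 / ν * β (s + ν * (t₁ - t₀)) :=
        mul_nonneg (by positivity) (hP.nonneg _ (by positivity))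
      linarith
  have h2 := hb.lamMul_mode hU (h.slice t₀ h₀).holder e (x t₀) (s + ν * (t₁ - t₀)) (by positivity)
  have h3 : (s + ν * (t₁ - t₀)) ^ (α / 2 - 1) ≤ (ν * (t₁ - t₀)) ^ (α / 2 - 1) :=
    Real.rpow_le_rpow_of_nonpos hh (by linarith) (by linarith)
  have h4 := norm_le_norm_sub_add (heatSum (lamMul (fourierMode e (u t₁) (x t₁))) s)
    (heatSum (lamMul (fourierMode e (u t₀) (x t₀))) (s + ν * (t₁ - t₀)))
  have h5 : C * U * (s + ν * (t₁ - t₀)) ^ (α / 2 - 1) ≤ C * U * (ν * (t₁ - t₀)) ^ (α / 2 - 1) := by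
    gcongr
  linarith

/-- The increments of the velocity along a trajectory at small time scales. -/
lemma abs_velocity_sub_le_of_small (h : ModeFlow α U M ν J S u x) (hP : Profile α β b B B' κ)
    (hb : StaticBounds d α β b C) (hα : 0 < α) (hα1 : α ≤ 2) (hν : 0 < ν) (hU : 0 ≤ U)
    {t₀ t₁ t₂ : ℝ} (h₀ : t₀ ∈ S) (h₁ : t₁ ∈ S) (h₂ : t₂ ∈ S) (h01 : t₀ < t₁) (h12 : t₁ < t₂)
    (e : Fin d) :
    |u t₂ (x t₂) e - u t₁ (x t₁) e| ≤
      C * U * (ν * (t₁ - t₀)) ^ (α / 2 - 1) * (ν * (t₂ - t₁))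
        + 2 * (C * U ^ 2 / ν * B (ν * (t₂ - t₁))) := by
  have hC := hb.const_nonneg
  have hδ : 0 < ν * (t₂ - t₁) := mul_pos hν (sub_pos.mpr h12)
  set A := C * U * (ν * (t₁ - t₀)) ^ (α / 2 - 1) with hA
  have hA0 : 0 ≤ A := mul_nonneg (by positivity)
    (Real.rpow_nonneg (mul_nonneg hν.le (sub_nonneg.mpr h01.le)) _)
  -- Heat sums are controlled only at positive heat times, so both velocities are regularised at
  -- scale θ, which tends to 0 at the end.
  have hθ : ∀ θ, 0 < θ → |u t₂ (x t₂) e - u t₁ (x t₁) e| ≤ A * (ν * (t₂ - t₁))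
      + 2 * (C * U ^ 2 / ν * B (θ + ν * (t₂ - t₁))) + 2 * (C * U * θ ^ (α / 2)) := fun θ hθ => by
    have k1 := norm_heatSum_mode_sub_le h hP hb hα hν hU h₁ h₂ h12.le e hθ
    have k2 := norm_heatSum_sub_le (s := θ) (R := θ + ν * (t₂ - t₁))
      (β := fun r => A * r + C * U ^ 2 / ν * B r) (b := fun r => A * 1 + C * U ^ 2 / ν * B' r)
      (heatSummable_fourierMode ((h.slice t₁ h₁).holder.continuous hα)
        (h.slice t₁ h₁).holder.periodic e (x t₁)) hθ (by linarith)
      (fun r hr => ((hasDerivAt_id r).const_mul A).add ((hP.hasDerivAt_prim r hr).const_mul _))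
      (fun r hr => (norm_heatSum_lamMul_mode_le h hP hb hα hα1 hν hU h₀ h₁ h01 e
        (hθ.trans_le hr.1)).trans (by
          rw [mul_one]
          gcongr
          exact hP.le_prim r (hθ.trans_le hr.1)))
    have k3 := hb.mode_sub hU (h.slice t₁ h₁).holder e (x t₁) θ hθ
    have k4 := hb.mode_sub hU (h.slice t₂ h₂).holder e (x t₂) θ hθ
    have k5 : 0 ≤ C * U ^ 2 / ν * B θ := mul_nonneg (by positivity) (hP.prim_nonneg θ hθ)
    rw [← Real.norm_eq_abs, ← Complex.norm_real, Complex.ofReal_sub]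
    set w₂ := heatSum (fourierMode e (u t₂) (x t₂)) θ
    set w₁ := heatSum (fourierMode e (u t₁) (x t₁)) θ
    set w := heatSum (fourierMode e (u t₁) (x t₁)) (θ + ν * (t₂ - t₁))
    -- Evolution from t₁ to t₂, then the heat flow of the slice at t₁ from θ to θ + ν(t₂ - t₁), then
    -- the two regularisation errors.
    have k6 : ((u t₂ (x t₂) e : ℂ) - (u t₁ (x t₁) e : ℂ))
        = (w₂ - w) + (w - w₁) + ((w₁ - (u t₁ (x t₁) e : ℂ)) - (w₂ - (u t₂ (x t₂) e : ℂ))) := by ring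
    rw [k6]
    have k7 := norm_add₃_le (a := w₂ - w) (b := w - w₁)
      (c := (w₁ - (u t₁ (x t₁) e : ℂ)) - (w₂ - (u t₂ (x t₂) e : ℂ)))
    have k8 := norm_sub_le (w₁ - (u t₁ (x t₁) e : ℂ)) (w₂ - (u t₂ (x t₂) e : ℂ))
    have k9 : A * (θ + ν * (t₂ - t₁)) = A * θ + A * (ν * (t₂ - t₁)) := by ring
    linarith
  have hlim : Tendsto (fun θ => A * (ν * (t₂ - t₁))
      + 2 * (C * U ^ 2 / ν * B (θ + ν * (t₂ - t₁))) + 2 * (C * U * θ ^ (α / 2))) (𝓝[>] 0)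
      (𝓝 (A * (ν * (t₂ - t₁)) + 2 * (C * U ^ 2 / ν * B (0 + ν * (t₂ - t₁)))
        + 2 * (C * U * 0 ^ (α / 2)))) := by
    have hB : ContinuousAt B (0 + ν * (t₂ - t₁)) := by
      rw [zero_add]; exact (hP.hasDerivAt_prim _ hδ).continuousAt
    have hB2 : ContinuousAt (fun θ => B (θ + ν * (t₂ - t₁))) 0 :=
      ContinuousAt.comp (f := fun θ : ℝ => θ + ν * (t₂ - t₁)) hB (by fun_prop)
    have hp : ContinuousAt (fun θ : ℝ => θ ^ (α / 2)) 0 :=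
      Real.continuousAt_rpow_const _ _ (Or.inr (by positivity))
    have hc : ContinuousAt (fun θ => A * (ν * (t₂ - t₁))
      + 2 * (C * U ^ 2 / ν * B (θ + ν * (t₂ - t₁))) + 2 * (C * U * θ ^ (α / 2))) 0 := by fun_prop
    exact hc.tendsto.mono_left nhdsWithin_le_nhds
  have := ge_of_tendsto hlim (eventually_nhdsWithin_of_forall fun θ h => hθ θ h)
  simpa [Real.zero_rpow (by positivity : α / 2 ≠ 0)] using this

/-- The increments of the velocity along a trajectory at large time scales. -/
lemma abs_velocity_sub_le_of_large (h : ModeFlow α U M ν J S u x) (hP : Profile α β b B B' κ)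
    (hb : StaticBounds d α β b C) (hα : 0 < α) (hν : 0 < ν) (hU : 0 ≤ U)
    {t₁ t₂ : ℝ} (h₁ : t₁ ∈ S) (h₂ : t₂ ∈ S) (h12 : t₁ ≤ t₂) (e : Fin d) {s : ℝ} (hs : 0 < s) :
    |u t₂ (x t₂) e - u t₁ (x t₁) e| ≤ C * U * s ^ (α / 2)
      + C * U * (s + ν * (t₂ - t₁)) ^ (α / 2) + C * U ^ 2 * β s * (t₂ - t₁) := by
  have h3 := mul_nonneg hν.le (sub_nonneg.mpr h12)
  have k1 := norm_heatSum_mode_sub_le_mul h hP hb hα hν hU h₁ h₂ h12 e hs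
  have k3 := hb.mode_sub hU (h.slice t₁ h₁).holder e (x t₁) (s + ν * (t₂ - t₁)) (by linarith)
  have k4 := hb.mode_sub hU (h.slice t₂ h₂).holder e (x t₂) s hs
  rw [← Real.norm_eq_abs, ← Complex.norm_real, Complex.ofReal_sub]
  set w₂ := heatSum (fourierMode e (u t₂) (x t₂)) s
  set w := heatSum (fourierMode e (u t₁) (x t₁)) (s + ν * (t₂ - t₁))
  have k6 : ((u t₂ (x t₂) e : ℂ) - (u t₁ (x t₁) e : ℂ))
      = (w₂ - w) + ((w - (u t₁ (x t₁) e : ℂ)) - (w₂ - (u t₂ (x t₂) e : ℂ))) := by ring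
  rw [k6]
  have k7 := norm_add_le (w₂ - w) ((w - (u t₁ (x t₁) e : ℂ)) - (w₂ - (u t₂ (x t₂) e : ℂ)))
  have k8 := norm_sub_le (w - (u t₁ (x t₁) e : ℂ)) (w₂ - (u t₂ (x t₂) e : ℂ))
  linarith

end VelocityIncrements

/-! ### The two profiles and the choice of scales. -/

section Scaling

open Filter Topology

variable {d : ℕ}

/-- For α < 1/2 the power s^{α-3/2} is integrable at infinity and suffices alone; the constant
1/(1/2 - α) blows up at the endpoint. -/
lemma profile_rpow {α : ℝ} (hα : 0 < α) (hα1 : α < 1 / 2) :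
    Profile α (fun s => s ^ (α - 1 / 2)) (fun s => (1 / 2 - α) * s ^ (α - 3 / 2))
      (fun s => s ^ (α + 1 / 2) / (α + 1 / 2)) (fun s => s ^ (α - 1 / 2)) (1 / (1 / 2 - α)) where
  hasDerivAt s hs := by
    convert! Real.hasDerivAt_rpow_const (p := α - 1 / 2) (Or.inl hs.ne') using 1
    rw [show α - 1 / 2 - 1 = α - 3 / 2 by ring]; ring
  nonneg s hs := by positivity
  min_le s hs := by
    have : 1 / 2 - α ≠ 0 := by linarith
    rw [← mul_assoc, one_div_mul_cancel this, one_mul]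
    exact min_le_left _ _
  const_nonneg := by
    have : 0 < 1 / 2 - α := by linarith
    positivity
  hasDerivAt_prim s hs := by
    have h := (Real.hasDerivAt_rpow_const (p := α + 1 / 2) (Or.inl hs.ne')).div_const (α + 1 / 2)
    convert! h using 1
    have : α + 1 / 2 ≠ 0 := by linarith
    rw [show α + 1 / 2 - 1 = α - 1 / 2 by ring]
    field_simp
  le_prim s _ := le_rfl
  prim_nonneg s hs := by positivity

/-- At α = 1/2 the power s^{-1} is not integrable at infinity, so the minimum with s^{-3/2} is
needed. The derivative of log(1 + s^{-1/2}) has both asymptotics, and the summand s/2 in the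
primitive compensates for sβ' ≥ -1/2. -/
lemma profile_log :
    Profile (1 / 2) (fun s => Real.log (1 + s ^ (-(1 / 2) : ℝ)))
      (fun s => 1 / 2 * s ^ (-(3 / 2) : ℝ) / (1 + s ^ (-(1 / 2) : ℝ)))
      (fun s => s * Real.log (1 + s ^ (-(1 / 2) : ℝ)) + s / 2)
      (fun s => 1 * Real.log (1 + s ^ (-(1 / 2) : ℝ))
        + s * -(1 / 2 * s ^ (-(3 / 2) : ℝ) / (1 + s ^ (-(1 / 2) : ℝ))) + 1 / 2) 4 := by
  have hβ : ∀ s : ℝ, 0 < s → HasDerivAt (fun s : ℝ => Real.log (1 + s ^ (-(1 / 2) : ℝ)))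
      (-(1 / 2 * s ^ (-(3 / 2) : ℝ) / (1 + s ^ (-(1 / 2) : ℝ)))) s := fun s hs => by
    have h := ((Real.hasDerivAt_rpow_const (p := -(1 / 2)) (Or.inl hs.ne')).const_add 1).log
      (by positivity)
    convert! h using 1
    rw [show (-(1 / 2) - 1 : ℝ) = -(3 / 2) by ring]; ring
  have hβ0 : ∀ s : ℝ, 0 < s → 0 ≤ Real.log (1 + s ^ (-(1 / 2) : ℝ)) := fun s hs =>
    Real.log_nonneg (by have : 0 < s ^ (-(1 / 2) : ℝ) := by positivity
                        linarith)
  refine ⟨hβ, hβ0, fun s hs => ?_, by norm_num, fun s hs => ?_, fun s hs => ?_, fun s hs => ?_⟩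
  · have hr : 0 < s ^ (-(1 / 2) : ℝ) := by positivity
    have h1 : s ^ (1 / 2 - 3 / 2 : ℝ) * s ^ (-(1 / 2) : ℝ) = s ^ (-(3 / 2) : ℝ) := by
      rw [← Real.rpow_add hs]; norm_num
    have h2 : 0 < s ^ (-(3 / 2) : ℝ) := by positivity
    have h3 : 0 < s ^ (1 / 2 - 3 / 2 : ℝ) := by positivity
    rw [mul_div_assoc', le_div_iff₀ (by positivity)]
    have m1 := min_le_left (s ^ (1 / 2 - 3 / 2 : ℝ)) (s ^ (-(3 / 2) : ℝ))
    have m2 := min_le_right (s ^ (1 / 2 - 3 / 2 : ℝ)) (s ^ (-(3 / 2) : ℝ))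
    have m3 := mul_le_mul_of_nonneg_right m1 hr.le
    linarith
  · exact ((hasDerivAt_id s).mul (hβ s hs)).add ((hasDerivAt_id s).div_const 2)
  · have hr : 0 < s ^ (-(1 / 2) : ℝ) := by positivity
    have h1 : s * s ^ (-(3 / 2) : ℝ) = s ^ (-(1 / 2) : ℝ) := by
      rw [← Real.rpow_one_add' hs.le (by norm_num)]; norm_num
    have h2 : s * (1 / 2 * s ^ (-(3 / 2) : ℝ) / (1 + s ^ (-(1 / 2) : ℝ))) ≤ 1 / 2 := by
      rw [mul_div_assoc', div_le_iff₀ (by positivity)]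
      linarith
    linarith
  · exact add_nonneg (mul_nonneg hs.le (hβ0 s hs)) (by positivity)

/-- The modulus of continuity `w` is compatible with the profile `β` at the parabolic scale. -/
structure ScaledModulus (α : ℝ) (β B w : ℝ → ℝ) : Prop where
  rpow_le : ∀ ρ, 0 < ρ → ρ ^ (α / (1 - α)) ≤ w ρ
  profile_le : ∀ ρ, 0 < ρ → ρ * β (ρ ^ (2 / (1 - α))) ≤ 2 * w ρ
  prim_le : ∀ ρ N, 0 < ρ → ρ ^ (2 / (1 - α)) ≤ N → ρ * (B N / N) ≤ 3 * w ρ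

/-- The exponents match: 1 + (2/(1-α))(α - 1/2) = α/(1-α). For N above the parabolic scale,
N^{α-1/2} decreases, and 1/(α + 1/2) is at most 2. -/
lemma scaledModulus_rpow {α : ℝ} (hα : 0 < α) (hα1 : α < 1 / 2) :
    ScaledModulus α (fun s => s ^ (α - 1 / 2)) (fun s => s ^ (α + 1 / 2) / (α + 1 / 2))
      (fun ρ => ρ ^ (α / (1 - α))) := by
  have h0 : 1 - α ≠ 0 := by linarith
  have hβ : ∀ ρ : ℝ, 0 < ρ → ρ * (ρ ^ (2 / (1 - α))) ^ (α - 1 / 2) = ρ ^ (α / (1 - α)) :=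
    fun ρ hρ => by
      rw [← Real.rpow_mul hρ.le]
      nth_rewrite 1 [← Real.rpow_one ρ]
      rw [← Real.rpow_add hρ]
      congr 1
      field_simp
      ring
  refine ⟨fun ρ _ => le_rfl, fun ρ hρ => ?_, fun ρ N hρ hN => ?_⟩
  · simp only [hβ ρ hρ]
    have : 0 < ρ ^ (α / (1 - α)) := by positivity
    linarith
  · have hs : 0 < ρ ^ (2 / (1 - α)) := by positivity
    have hN0 := hs.trans_le hN
    have h1 : N ^ (α + 1 / 2) / (α + 1 / 2) / N = N ^ (α - 1 / 2) / (α + 1 / 2) := by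
      rw [div_right_comm, show α - 1 / 2 = α + 1 / 2 - 1 by ring, Real.rpow_sub_one hN0.ne']
    have h2 : N ^ (α - 1 / 2) ≤ (ρ ^ (2 / (1 - α))) ^ (α - 1 / 2) :=
      Real.rpow_le_rpow_of_nonpos hs hN (by linarith)
    simp only [h1]
    have h3 := mul_le_mul_of_nonneg_left h2 hρ.le
    rw [hβ ρ hρ] at h3
    have h4 : 0 < ρ ^ (α / (1 - α)) := by positivity
    rw [← mul_div_assoc, div_le_iff₀ (by linarith)]
    nlinarith

/-- At α = 1/2 the scale is ρ⁴, so the profile there is log(1 + ρ^{-2}), at most log 2 - 2 log⁻ ρ.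
-/
lemma scaledModulus_log :
    ScaledModulus (1 / 2) (fun s => Real.log (1 + s ^ (-(1 / 2) : ℝ)))
      (fun s => s * Real.log (1 + s ^ (-(1 / 2) : ℝ)) + s / 2)
      (fun ρ => ρ * (1 - logMinus ρ)) := by
  have hm : ∀ ρ, logMinus ρ ≤ 0 := fun ρ => min_le_right _ _
  have hβ : ∀ ρ : ℝ, 0 < ρ →
      Real.log (1 + (ρ ^ (2 / (1 - 1 / 2) : ℝ)) ^ (-(1 / 2) : ℝ)) ≤ 2 * (1 - logMinus ρ) :=
    fun ρ hρ => by
      rw [← Real.rpow_mul hρ.le, show (2 / (1 - 1 / 2) * -(1 / 2) : ℝ) = -2 by norm_num]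
      have h1 : 1 + ρ ^ (-2 : ℝ) ≤ 2 * Real.exp (-2 * logMinus ρ) := by
        have h2 : 1 ≤ Real.exp (-2 * logMinus ρ) := Real.one_le_exp (by linarith [hm ρ])
        have h3 : ρ ^ (-2 : ℝ) ≤ Real.exp (-2 * logMinus ρ) := by
          rw [Real.rpow_def_of_pos hρ]
          refine Real.exp_le_exp.mpr ?_
          have : logMinus ρ ≤ Real.log ρ := min_le_left _ _
          linarith
        linarith
      have h4 := Real.log_le_log (by positivity) h1
      rw [Real.log_mul (by norm_num) (Real.exp_pos _).ne', Real.log_exp] at h4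
      have h5 := Real.log_two_lt_d9
      linarith
  refine ⟨fun ρ hρ => ?_, fun ρ hρ => ?_, fun ρ N hρ hN => ?_⟩
  · rw [show (1 / 2 / (1 - 1 / 2) : ℝ) = 1 by norm_num, Real.rpow_one]
    nlinarith [hm ρ]
  · have := mul_le_mul_of_nonneg_left (hβ ρ hρ) hρ.le
    linarith
  · have hs : 0 < ρ ^ (2 / (1 - 1 / 2) : ℝ) := by positivity
    have hN0 := hs.trans_le hN
    have h1 : (N * Real.log (1 + N ^ (-(1 / 2) : ℝ)) + N / 2) / N
        = Real.log (1 + N ^ (-(1 / 2) : ℝ)) + 1 / 2 := by field_simp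
    have h2 := profile_log.antitoneOn hs hN0 hN
    rw [h1]
    have h3 := hβ ρ hρ
    have h4 := mul_le_mul_of_nonneg_left
      (show Real.log (1 + N ^ (-(1 / 2) : ℝ)) + 1 / 2 ≤ 3 * (1 - logMinus ρ) by
        linarith [hm ρ]) hρ.le
    linarith

variable {α U M ν C κ : ℝ} {S : Set ℝ} {u : ℝ → Space d → Space d}
    {x : ℝ → Space d} {β b B B' w : ℝ → ℝ} {T : EReal}

lemma ModeFlow.exists_mem_le {J : Set ℝ} (h : ModeFlow α U M ν J S u x) {t : ℝ} (ht : 0 < t)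
    (hJ : Ioc 0 t ⊆ J) : ∃ s ∈ S, s ≤ t := by
  by_contra! hcon
  have h1 : volume (Ioc 0 t) = 0 := by
    refine measure_mono_null (fun r hr => ?_) h.ae_mem
    exact fun h2 => (hcon r (h2 (hJ hr))).not_ge hr.2
  simp at h1
  linarith

/-- For N = νδ and ρ = Uδ, the quantity (N/ρ)^{2/(1+α)} is ν times the threshold time of the
theorem. The left side is a power of ρ times N^{(2α-1)/(1+α)}; as α ≤ 1/2 this exponent is
nonpositive, and the worst case is N at the parabolic scale, with equality. -/
lemma rpow_scale_le {N ρ : ℝ} (hα : 0 < α) (hα1 : α ≤ 1 / 2) (hρ : 0 < ρ)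
    (hN : ρ ^ (2 / (1 - α)) ≤ N) :
    ((N / ρ) ^ (2 / (1 + α))) ^ (α / 2 - 1) * N ≤ ρ ^ (α / (1 - α)) := by
  have hs : 0 < ρ ^ (2 / (1 - α)) := by positivity
  have hN0 := hs.trans_le hN
  have h0 : 1 - α ≠ 0 := by linarith
  have h0' : 1 + α ≠ 0 := by linarith
  have e1 : ((N / ρ) ^ (2 / (1 + α))) ^ (α / 2 - 1) * N
      = ρ ^ ((2 - α) / (1 + α)) * N ^ ((2 * α - 1) / (1 + α)) := by
    rw [← Real.rpow_mul (by positivity), Real.div_rpow hN0.le hρ.le, div_eq_mul_inv,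
      ← Real.rpow_neg hρ.le, mul_right_comm, ← Real.rpow_add_one hN0.ne', mul_comm]
    congr 2 <;> field_simp <;> ring
  rw [e1]
  calc _ ≤ ρ ^ ((2 - α) / (1 + α)) * (ρ ^ (2 / (1 - α))) ^ ((2 * α - 1) / (1 + α)) := by
        refine mul_le_mul_of_nonneg_left (Real.rpow_le_rpow_of_nonpos hs hN ?_) (by positivity)
        exact div_nonpos_of_nonpos_of_nonneg (by linarith) (by linarith)
    _ = ρ ^ (α / (1 - α)) := by
        rw [← Real.rpow_mul hρ.le, ← Real.rpow_add hρ]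
        congr 1
        field_simp
        ring

/-- The origin of the factor a⁻¹ + 1: the exponent lies between -1 and 0. -/
lemma half_rpow_le {a : ℝ} (hα : 0 < α) (hα1 : α ≤ 1 / 2) (ha : 0 < a) :
    (a / 2) ^ (α / 2 - 1) ≤ 2 * (a⁻¹ + 1) := by
  have ha' : 0 < a⁻¹ := by positivity
  rcases le_total 1 (a / 2) with h | h
  · have := Real.rpow_le_one_of_one_le_of_nonpos h (by linarith : α / 2 - 1 ≤ 0)
    linarith
  · have := Real.rpow_le_rpow_of_exponent_ge (by positivity) h (by linarith : -1 ≤ α / 2 - 1)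
    rw [Real.rpow_neg_one, inv_div] at this
    have h2 : 2 / a = 2 * a⁻¹ := by ring
    linarith

/-- The modulus of continuity of the velocity along a trajectory. -/
lemma abs_velocity_sub_le (h : ModeFlow α U M ν (timeInterval T) S u x)
    (hP : Profile α β b B B' κ) (hb : StaticBounds d α β b C) (hw : ScaledModulus α β B w)
    (hα : 0 < α) (hα1 : α ≤ 1 / 2) (hν : 0 < ν) (hU : 0 ≤ U) {a t₁ t₂ : ℝ} (ha : 0 < a)
    (h₁ : t₁ ∈ S) (h₂ : t₂ ∈ S) (h12 : t₁ < t₂)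
    (hat : a * U ^ (-2 / (1 + α)) * ν ^ ((1 - α) / (1 + α)) ≤ t₁) (e : Fin d) :
    |u t₂ (x t₂) e - u t₁ (x t₁) e| ≤ 8 * C * (a⁻¹ + 1) * (U * w (U * (t₂ - t₁))) := by
  have hC := hb.const_nonneg
  have hJ₁ := h.subset h₁
  have ht1 : 0 < t₁ := hJ₁.1
  -- Half of the elapsed time is kept for viscous smoothing, so t₁ - t₀ ≥ t₁/2.
  obtain ⟨t₀, h₀, h0t⟩ := h.exists_mem_le (half_pos ht1) fun r hr => ⟨hr.1, lt_of_le_of_lt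
    (by exact_mod_cast (hr.2.trans (half_le_self ht1.le))) hJ₁.2⟩
  have hsmall := abs_velocity_sub_le_of_small h hP hb hα (by linarith) hν hU h₀ h₁ h₂
    (by linarith) h12 e
  rcases hU.eq_or_lt with rfl | hU
  · simpa using hsmall
  have hδ : 0 < t₂ - t₁ := sub_pos.mpr h12
  set ρ := U * (t₂ - t₁) with hρ
  have hρ0 : 0 < ρ := by positivity
  -- The heat time at which the regularisation error U s^{α/2} equals U ρ^{α/(1-α)}.
  set s := ρ ^ (2 / (1 - α)) with hs
  have hs0 : 0 < s := by positivity
  have hγ := hw.rpow_le ρ hρ0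
  have hγ0 : 0 < ρ ^ (α / (1 - α)) := by positivity
  have ha' : 0 < a⁻¹ := by positivity
  have hw0 : 0 < w ρ := hγ0.trans_le hγ
  have hfin : 8 * C * (U * w ρ) ≤ 8 * C * (a⁻¹ + 1) * (U * w ρ) := by
    have : 0 ≤ 8 * C * (U * w ρ) * a⁻¹ := by positivity
    linarith
  set N := ν * (t₂ - t₁) with hN
  have hN0 : 0 < N := by positivity
  rcases le_total s N with hsN | hNs
  · have e1 : C * U ^ 2 / ν * B N = C * U * (ρ * (B N / N)) := by
      rw [hρ, hN]; field_simp
    have k1 := mul_le_mul_of_nonneg_left (hw.prim_le ρ N hρ0 hsN) (by positivity : 0 ≤ C * U)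
    -- The lower bound on t₁, written in the scaled variables of `rpow_scale_le`.
    have e2 : a / 2 * (N / ρ) ^ (2 / (1 + α)) ≤ ν * (t₁ - t₀) := by
      have e3 : N / ρ = ν / U := by rw [hρ, hN]; field_simp
      have e4 : (N / ρ) ^ (2 / (1 + α))
          = ν * (U ^ (-2 / (1 + α)) * ν ^ ((1 - α) / (1 + α))) := by
        rw [e3, Real.div_rpow hν.le hU.le, div_eq_mul_inv, ← Real.rpow_neg hU.le, mul_left_comm,
          ← Real.rpow_one_add' hν.le, mul_comm]
        · congr 2
          · ring
          · field_simp; ring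
        · have : 0 ≤ (1 - α) / (1 + α) := div_nonneg (by linarith) (by linarith)
          linarith
      rw [e4]
      have := mul_le_mul_of_nonneg_left (show a / 2 * (U ^ (-2 / (1 + α)) *
        ν ^ ((1 - α) / (1 + α))) ≤ t₁ - t₀ by linarith) hν.le
      linarith
    have k2 : (ν * (t₁ - t₀)) ^ (α / 2 - 1) * N ≤ 2 * (a⁻¹ + 1) * w ρ := by
      calc _ ≤ (a / 2 * (N / ρ) ^ (2 / (1 + α))) ^ (α / 2 - 1) * N := by
            gcongr 1
            exact Real.rpow_le_rpow_of_nonpos (by positivity) e2 (by linarith)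
        _ = (a / 2) ^ (α / 2 - 1) * (((N / ρ) ^ (2 / (1 + α))) ^ (α / 2 - 1) * N) := by
            rw [Real.mul_rpow (by positivity) (by positivity), mul_assoc]
        _ ≤ 2 * (a⁻¹ + 1) * w ρ := by
            gcongr
            · exact half_rpow_le hα hα1 ha
            · exact (rpow_scale_le hα hα1 hρ0 hsN).trans hγ
    have k3 := mul_le_mul_of_nonneg_left k2 (by positivity : 0 ≤ C * U)
    have k4 : 0 ≤ C * U * w ρ * a⁻¹ := by positivity
    rw [e1] at hsmall
    nlinarith
  · have hl := abs_velocity_sub_le_of_large h hP hb hα hν hU.le h₁ h₂ h12.le e hs0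
    have e1 : s ^ (α / 2) = ρ ^ (α / (1 - α)) := by
      rw [hs, ← Real.rpow_mul hρ0.le]; congr 1
      have : 1 - α ≠ 0 := by linarith
      field_simp
    have e2 : (s + N) ^ (α / 2) ≤ 2 * ρ ^ (α / (1 - α)) := by
      calc (s + N) ^ (α / 2) ≤ (2 * s) ^ (α / 2) := by gcongr; linarith
        _ = 2 ^ (α / 2) * s ^ (α / 2) := Real.mul_rpow (by norm_num) hs0.le
        _ ≤ 2 ^ (1 : ℝ) * s ^ (α / 2) := by gcongr <;> linarith
        _ = _ := by rw [e1, Real.rpow_one]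
    have e3 : C * U ^ 2 * β s * (t₂ - t₁) = C * U * (ρ * β s) := by rw [hρ]; ring
    have k1 := mul_le_mul_of_nonneg_left (hw.profile_le ρ hρ0) (by positivity : 0 ≤ C * U)
    have k2 := mul_le_mul_of_nonneg_left (e2.trans (mul_le_mul_of_nonneg_left hγ zero_le_two))
      (by positivity : 0 ≤ C * U)
    have k3 := mul_le_mul_of_nonneg_left hγ (by positivity : 0 ≤ C * U)
    rw [e1, e3] at hl
    have k4 : 0 ≤ C * U * w ρ := by positivity
    linarith

end Scaling

/-! ### From almost every time to every time. -/

section Modulus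

open Filter Topology

/-- A primitive of a function that has a modulus of continuity on a set of full measure is
differentiable, and its derivative has the same modulus of continuity. -/
lemma differentiableAt_of_ae_modulus {E : Type*} [NormedAddCommGroup E] [NormedSpace ℝ E]
    [CompleteSpace E] {J S : Set ℝ} (hJ : IsOpen J) {x V : ℝ → E} {w : ℝ → ℝ}
    (hS : ∀ᵐ t, t ∈ J → t ∈ S) (hw : Continuous w) (hw0 : w 0 = 0)
    (hV : ∀ t₁ ∈ S, ∀ t₂ ∈ S, ‖V t₁ - V t₂‖ ≤ w (t₁ - t₂))
    (hx : ∀ s ∈ J, ∀ t ∈ J, IntervalIntegrable V volume s t ∧ x t = x s + ∫ r in s..t, V r) :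
    (∀ t ∈ J, DifferentiableAt ℝ x t) ∧
      ∀ t₁ ∈ J, ∀ t₂ ∈ J, ‖deriv x t₁ - deriv x t₂‖ ≤ w (t₁ - t₂) := by
  -- Limits are taken along neighbourhoods of t modulo null sets. This filter contains S and is
  -- proper because neighbourhoods have positive measure; V is Cauchy along it, and its limit is the
  -- derivative of x at t, even if t is not in S.
  have hmem : ∀ t ∈ J, S ∈ 𝓝 t ⊓ ae volume := fun t ht => by
    have h1 : J ∈ 𝓝 t ⊓ ae volume := mem_inf_of_left (hJ.mem_nhds ht)
    have h2 : {t | t ∈ J → t ∈ S} ∈ 𝓝 t ⊓ ae volume := mem_inf_of_right hS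
    filter_upwards [h1, h2] with r h3 h4 using h4 h3
  have hne : ∀ t : ℝ, (𝓝 t ⊓ ae volume).NeBot := fun t => by
    rw [inf_neBot_iff]
    intro s hs s' hs'
    by_contra hcon
    rw [not_nonempty_iff_eq_empty, ← disjoint_iff_inter_eq_empty] at hcon
    exact (Measure.measure_pos_of_mem_nhds volume hs).ne'
      (measure_mono_null hcon.subset_compl_right hs')
  have hlim : ∀ t ∈ J, ∃ L, Tendsto V (𝓝 t ⊓ ae volume) (𝓝 L) := fun t ht => by
    have := hne t
    refine cauchy_map_iff_exists_tendsto.mp ?_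
    rw [cauchy_map_iff]
    refine ⟨hne t, ?_⟩
    rw [Metric.uniformity_eq_comap_nhds_zero, tendsto_comap_iff]
    have h1 : Tendsto (fun p : ℝ × ℝ => w (p.1 - p.2))
        ((𝓝 t ⊓ ae volume) ×ˢ (𝓝 t ⊓ ae volume)) (𝓝 0) := by
      have h2 : Tendsto (fun p : ℝ × ℝ => w (p.1 - p.2)) (𝓝 t ×ˢ 𝓝 t) (𝓝 (w (t - t))) := by
        rw [← nhds_prod_eq]
        exact (by fun_prop : Continuous fun p : ℝ × ℝ => w (p.1 - p.2)).tendsto (t, t)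
      rw [sub_self, hw0] at h2
      exact h2.mono_left (Filter.prod_mono inf_le_left inf_le_left)
    refine squeeze_zero' (Eventually.of_forall fun p => dist_nonneg) ?_ h1
    filter_upwards [prod_mem_prod (hmem t ht) (hmem t ht)] with p hp
    simp only [Function.comp, dist_eq_norm]
    exact hV _ hp.1 _ hp.2
  have hderiv : ∀ t ∈ J, ∀ L, Tendsto V (𝓝 t ⊓ ae volume) (𝓝 L) → HasDerivAt x L t := by
    intro t ht L hL
    obtain ⟨η, hη, hball⟩ := Metric.isOpen_iff.mp hJ t ht
    have hs : t - η / 2 ∈ J := hball (by rw [Metric.mem_ball, Real.dist_eq, abs_lt]; constructor <;> linarith)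
    have hs' : t + η / 2 ∈ J := hball (by rw [Metric.mem_ball, Real.dist_eq, abs_lt]; constructor <;> linarith)
    have hm : StronglyMeasurableAtFilter V (𝓝 t) volume := by
      refine ⟨Ioc (t - η / 2) (t + η / 2), Ioc_mem_nhds (by linarith) (by linarith), ?_⟩
      exact ((hx _ hs _ hs').1.1).aestronglyMeasurable
    have h1 := (intervalIntegral.integral_hasDerivAt_of_tendsto_ae_right (hx _ hs _ ht).1 hm
      hL).const_add (x (t - η / 2))
    refine h1.congr_of_eventuallyEq ?_
    filter_upwards [hJ.mem_nhds ht] with r hr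
    exact (hx _ hs _ hr).2
  refine ⟨fun t ht => ?_, fun t₁ h₁ t₂ h₂ => ?_⟩
  · obtain ⟨L, hL⟩ := hlim t ht
    exact (hderiv t ht L hL).differentiableAt
  · obtain ⟨L₁, hL₁⟩ := hlim t₁ h₁
    obtain ⟨L₂, hL₂⟩ := hlim t₂ h₂
    have := hne t₁
    have := hne t₂
    rw [(hderiv t₁ h₁ L₁ hL₁).deriv, (hderiv t₂ h₂ L₂ hL₂).deriv]
    have h1 : Tendsto (fun p : ℝ × ℝ => ‖V p.1 - V p.2‖)
        ((𝓝 t₁ ⊓ ae volume) ×ˢ (𝓝 t₂ ⊓ ae volume)) (𝓝 ‖L₁ - L₂‖) :=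
      ((hL₁.comp tendsto_fst).sub (hL₂.comp tendsto_snd)).norm
    have h2 : Tendsto (fun p : ℝ × ℝ => w (p.1 - p.2))
        ((𝓝 t₁ ⊓ ae volume) ×ˢ (𝓝 t₂ ⊓ ae volume)) (𝓝 (w (t₁ - t₂))) := by
      have h3 : Tendsto (fun p : ℝ × ℝ => w (p.1 - p.2)) (𝓝 t₁ ×ˢ 𝓝 t₂) (𝓝 (w (t₁ - t₂))) := by
        rw [← nhds_prod_eq]
        exact (by fun_prop : Continuous fun p : ℝ × ℝ => w (p.1 - p.2)).tendsto (t₁, t₂)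
      exact h3.mono_left (Filter.prod_mono inf_le_left inf_le_left)
    refine le_of_tendsto_of_tendsto h1 h2 ?_
    filter_upwards [prod_mem_prod (hmem t₁ h₁) (hmem t₂ h₂)] with p hp
    exact hV _ hp.1 _ hp.2

end Modulus

/-! ### Regularity of trajectories. -/

section Trajectories

open Filter Topology

lemma norm_le_of_abs_apply_le {d : ℕ} {w : Space d} {K : ℝ} (h : ∀ e, |w e| ≤ K) :
    ‖w‖ ≤ d * K := by
  have h1 : w = ∑ e, EuclideanSpace.single e (w e) := by
    ext i
    simp [Finset.sum_apply, Pi.single_apply]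
  rw [h1]
  refine (norm_sum_le _ _).trans ?_
  refine (Finset.sum_le_sum fun e _ => (?_ : _ ≤ K)).trans (by simp)
  simpa using h e

/-- The regularity of trajectories, for a general modulus of continuity. -/
lemma exists_trajectory_bound (d : ℕ) {α : ℝ≥0} (hα : 0 < α) (hα' : (α : ℝ) ≤ 1 / 2)
    {β b B B' w : ℝ → ℝ} {κ : ℝ} (hP : Profile α β b B B' κ) (hw : ScaledModulus α β B w)
    (hwc : Continuous fun ρ => w |ρ|) (hw0 : w 0 = 0) :
    ∃ C : ℝ, 0 < C ∧ ∀ (ν : ℝ) (T : EReal) (u₀ : Space d → Space d) (u : ℝ → Space d → Space d)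
      (x : ℝ → Space d), 0 < ν → MemLinftyHolder α T u → IsWeakSolution ν T u₀ u →
      IsTrajectory T u x →
      (∀ t ∈ timeInterval T, DifferentiableAt ℝ x t) ∧
      ∀ a : ℝ, 0 < a → ∀ t₁ ∈ timeInterval T, ∀ t₂ ∈ timeInterval T,
        a * holderNorm α T u ^ (-2 / (1 + (α : ℝ))) * ν ^ ((1 - (α : ℝ)) / (1 + (α : ℝ))) ≤ t₁ →
        a * holderNorm α T u ^ (-2 / (1 + (α : ℝ))) * ν ^ ((1 - (α : ℝ)) / (1 + (α : ℝ))) ≤ t₂ →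
        ‖deriv x t₁ - deriv x t₂‖ ≤ C * (a⁻¹ + 1) *
          (holderNorm α T u * w (holderNorm α T u * |t₁ - t₂|)) := by
  have hα0 : (0 : ℝ) < α := by exact_mod_cast hα
  obtain ⟨C, hb⟩ := exists_staticBounds d hα0 hα' hP
  have hC := hb.const_nonneg
  -- The summand 1 keeps the constant positive when d or C is 0.
  refine ⟨d * (16 * C) + 1, by positivity, fun ν T u₀ u x hν hu hs hx => ?_⟩
  set U := holderNorm α T u with hUdef
  have hU : 0 ≤ U := ENNReal.toReal_nonneg
  set τ := U ^ (-2 / (1 + (α : ℝ))) * ν ^ ((1 - (α : ℝ)) / (1 + (α : ℝ))) with hτ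
  have hτ0 : 0 ≤ τ := mul_nonneg (Real.rpow_nonneg hU _) (Real.rpow_nonneg hν.le _)
  have hwn : ∀ ρ, 0 ≤ ρ → 0 ≤ w ρ := fun ρ hρ => by
    rcases hρ.eq_or_lt with rfl | hρ
    · rw [hw0]
    · exact (by positivity : 0 ≤ ρ ^ ((α : ℝ) / (1 - α))).trans (hw.rpow_le ρ hρ)
  rcases (timeInterval T).eq_empty_or_nonempty with hT | hT
  · simp [hT]
  obtain ⟨M, hM, hg⟩ := ae_goodSlice hu hs
  obtain ⟨S, hS⟩ := exists_modeFlow hα0 hM hu.measurable hs hx hT hg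
  -- The strict condition t > aτ makes the set of times open, as the passage to every time requires.
  have hmain : ∀ a : ℝ, 0 < a →
      (∀ t ∈ timeInterval T ∩ Ioi (a * τ), DifferentiableAt ℝ x t) ∧
      ∀ t₁ ∈ timeInterval T ∩ Ioi (a * τ), ∀ t₂ ∈ timeInterval T ∩ Ioi (a * τ),
        ‖deriv x t₁ - deriv x t₂‖ ≤
          d * (8 * C * (a⁻¹ + 1) * (U * w |U * (t₁ - t₂)|)) := fun a ha => by
    have hV : ∀ t₁ ∈ S ∩ Ioi (a * τ), ∀ t₂ ∈ S ∩ Ioi (a * τ), t₁ < t₂ →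
        ‖u t₂ (x t₂) - u t₁ (x t₁)‖ ≤ d * (8 * C * (a⁻¹ + 1) * (U * w (U * (t₂ - t₁)))) :=
      fun t₁ h₁ t₂ h₂ h12 => norm_le_of_abs_apply_le fun e => by
        rw [PiLp.sub_apply]
        exact abs_velocity_sub_le hS hP hb hw hα0 hα' hν hU ha h₁.1 h₂.1 h12
          (by rw [mul_assoc]; exact (mem_Ioi.mp h₁.2).le) e
    refine differentiableAt_of_ae_modulus ((isOpen_timeInterval T).inter isOpen_Ioi)
      (S := S ∩ Ioi (a * τ)) (V := fun r => u r (x r))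
      (w := fun δ => d * (8 * C * (a⁻¹ + 1) * (U * w |U * δ|))) ?_ ?_ ?_ ?_ ?_
    · filter_upwards [hS.ae_mem] with t ht h using ⟨ht h.1, h.2⟩
    · have : Continuous fun δ => w |U * δ| := hwc.comp (continuous_const_mul U)
      exact continuous_const.mul (continuous_const.mul (continuous_const.mul this))
    · simp [hw0]
    · intro t₁ h₁ t₂ h₂
      rw [abs_mul, abs_of_nonneg hU]
      rcases lt_trichotomy t₁ t₂ with h | rfl | h
      · rw [norm_sub_rev, abs_sub_comm, abs_of_pos (sub_pos.mpr h)]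
        exact hV t₁ h₁ t₂ h₂ h
      · simp [hw0]
      · rw [abs_of_pos (sub_pos.mpr h)]
        exact hV t₂ h₂ t₁ h₁ h
    · exact fun s hs t ht => hx s hs.1 t ht.1
  refine ⟨fun t ht => ?_, fun a ha t₁ h₁ t₂ h₂ ha₁ ha₂ => ?_⟩
  · have ht0 : 0 < t := ht.1
    -- Differentiability needs no lower bound on t, since a may depend on t; adding 1 to τ covers τ
    -- = 0.
    refine (hmain (t / (τ + 1)) (by positivity)).1 t ⟨ht, ?_⟩
    rw [mem_Ioi, div_mul_eq_mul_div, div_lt_iff₀ (by positivity)]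
    linarith
  · rw [mul_assoc, ← hτ] at ha₁ ha₂
    have hI : ∀ t, t ∈ timeInterval T → a * τ ≤ t → t ∈ timeInterval T ∩ Ioi (a / 2 * τ) :=
      fun t ht hat => ⟨ht, by
        have ht0 : 0 < t := ht.1
        have : 0 ≤ a * τ := by positivity
        rw [mem_Ioi]; linarith⟩
    -- Halving a turns t ≥ aτ into a strict inequality, at the cost of a factor 2 in the constant.
    refine ((hmain (a / 2) (by positivity)).2 t₁ (hI t₁ h₁ ha₁) t₂ (hI t₂ h₂ ha₂)).trans ?_
    rw [abs_mul, abs_of_nonneg hU]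
    have hX : 0 ≤ U * w (U * |t₁ - t₂|) := mul_nonneg hU (hwn _ (by positivity))
    have h3 : (a / 2)⁻¹ + 1 ≤ 2 * (a⁻¹ + 1) := by
      rw [inv_div, div_eq_mul_inv]; linarith
    calc (d : ℝ) * (8 * C * ((a / 2)⁻¹ + 1) * (U * w (U * |t₁ - t₂|)))
        ≤ d * (8 * C * (2 * (a⁻¹ + 1)) * (U * w (U * |t₁ - t₂|))) := by gcongr
      _ = d * (16 * C) * (a⁻¹ + 1) * (U * w (U * |t₁ - t₂|)) := by ring
      _ ≤ (d * (16 * C) + 1) * (a⁻¹ + 1) * (U * w (U * |t₁ - t₂|)) := by gcongr; linarith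

/-- Multiplying the minimum through by |ρ| leaves |ρ| log |ρ|, which is continuous at 0. -/
lemma continuous_abs_mul_one_sub_logMinus :
    Continuous fun ρ : ℝ => |ρ| * (1 - logMinus |ρ|) := by
  have h : (fun ρ : ℝ => |ρ| * (1 - logMinus |ρ|))
      = fun ρ => |ρ| - min (|ρ| * Real.log |ρ|) 0 := by
    ext ρ
    rw [mul_sub, mul_one, logMinus, mul_min_of_nonneg _ _ (abs_nonneg ρ), mul_zero]
  rw [h]
  have := Real.continuous_mul_log.comp (continuous_abs (G := ℝ))
  exact continuous_abs.sub (this.min continuous_const)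

end Trajectories

end NavierStokes

end

/-! ### The two cases of the theorem. -/

theorem mainTheorem4 (d : ℕ) (α : ℝ≥0) (hα : 0 < α) (hα' : α ≤ 1 / 2) :
    ∃ C : ℝ, 0 < C ∧
      ∀ (ν : ℝ) (T : EReal) (u₀ : NavierStokes.Space d → NavierStokes.Space d)
        (u : ℝ → NavierStokes.Space d → NavierStokes.Space d) (x : ℝ → NavierStokes.Space d),
        0 < ν →
        NavierStokes.MemLinftyHolder α T u →
        NavierStokes.IsWeakSolution ν T u₀ u →
        NavierStokes.IsTrajectory T u x →
        (∀ t ∈ NavierStokes.timeInterval T, DifferentiableAt ℝ x t) ∧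
        ∀ a : ℝ, 0 < a →
        ∀ t₁ ∈ NavierStokes.timeInterval T, ∀ t₂ ∈ NavierStokes.timeInterval T,
          a * NavierStokes.holderNorm α T u ^ (-2 / (1 + (α : ℝ)))
              * ν ^ ((1 - (α : ℝ)) / (1 + (α : ℝ))) ≤ t₁ →
          a * NavierStokes.holderNorm α T u ^ (-2 / (1 + (α : ℝ)))
              * ν ^ ((1 - (α : ℝ)) / (1 + (α : ℝ))) ≤ t₂ →
          (α < 1 / 2 →
            ‖deriv x t₁ - deriv x t₂‖ ≤
              C * (a⁻¹ + 1) * NavierStokes.holderNorm α T u ^ (1 / (1 - (α : ℝ)))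
                * |t₁ - t₂| ^ ((α : ℝ) / (1 - (α : ℝ)))) ∧
          (α = 1 / 2 →
            ‖deriv x t₁ - deriv x t₂‖ ≤
              C * (a⁻¹ + 1) * NavierStokes.holderNorm α T u ^ (1 / (1 - (α : ℝ)))
                * |t₁ - t₂|
                * (1 - NavierStokes.logMinus (NavierStokes.holderNorm α T u * |t₁ - t₂|))) := by
  have hα0 : (0 : ℝ) < α := by exact_mod_cast hα
  rcases hα'.lt_or_eq with hlt | rfl
  · have hα1 : (α : ℝ) < 1 / 2 := by
      have h := NNReal.coe_lt_coe.mpr hlt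
      push_cast at h
      exact h
    have hγ : 0 < (α : ℝ) / (1 - α) := div_pos hα0 (by linarith)
    obtain ⟨C, hC, h⟩ := NavierStokes.exists_trajectory_bound d hα hα1.le
      (NavierStokes.profile_rpow hα0 hα1) (NavierStokes.scaledModulus_rpow hα0 hα1)
      (continuous_abs.rpow_const fun _ => Or.inr hγ.le) (Real.zero_rpow hγ.ne')
    refine ⟨C, hC, fun ν T u₀ u x hν hu hw hx => ⟨(h ν T u₀ u x hν hu hw hx).1,
      fun a ha t₁ h₁ t₂ h₂ ha₁ ha₂ => ⟨fun _ => ?_, fun heq => absurd heq hlt.ne⟩⟩⟩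
    refine ((h ν T u₀ u x hν hu hw hx).2 a ha t₁ h₁ t₂ h₂ ha₁ ha₂).trans_eq ?_
    have hU : 0 ≤ NavierStokes.holderNorm α T u := ENNReal.toReal_nonneg
    -- The general bound is U(Uδ)^{α/(1-α)}, so the powers of U add up to 1/(1-α).
    have e : 1 / (1 - (α : ℝ)) = 1 + (α : ℝ) / (1 - α) := by
      have : 1 - (α : ℝ) ≠ 0 := by linarith
      field_simp
      ring
    rw [Real.mul_rpow hU (abs_nonneg _), e, Real.rpow_one_add' hU (by positivity)]
    ring
  · have hc : (((1 / 2 : ℝ≥0)) : ℝ) = 1 / 2 := by push_cast; rfl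
    obtain ⟨C, hC, h⟩ := NavierStokes.exists_trajectory_bound d hα hc.le
      (by rw [hc]; exact NavierStokes.profile_log) (by rw [hc]; exact NavierStokes.scaledModulus_log)
      NavierStokes.continuous_abs_mul_one_sub_logMinus (by simp)
    refine ⟨C, hC, fun ν T u₀ u x hν hu hw hx => ⟨(h ν T u₀ u x hν hu hw hx).1,
      fun a ha t₁ h₁ t₂ h₂ ha₁ ha₂ => ⟨fun hlt => absurd hlt (lt_irrefl _), fun _ => ?_⟩⟩⟩
    refine ((h ν T u₀ u x hν hu hw hx).2 a ha t₁ h₁ t₂ h₂ ha₁ ha₂).trans_eq ?_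
    rw [hc, show (1 / (1 - 1 / 2) : ℝ) = 2 by norm_num, Real.rpow_two]
    ring
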